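/- There are a randomized program $\mathsf S$ and absolute constants $C, c$ such that the following holds for all integers $n, k \ge 0$ and $d \ge d_0 \ge 1$ and all reals $\epsilon, \delta, \gamma > 0$. Say that $f : \{0,1\}^n \to \mathbb{R}^d$ is $(\epsilon,\delta)$-concentrated at $\mu \in \mathbb{R}^d$ if $\Pr_{X}[\|f(X) - \mu\|_\infty > \epsilon] \le \delta$ for uniform $X \in \{0,1\}^n$. Let $\mathsf S$, on input $(n,k,d,d_0,\epsilon,\delta,\gamma)$, interact with an arbitrary, possibly randomized, owner $\mathsf O$ for $k$ rounds. In round $i$, $\mathsf O$ chooses, depending on $Y_1,\dots,Y_{i-1}$ and on its own randomness, a function $f_i : \{0,1\}^n \to \mathbb{R}^d$ that is $(\epsilon,\delta)$-concentrated at some point $\mu_i \in \mathbb{R}^d$; then $\mathsf S$ queries $f_i$ at a single point $X_i \in \{0,1\}^n$ of its choice, which $\mathsf O$ does not see; $\mathsf S$ learns $f_i(X_i)$ and nothing else about $f_i$, and gives a vector $Y_i \in \mathbb{R}^d$ to $\mathsf O$. Then $$\Pr\Big[\max_{i} \|Y_i - \mu_i\|_\infty > C \epsilon d_0\Big] \le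 k\delta + \gamma,$$ where the probability is over the randomness of $\mathsf S$ and of $\mathsf O$. Moreover $\mathsf S$ uses at most $$n + C\left(\frac{k d \log_2 (d_0+1)}{d_0} + (\log_2 k) \cdot \max\{0, \log_2 (1/\gamma)\}\right)$$ uniform random bits, and its total running time is at most $C\,(n + k + d + \max\{0,\log_2(1/\epsilon)\} + \max\{0,\log_2(1/\gamma)\} + 1)^c$ (with $\log_2 0$ read as $0$ if $k = 0$). Here a program is a program of a unit-cost random access machine with natural-number registers (operations: constants, $+$, truncated $-$, comparison) and real registers (operations: natural constants, $+$, $-$, comparison, and rounding a number down to an integer multiple of another); a random bit costs one step, a query $n+d+1$ steps and an answer $d+1$ steps. -/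

import Mathlib

open MeasureTheory

noncomputable section

namespace RandomnessSteward

/-! ### Concentrated functions and owners -/

/-- Bit strings of length `n`, i.e. elements of `{0,1}^n`. -/
abbrev Bits (n : ℕ) : Type := Fin n → Bool

/-- The probability that a uniformly random element of the finite type `α` lies in `E`. -/
def uniformProb {α : Type} [Fintype α] (E : Set α) : ℝ :=
  (E.ncard : ℝ) / (Fintype.card α : ℝ)

/-- `f : {0,1}^n → ℝ^d` is `(ε, δ)`-concentrated at `μ`: for uniform `X`,
`Pr[‖f X - μ‖_∞ > ε] ≤ δ`. (The norm of `Fin d → ℝ` is the sup norm.) -/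
def Concentrated {n d : ℕ} (ε δ : ℝ) (f : Bits n → Fin d → ℝ) (μ : Fin d → ℝ) : Prop :=
  uniformProb {x : Bits n | ε < ‖f x - μ‖} ≤ δ

/-- A deterministic owner. After having received the answers `h = [Y_1, …, Y_{i-1}]` it chooses
the function `f_i = func h`, which is `(ε, δ)`-concentrated at the point `μ_i = point h`.
(A randomized owner is a family of these, indexed by the points of a probability space.) -/
structure Owner (n d : ℕ) (ε δ : ℝ) where
  func : List (Fin d → ℝ) → Bits n → Fin d → ℝ
  point : List (Fin d → ℝ) → Fin d → ℝ
  concentrated : ∀ h, Concentrated ε δ (func h) (point h)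

/-! ### The machine model

Programs of a unit-cost random access machine with two memories, one of natural numbers and one of
real numbers, both with indirect addressing.

* On natural numbers the operations are constants, `+`, truncated `-` and comparison. There is no
  multiplication, so one assignment lengthens numbers by only `O(1)` bits, and `t` steps can be
  simulated in time polynomial in `t` and in the length of the input on a Turing machine.
* On real numbers the operations are natural constants, `+`, `-`, comparison, and rounding `x` down
  to a multiple of `y`. They map multiples of `1 / D` to multiples of `1 / D`, and the absolute
  value of the result is at most the sum of those of the arguments, so the preceding remark applies
  to rational data as well.

Program constants are natural numbers: there are no real numbers in a program. -/

/-- Expressions of type natural number. `mem a` is the content of the natural register with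
address `a`; `sub` is truncated subtraction. -/
inductive NExpr : Type
  | const (c : ℕ)
  | mem (a : NExpr)
  | add (a b : NExpr)
  | sub (a b : NExpr)

/-- Expressions of type real number. `mem a` is the content of the real register with
address `a`; `roundDown x y` is `x` rounded down to an integer multiple of `y`. -/
inductive RExpr : Type
  | const (c : ℕ)
  | mem (a : NExpr)
  | add (x y : RExpr)
  | sub (x y : RExpr)
  | roundDown (x y : RExpr)

/-- Tests. -/
inductive Test : Type
  | ltN (a b : NExpr)
  | ltR (x y : RExpr)
  | not (b : Test)

/-- Programs of a randomized machine that interacts with an owner. -/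
inductive Prog : Type
  | skip
  /-- Store the value of `e` in the natural register with address `a`. -/
  | setN (a e : NExpr)
  /-- Store the value of `x` in the real register with address `a`. -/
  | setR (a : NExpr) (x : RExpr)
  /-- Store a fresh random bit in the natural register with address `a`. -/
  | coin (a : NExpr)
  /-- Query the current function `f_i` at the point stored in the `n` natural registers from
  address `a` on, and store the result in the `d` real registers from address `b` on. -/
  | query (a b : NExpr)
  /-- Give to the owner the vector `Y_i` stored in the `d` real registers from address `a` on. -/
  | answer (a : NExpr)
  | seq (p q : Prog)
  | ite (b : Test) (p q : Prog)
  | loop (b : Test) (p : Prog)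

/-- A state of the machine during an interaction: the two memories, the random bits that have not
been used yet, the answers given so far (in chronological order), and whether the current function
has been queried. -/
structure State (d : ℕ) where
  nat : ℕ → ℕ
  real : ℕ → ℝ
  coins : List Bool
  answers : List (Fin d → ℝ)
  queried : Bool

/-- The value of a natural expression. -/
def NExpr.val {d : ℕ} (s : State d) : NExpr → ℕ
  | .const c => c
  | .mem a => s.nat (a.val s)
  | .add a b => a.val s + b.val s
  | .sub a b => a.val s - b.val s

/-- The value of a real expression. -/
def RExpr.val {d : ℕ} (s : State d) : RExpr → ℝ
  | .const c => (c : ℝ)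
  | .mem a => s.real (a.val s)
  | .add x y => x.val s + y.val s
  | .sub x y => x.val s - y.val s
  | .roundDown x y => (⌊x.val s / y.val s⌋ : ℝ) * y.val s

/-- The truth value of a test. -/
def Test.Holds {d : ℕ} (s : State d) : Test → Prop
  | .ltN a b => a.val s < b.val s
  | .ltR x y => x.val s < y.val s
  | .not b => ¬ b.Holds s

/-- The bit string in the `n` natural registers from address `a` on (nonzero means `1`). -/
def State.readBits {d : ℕ} (s : State d) (n a : ℕ) : Bits n :=
  fun j => decide (s.nat (a + j) ≠ 0)

/-- The vector in the `d` real registers from address `a` on. -/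
def State.readVec {d : ℕ} (s : State d) (a : ℕ) : Fin d → ℝ :=
  fun j => s.real (a + j)

/-- The real memory after the vector `w` is stored in the `d` registers from address `a` on. -/
def State.storeVec {d : ℕ} (s : State d) (a : ℕ) (w : Fin d → ℝ) : ℕ → ℝ :=
  fun b => if h : a ≤ b ∧ b - a < d then w ⟨b - a, h.2⟩ else s.real b

/-- `Exec k f p s t s'`: in an interaction of `k` rounds with an owner that chooses `f h` after the
answers `h`, program `p`, started in state `s`, halts after `t` steps in state `s'`.

In every round there is exactly one query, and it comes before the answer. A program that wants to
make another query, that gives an answer without having made the query, that goes on after the last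
round, or that asks for more random bits than there are, gets stuck and does not halt. -/
inductive Exec {n d : ℕ} (k : ℕ) (f : List (Fin d → ℝ) → Bits n → Fin d → ℝ) :
    Prog → State d → ℕ → State d → Prop
  | skip (s : State d) : Exec k f .skip s 1 s
  | setN (s : State d) (a e : NExpr) :
      Exec k f (.setN a e) s 1 { s with nat := Function.update s.nat (a.val s) (e.val s) }
  | setR (s : State d) (a : NExpr) (x : RExpr) :
      Exec k f (.setR a x) s 1 { s with real := Function.update s.real (a.val s) (x.val s) }
  | coin (s : State d) (a : NExpr) (b : Bool) (l : List Bool) (hs : s.coins = b :: l) :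
      Exec k f (.coin a) s 1
        { s with nat := Function.update s.nat (a.val s) b.toNat, coins := l }
  | query (s : State d) (a b : NExpr) (hk : s.answers.length < k) (hq : s.queried = false) :
      Exec k f (.query a b) s (n + d + 1)
        { s with
          real := s.storeVec (b.val s) (f s.answers (s.readBits n (a.val s)))
          queried := true }
  | answer (s : State d) (a : NExpr) (hk : s.answers.length < k) (hq : s.queried = true) :
      Exec k f (.answer a) s (d + 1)
        { s with
          answers := s.answers ++ [s.readVec (a.val s)]
          queried := false }
  | seq (p q : Prog) (s s₁ s₂ : State d) (t₁ t₂ : ℕ)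
      (h₁ : Exec k f p s t₁ s₁) (h₂ : Exec k f q s₁ t₂ s₂) :
      Exec k f (.seq p q) s (t₁ + t₂) s₂
  | iteTrue (b : Test) (p q : Prog) (s s₁ : State d) (t : ℕ)
      (hb : b.Holds s) (h : Exec k f p s t s₁) : Exec k f (.ite b p q) s (t + 1) s₁
  | iteFalse (b : Test) (p q : Prog) (s s₁ : State d) (t : ℕ)
      (hb : ¬ b.Holds s) (h : Exec k f q s t s₁) : Exec k f (.ite b p q) s (t + 1) s₁
  | loopTrue (b : Test) (p : Prog) (s s₁ s₂ : State d) (t₁ t₂ : ℕ)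
      (hb : b.Holds s) (h₁ : Exec k f p s t₁ s₁) (h₂ : Exec k f (.loop b p) s₁ t₂ s₂) :
      Exec k f (.loop b p) s (t₁ + t₂ + 1) s₂
  | loopFalse (b : Test) (p : Prog) (s : State d) (hb : ¬ b.Holds s) :
      Exec k f (.loop b p) s 1 s

/-- The initial state on natural inputs `ns`, real inputs `rs` and random bits `z`: the inputs are
in the first registers, all other registers contain `0`. -/
def State.init (d : ℕ) (ns : List ℕ) (rs : List ℝ) {m : ℕ} (z : Bits m) : State d where
  nat := fun a => ns.getD a 0
  real := fun a => rs.getD a 0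
  coins := List.ofFn z
  answers := []
  queried := false

/-! ### One-query stewards -/

/-- In the interaction of `O` with the program `p` on inputs `ns`, `rs` and random bits `z`, the
program halts after `t` steps, after having given exactly the `k` answers `Y_1, …, Y_k`. -/
def Transcript {n d m k : ℕ} {ε δ : ℝ} (p : Prog) (ns : List ℕ) (rs : List ℝ)
    (O : Owner n d ε δ) (z : Bits m) (t : ℕ) (Y : Fin k → Fin d → ℝ) : Prop :=
  ∃ s : State d, Exec k O.func p (State.init d ns rs z) t s ∧ s.answers = List.ofFn Y

/-- `max_i ‖Y_i - μ_i‖_∞ > ε'` when the owner `O` receives the answers `Y_1, …, Y_k`. -/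
def Fails {n d k : ℕ} {ε δ : ℝ} (ε' : ℝ) (O : Owner n d ε δ) (Y : Fin k → Fin d → ℝ) : Prop :=
  ∃ i : Fin k, ε' < ‖Y i - O.point ((List.ofFn Y).take i)‖

/-- On inputs `ns`, `rs`, the program `p` is a one-query `(ε', δ')`-steward for `k` adaptively chosen
`(ε, δ)`-concentrated functions `{0,1}^n → ℝ^d` that uses at most `m` random bits and runs in total
time at most `T`. -/
structure IsOneQuerySteward (p : Prog) (ns : List ℕ) (rs : List ℝ) (n k d : ℕ) (ε δ ε' δ' : ℝ)
    (m : ℕ) (T : ℝ) : Prop where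
  /-- Against every owner and for all random bits, the machine completes the `k` rounds, with
  one query in each, in time `T`. -/
  halts : ∀ (O : Owner n d ε δ) (z : Bits m),
    ∃ (t : ℕ) (Y : Fin k → Fin d → ℝ), Transcript p ns rs O z t Y ∧ (t : ℝ) ≤ T
  /-- Against every randomized owner, the failure probability, over the randomness `ω` of the owner
  and the independent uniform random bits `z` of the steward, is at most `δ'`. -/
  correct : ∀ (Ω : Type) [MeasurableSpace Ω] (P : Measure Ω) [IsProbabilityMeasure P]
    (O : Ω → Owner n d ε δ),
    ∫⁻ ω, ENNReal.ofReal (uniformProb {z : Bits m |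
        ∃ (t : ℕ) (Y : Fin k → Fin d → ℝ), Transcript p ns rs (O ω) z t Y ∧ Fails ε' (O ω) Y}) ∂P
      ≤ ENNReal.ofReal δ'

/-- `max (0, log₂ (1 / x))`. -/
def logInv (x : ℝ) : ℝ := max 0 (Real.logb 2 (1 / x))

end RandomnessSteward

end

/-!
Each query is answered by its value after shifting and rounding. With cells of width `2ε(d₀ + 1)`
and the `d₀ + 1` shifts by multiples of `2ε`, at most one shift of a coordinate of `f x` brings it
within `ε` of the boundary of a cell, so each block of `d₀` coordinates has a shift that is good
for all of them, and if `‖f x - μ‖ ≤ ε`, then `μ` is rounded to the same value after this shift.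
As long as all the queries hit, an answer is therefore determined by the shifts of the `⌈d / d₀⌉`
blocks, which can be chosen in at most `2 ^ D` ways, where `D` is about `d log (d₀ + 1) / d₀`.

Against a process with so few branches, independent queries can be replaced by those of a generator
that doubles the number of rounds by a random walk on the Margulis–Gabber–Galil expander, from the
seed of the first half to the seed of the second half. Only `2 ^ (D 2ⁱ)` states can be reached
after a first half of `2ⁱ` rounds, so by mixing a walk of length `O(D 2ⁱ + e)` makes the error of
level `i` at most `2⁻ᵉ`. The labels of the walks take `O(D k + e log k)` bits in total. The spectral
gap of the expander is an inequality between weights on the dual torus: a Schur test for the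
Fourier transform of the adjacency operator.
-/

noncomputable section

namespace RandomnessSteward

/-! ### The Fourier transform on `(ℤ/N)²` -/

/-- The group `(ℤ/N)²`, the vertex set of the Margulis–Gabber–Galil graph. -/
abbrev Torus (N : ℕ) : Type := ZMod N × ZMod N

/-- The discrete Fourier transform on `(ℤ/N)²`, unnormalized. -/
def torusFT {N : ℕ} [NeZero N] (f : Torus N → ℂ) (u : Torus N) : ℂ :=
  ∑ z : Torus N, f z * ZMod.stdAddChar (-(u.1 * z.1 + u.2 * z.2))

section Fourier

variable {N : ℕ} [NeZero N]

theorem sum_stdAddChar_mul (a : ZMod N) :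
    ∑ x : ZMod N, (ZMod.stdAddChar (x * a) : ℂ) = if a = 0 then (N : ℂ) else 0 := by
  rw [AddChar.sum_mulShift a (ZMod.isPrimitive_stdAddChar N), ZMod.card]
  split_ifs <;> simp only [Nat.cast_zero]

theorem sum_stdAddChar_torus (w : Torus N) :
    ∑ u : Torus N, (ZMod.stdAddChar (u.1 * w.1 + u.2 * w.2) : ℂ) =
      if w = 0 then (N : ℂ) ^ 2 else 0 := by
  obtain ⟨a, b⟩ := w
  rw [Fintype.sum_prod_type]
  simp only [AddChar.map_add_eq_mul, ← Finset.mul_sum, ← Finset.sum_mul, sum_stdAddChar_mul]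
  by_cases ha : a = 0 <;> by_cases hb : b = 0 <;> simp [ha, hb, sq]

theorem torusFT_mul_conj (f : Torus N → ℂ) (u : Torus N) :
    torusFT f u * (starRingEnd ℂ) (torusFT f u) =
      ∑ z, ∑ w, f z * (starRingEnd ℂ) (f w) *
        ZMod.stdAddChar (u.1 * (w - z).1 + u.2 * (w - z).2) := by
  simp only [torusFT, map_sum, map_mul, Finset.sum_mul_sum]
  refine Finset.sum_congr rfl fun z _ => Finset.sum_congr rfl fun w _ => ?_
  have split : u.1 * (w - z).1 + u.2 * (w - z).2 =
      -(u.1 * z.1 + u.2 * z.2) + (u.1 * w.1 + u.2 * w.2) := by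
    simp only [Prod.fst_sub, Prod.snd_sub]; ring
  rw [← AddChar.map_neg_eq_conj, neg_neg, split,
    AddChar.map_add_eq_mul _ (-(u.1 * z.1 + u.2 * z.2))]
  ring

theorem sum_norm_sq_torusFT (f : Torus N → ℂ) :
    ∑ u, ‖torusFT f u‖ ^ 2 = (N : ℝ) ^ 2 * ∑ z, ‖f z‖ ^ 2 := by
  have parseval : ∑ u, torusFT f u * (starRingEnd ℂ) (torusFT f u) =
      (N : ℂ) ^ 2 * ∑ z, f z * (starRingEnd ℂ) (f z) := by
    simp only [torusFT_mul_conj]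
    rw [Finset.sum_comm, Finset.mul_sum]
    refine Finset.sum_congr rfl fun z _ => ?_
    rw [Finset.sum_comm]
    simp only [← Finset.mul_sum, sum_stdAddChar_torus, sub_eq_zero, mul_ite, mul_zero,
      Finset.sum_ite_eq', Finset.mem_univ, if_true]
    ring
  simp only [Complex.mul_conj'] at parseval
  exact_mod_cast parseval

theorem torusFT_swap (f : Torus N → ℂ) (u : Torus N) :
    torusFT (fun z => f z.swap) u = torusFT f u.swap :=
  Fintype.sum_equiv (Equiv.prodComm _ _) _ _ fun z => by simp [add_comm]

theorem torusFT_shear_fst (f : Torus N → ℂ) (k c : ZMod N) (u : Torus N) :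
    torusFT (fun z => f (z.1 + k * z.2 + c, z.2)) u =
      ZMod.stdAddChar (c * u.1) * torusFT f (u.1, u.2 - k * u.1) := by
  simp only [torusFT, Finset.mul_sum]
  refine Finset.sum_nbij' (fun z => (z.1 + k * z.2 + c, z.2)) (fun z => (z.1 - k * z.2 - c, z.2))
    (by simp) (by simp) (fun z _ => by ext <;> simp; ring)
    (fun z _ => by ext <;> simp; ring) fun z _ => ?_
  rw [mul_left_comm, ← AddChar.map_add_eq_mul]
  congr 2
  ring

theorem torusFT_shear_snd (f : Torus N → ℂ) (k c : ZMod N) (u : Torus N) :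
    torusFT (fun z => f (z.1, z.2 + k * z.1 + c)) u =
      ZMod.stdAddChar (c * u.2) * torusFT f (u.1 - k * u.2, u.2) := by
  have h := torusFT_shear_fst (fun z => f z.swap) k c u.swap
  rwa [torusFT_swap, ← torusFT_swap] at h

/-- The norm of the averaged character value `(1 + e(a)) / 2`. -/
def cosWeight (a : ZMod N) : ℝ := ‖(1 + ZMod.stdAddChar a : ℂ)‖ / 2

theorem norm_one_add_stdAddChar (a : ZMod N) :
    ‖(1 + ZMod.stdAddChar a : ℂ)‖ = 2 * cosWeight a := by
  rw [cosWeight]; ring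

theorem cosWeight_neg (a : ZMod N) : cosWeight (-a) = cosWeight a := by
  rw [cosWeight, AddChar.map_neg_eq_conj, ← Complex.norm_conj]
  simp only [map_add, map_one, Complex.conj_conj, cosWeight]

theorem cosWeight_eq_abs_cos (a : ZMod N) :
    cosWeight a = |Real.cos (Real.pi * a.valMinAbs / N)| := by
  have char : (ZMod.stdAddChar a : ℂ) =
      Complex.exp (2 * Real.pi * Complex.I * a.valMinAbs / N) := by
    rw [← ZMod.stdAddChar_coe, ZMod.coe_valMinAbs]
  set θ : ℝ := Real.pi * a.valMinAbs / N with hθ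
  have factor : (1 + ZMod.stdAddChar a : ℂ) =
      Complex.exp (θ * Complex.I) * (2 * Complex.cos θ) := by
    rw [char, Complex.two_cos, mul_add, ← Complex.exp_add, ← Complex.exp_add,
      show (θ : ℂ) * Complex.I + -(θ : ℂ) * Complex.I = 0 by ring, Complex.exp_zero, add_comm]
    congr 2
    rw [hθ]; push_cast; ring
  rw [cosWeight, factor, norm_mul, Complex.norm_exp_ofReal_mul_I, norm_mul, ← Complex.ofReal_cos,
    Complex.norm_real, Real.norm_eq_abs, Complex.norm_ofNat]
  ring

theorem cosWeight_nonneg (a : ZMod N) : 0 ≤ cosWeight a := by unfold cosWeight; positivity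

theorem cosWeight_le_one (a : ZMod N) : cosWeight a ≤ 1 := by
  rw [cosWeight_eq_abs_cos]; exact Real.abs_cos_le_one _

end Fourier

/-! ### The spectral gap of the Margulis–Gabber–Galil graph -/

/-- The absolute value of the representative of `a` of least absolute value. -/
def torusAbs {N : ℕ} (a : ZMod N) : ℕ := a.valMinAbs.natAbs

/-- The displacement of a coordinate in the step with label `l`, given the other coordinate. -/
def displacement {R : Type*} [Ring R] (l : ℕ) (y : R) : R :=
  match l with
  | 0 => 2 * y
  | 1 => 2 * y + 1
  | 2 => -(2 * y)
  | _ => -(2 * y + 1)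

/-- The neighbour with label `l < 8` in the Margulis–Gabber–Galil graph. -/
def torusStep {R : Type*} [Ring R] (l : ℕ) (z : R × R) : R × R :=
  if l < 4 then (z.1 + displacement l z.2, z.2) else (z.1, z.2 + displacement (l - 4) z.1)

/-- The averaging operator of the Margulis–Gabber–Galil graph. -/
def torusAvg {N : ℕ} (f : Torus N → ℝ) (z : Torus N) : ℝ :=
  (∑ l ∈ Finset.range 8, f (torusStep l z)) / 8

/-- The weight in the Schur test of an edge along which the changing coordinate has the absolute
values `p` and `q` at the ends. -/
def edgeWeight (p q : ℕ) : ℝ := if p < q then 4 / 5 else if q < p then 5 / 4 else 1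

/-- The sum of the weights of the two edges that change `x` by `± 2 y`. -/
def pairWeight {N : ℕ} (x y : ZMod N) : ℝ :=
  edgeWeight (torusAbs x) (torusAbs (x - 2 * y)) + edgeWeight (torusAbs x) (torusAbs (x + 2 * y))

theorem edgeWeight_pos (p q : ℕ) : 0 < edgeWeight p q := by
  unfold edgeWeight; split_ifs <;> norm_num

theorem edgeWeight_le (p q : ℕ) : edgeWeight p q ≤ 5 / 4 := by
  unfold edgeWeight; split_ifs <;> norm_num

theorem edgeWeight_self (p : ℕ) : edgeWeight p p = 1 := by simp [edgeWeight]

theorem edgeWeight_of_lt {p q : ℕ} (h : p < q) : edgeWeight p q = 4 / 5 := if_pos h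

theorem edgeWeight_mul_symm (p q : ℕ) : edgeWeight p q * edgeWeight q p = 1 := by
  unfold edgeWeight; split_ifs <;> first | omega | norm_num

theorem cos_add_cos_le_sqrt_two {x y : ℝ} (hx : x ≤ Real.pi / 2) (hy : y ≤ Real.pi / 2)
    (hxy : Real.pi / 2 ≤ x + y) : Real.cos x + Real.cos y ≤ Real.sqrt 2 := by
  have hπ := Real.pi_pos
  have half_le : Real.cos ((x + y) / 2) ≤ Real.sqrt 2 / 2 := by
    rw [← Real.cos_pi_div_four]
    exact Real.cos_le_cos_of_nonneg_of_le_pi (by positivity) (by linarith) (by linarith)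
  have half_nonneg : 0 ≤ Real.cos ((x + y) / 2) :=
    Real.cos_nonneg_of_neg_pi_div_two_le_of_le (by linarith) (by linarith)
  rw [Real.cos_add_cos]
  nlinarith [Real.cos_le_one ((x - y) / 2)]

theorem sum_sq_le_of_schur {ι σ : Type*} [Fintype ι] [Fintype σ] (e : σ → Equiv.Perm ι)
    {c f g : σ → ι → ℝ} {P Q : ι → ℝ} {R R' : ℝ} (hR : 0 ≤ R) (hf : ∀ s u, 0 ≤ f s u)
    (hg : ∀ s u, 0 ≤ g s u) (hfg : ∀ s u, c s u ^ 2 ≤ f s u * g s u) (hQ : ∀ u, 0 ≤ Q u)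
    (hQP : ∀ u, Q u ≤ ∑ s, c s u * P (e s u)) (row : ∀ u, Q u ≠ 0 → ∑ s, f s u ≤ R)
    (column : ∀ v, P v ≠ 0 → ∑ s, g s ((e s).symm v) ≤ R') :
    ∑ u, Q u ^ 2 ≤ R * R' * ∑ v, P v ^ 2 := by
  have weighted (u : ι) : Q u ^ 2 ≤ R * ∑ s, g s u * P (e s u) ^ 2 := by
    have nonneg : 0 ≤ ∑ s, g s u * P (e s u) ^ 2 :=
      Finset.sum_nonneg fun s _ => mul_nonneg (hg s u) (sq_nonneg _)
    rcases eq_or_ne (Q u) 0 with hu | hu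
    · simpa [hu] using mul_nonneg hR nonneg
    calc Q u ^ 2 ≤ (∑ s, c s u * P (e s u)) ^ 2 := pow_le_pow_left₀ (hQ u) (hQP u) 2
      _ ≤ (∑ s, f s u) * ∑ s, g s u * P (e s u) ^ 2 :=
          Finset.sum_sq_le_sum_mul_sum_of_sq_le_mul _ (fun s _ => hf s u)
            (fun s _ => mul_nonneg (hg s u) (sq_nonneg _)) fun s _ => by
              rw [mul_pow, ← mul_assoc]
              exact mul_le_mul_of_nonneg_right (hfg s u) (sq_nonneg _)
      _ ≤ R * ∑ s, g s u * P (e s u) ^ 2 := mul_le_mul_of_nonneg_right (row u hu) nonneg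
  calc ∑ u, Q u ^ 2 ≤ R * ∑ u, ∑ s, g s u * P (e s u) ^ 2 := by
        rw [Finset.mul_sum]
        exact Finset.sum_le_sum fun u _ => weighted u
    _ = R * ∑ v, (∑ s, g s ((e s).symm v)) * P v ^ 2 := by
        rw [Finset.sum_comm]
        simp only [Finset.sum_mul]
        rw [Finset.sum_comm (s := Finset.univ (α := ι))]
        congr 1
        refine Finset.sum_congr rfl fun s _ => ?_
        rw [← Equiv.sum_comp (e s) fun v => g s ((e s).symm v) * P v ^ 2]
        simp only [Equiv.symm_apply_apply]
    _ ≤ R * ∑ v, R' * P v ^ 2 := by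
        refine mul_le_mul_of_nonneg_left (Finset.sum_le_sum fun v _ => ?_) hR
        rcases eq_or_ne (P v) 0 with hv | hv
        · simp [hv]
        · exact mul_le_mul_of_nonneg_right (column v hv) (sq_nonneg _)
    _ = R * R' * ∑ v, P v ^ 2 := by rw [← Finset.mul_sum, mul_assoc]

/-- The automorphism `(x, y) ↦ (x + k y, y)` of `R²`. -/
def shearFst {R : Type*} [Ring R] (k : R) : Equiv.Perm (R × R) where
  toFun z := (z.1 + k * z.2, z.2)
  invFun z := (z.1 - k * z.2, z.2)
  left_inv z := by simp
  right_inv z := by simp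

/-- The automorphism `(x, y) ↦ (x, y + k x)` of `R²`. -/
def shearSnd {R : Type*} [Ring R] (k : R) : Equiv.Perm (R × R) where
  toFun z := (z.1, z.2 + k * z.1)
  invFun z := (z.1, z.2 - k * z.1)
  left_inv z := by simp
  right_inv z := by simp

section SpectralGap

variable {N : ℕ} [NeZero N]

theorem torusAbs_le (a : ZMod N) : (torusAbs a : ℝ) ≤ N / 2 := by
  rw [le_div_iff₀ two_pos]
  exact_mod_cast (by have := a.natAbs_valMinAbs_le; unfold torusAbs; omega : torusAbs a * 2 ≤ N)

theorem pi_div_mul_torusAbs_le (a : ZMod N) : Real.pi / N * torusAbs a ≤ Real.pi / 2 := by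
  have : (N : ℝ) ≠ 0 := by exact_mod_cast NeZero.ne N
  calc Real.pi / N * torusAbs a ≤ Real.pi / N * (N / 2) := by
        gcongr
        exact torusAbs_le a
    _ = Real.pi / 2 := by field_simp

theorem cosWeight_eq_cos_torusAbs (a : ZMod N) :
    cosWeight a = Real.cos (Real.pi / N * torusAbs a) := by
  have natAbs_eq : (torusAbs a : ℝ) = |(a.valMinAbs : ℝ)| := by
    rw [torusAbs, Nat.cast_natAbs, Int.cast_abs]
  have angle_nonneg : 0 ≤ Real.pi / N * torusAbs a := by positivity
  rw [cosWeight_eq_abs_cos, ← abs_of_nonneg (Real.cos_nonneg_of_neg_pi_div_two_le_of_le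
    (by linarith [Real.pi_pos]) (pi_div_mul_torusAbs_le a)), mul_div_right_comm, natAbs_eq]
  rcases abs_choice (a.valMinAbs : ℝ) with h | h <;> rw [h]
  rw [mul_neg, Real.cos_neg]

theorem cosWeight_add_le (a b : ZMod N) (h : N ≤ 2 * (torusAbs a + torusAbs b)) :
    cosWeight a + cosWeight b ≤ Real.sqrt 2 := by
  have : (N : ℝ) ≠ 0 := by exact_mod_cast NeZero.ne N
  rw [cosWeight_eq_cos_torusAbs, cosWeight_eq_cos_torusAbs]
  refine cos_add_cos_le_sqrt_two (pi_div_mul_torusAbs_le a) (pi_div_mul_torusAbs_le b) ?_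
  calc Real.pi / 2 = Real.pi / N * (N / 2) := by field_simp
    _ ≤ Real.pi / N * (torusAbs a + torusAbs b) := by
        have : (N : ℝ) ≤ 2 * (torusAbs a + torusAbs b) := by exact_mod_cast h
        gcongr
        linarith
    _ = _ := mul_add _ _ _

theorem valMinAbs_eq_of_intCast_eq {x : ZMod N} {X : ℤ} (hx : (X : ZMod N) = x)
    (hX : -(N : ℤ) < X ∧ X < N) :
    x.valMinAbs = X ∨ x.valMinAbs = X + N ∨ x.valMinAbs = X - N := by
  obtain ⟨q, hq⟩ : (N : ℤ) ∣ x.valMinAbs - X := by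
    rw [← ZMod.intCast_zmod_eq_zero_iff_dvd, Int.cast_sub, ZMod.coe_valMinAbs, hx, sub_self]
  have : (0 : ℤ) < N := by exact_mod_cast NeZero.pos N
  obtain ⟨h1, h2⟩ := x.valMinAbs_mem_Ioc
  have hq1 : q < 2 := by nlinarith
  have hq2 : -2 < q := by nlinarith
  obtain rfl | rfl | rfl : q = 0 ∨ q = 1 ∨ q = -1 := by omega
  all_goals simp only [mul_zero, mul_one, mul_neg] at hq; omega

theorem torusAbs_sub_add_cases (x y : ZMod N) (h : 2 * (torusAbs x + torusAbs y) < N) :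
    (torusAbs x < torusAbs y → torusAbs x < torusAbs (x - 2 * y) ∧
      torusAbs x < torusAbs (x + 2 * y)) ∧
    (torusAbs x = torusAbs y → torusAbs x ≠ 0 →
      (torusAbs x < torusAbs (x - 2 * y) ∧ torusAbs x = torusAbs (x + 2 * y)) ∨
      (torusAbs x = torusAbs (x - 2 * y) ∧ torusAbs x < torusAbs (x + 2 * y))) ∧
    (torusAbs y < torusAbs x →
      (torusAbs x < torusAbs (x - 2 * y) ∨ torusAbs x < torusAbs (x + 2 * y)) ∨
      (torusAbs x = torusAbs (x - 2 * y) ∧ torusAbs x = torusAbs (x + 2 * y))) := by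
  unfold torusAbs at *
  have sub := valMinAbs_eq_of_intCast_eq (x := x - 2 * y) (X := x.valMinAbs - 2 * y.valMinAbs)
    (by simp) (by omega)
  have add := valMinAbs_eq_of_intCast_eq (x := x + 2 * y) (X := x.valMinAbs + 2 * y.valMinAbs)
    (by simp) (by omega)
  have sub_mem := Set.mem_Ioc.mp (x - 2 * y).valMinAbs_mem_Ioc
  have add_mem := Set.mem_Ioc.mp (x + 2 * y).valMinAbs_mem_Ioc
  generalize (x - 2 * y).valMinAbs = P at *
  generalize (x + 2 * y).valMinAbs = Q at *
  generalize x.valMinAbs = X at *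
  generalize y.valMinAbs = Y at *
  refine ⟨?_, ?_, ?_⟩ <;> omega

omit [NeZero N] in
theorem pairWeight_nonneg (x y : ZMod N) : 0 ≤ pairWeight x y :=
  add_nonneg (edgeWeight_pos _ _).le (edgeWeight_pos _ _).le

omit [NeZero N] in
theorem pairWeight_le (x y : ZMod N) : pairWeight x y ≤ 5 / 2 :=
  (add_le_add (edgeWeight_le _ _) (edgeWeight_le _ _)).trans_eq (by norm_num)

theorem pairWeight_of_torusAbs_lt {x y : ZMod N} (h : 2 * (torusAbs x + torusAbs y) < N)
    (hxy : torusAbs x < torusAbs y) : pairWeight x y = 8 / 5 := by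
  obtain ⟨hsub, hadd⟩ := (torusAbs_sub_add_cases x y h).1 hxy
  rw [pairWeight, edgeWeight_of_lt hsub, edgeWeight_of_lt hadd]
  norm_num

theorem pairWeight_of_torusAbs_eq {x y : ZMod N} (h : 2 * (torusAbs x + torusAbs y) < N)
    (hxy : torusAbs x = torusAbs y) (hx : torusAbs x ≠ 0) : pairWeight x y = 9 / 5 := by
  unfold pairWeight
  rcases (torusAbs_sub_add_cases x y h).2.1 hxy hx with ⟨hlt, heq⟩ | ⟨heq, hlt⟩ <;>
    rw [edgeWeight_of_lt hlt, ← heq, edgeWeight_self] <;> norm_num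

theorem pairWeight_le_of_torusAbs_lt {x y : ZMod N} (h : 2 * (torusAbs x + torusAbs y) < N)
    (hxy : torusAbs y < torusAbs x) : pairWeight x y ≤ 41 / 20 := by
  unfold pairWeight
  rcases (torusAbs_sub_add_cases x y h).2.2 hxy with (hlt | hlt) | ⟨hsub, hadd⟩
  · linarith [edgeWeight_of_lt hlt, edgeWeight_le (torusAbs x) (torusAbs (x + 2 * y))]
  · linarith [edgeWeight_of_lt hlt, edgeWeight_le (torusAbs x) (torusAbs (x - 2 * y))]
  · rw [← hsub, ← hadd, edgeWeight_self]
    norm_num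

theorem pairWeight_add_pairWeight_le {a b : ZMod N} (hab : (a, b) ≠ 0)
    (h : 2 * (torusAbs a + torusAbs b) < N) : pairWeight b a + pairWeight a b ≤ 73 / 20 := by
  have h' : 2 * (torusAbs b + torusAbs a) < N := by omega
  rcases lt_trichotomy (torusAbs a) (torusAbs b) with hlt | heq | hgt
  · linarith [pairWeight_of_torusAbs_lt h hlt, pairWeight_le_of_torusAbs_lt h' hlt]
  · have ha : torusAbs a ≠ 0 := fun ha => hab <| by
      have hb := heq ▸ ha
      simp only [torusAbs, Int.natAbs_eq_zero, ZMod.valMinAbs_eq_zero] at ha hb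
      simp [ha, hb]
    rw [pairWeight_of_torusAbs_eq h heq ha, pairWeight_of_torusAbs_eq h' heq.symm (heq ▸ ha)]
    norm_num
  · linarith [pairWeight_of_torusAbs_lt h' hgt, pairWeight_le_of_torusAbs_lt h hgt]

/-- Close to the origin the edge weights alone are small on average; far from it the cosines are. -/
theorem cosWeight_mul_pairWeight_add_le (u : Torus N) (hu : u ≠ 0) :
    cosWeight u.1 * pairWeight u.2 u.1 + cosWeight u.2 * pairWeight u.1 u.2 ≤ 73 / 20 := by
  obtain ⟨a, b⟩ := u
  rcases Nat.lt_or_ge (2 * (torusAbs a + torusAbs b)) N with near | far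
  · have ha := mul_le_of_le_one_left (pairWeight_nonneg b a) (cosWeight_le_one a)
    have hb := mul_le_of_le_one_left (pairWeight_nonneg a b) (cosWeight_le_one b)
    exact (add_le_add ha hb).trans (pairWeight_add_pairWeight_le hu near)
  · have ha := mul_le_mul_of_nonneg_left (pairWeight_le b a) (cosWeight_nonneg a)
    have hb := mul_le_mul_of_nonneg_left (pairWeight_le a b) (cosWeight_nonneg b)
    have hcos := cosWeight_add_le a b far
    have hsqrt : Real.sqrt 2 ≤ 1.46 := by
      rw [Real.sqrt_le_left (by norm_num)]; norm_num
    linarith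

theorem sum_sq_le_of_le_cosWeight_mul (P Q : Torus N → ℝ) (hQ : ∀ u, 0 ≤ Q u) (hP0 : P 0 = 0)
    (h : ∀ u, Q u ≤ (cosWeight u.1 * (P (u.1, u.2 - 2 * u.1) + P (u.1, u.2 + 2 * u.1)) +
      cosWeight u.2 * (P (u.1 - 2 * u.2, u.2) + P (u.1 + 2 * u.2, u.2))) / 4) :
    ∑ u, Q u ^ 2 ≤ (73 / 80) ^ 2 * ∑ u, P u ^ 2 := by
  have hQ0 : Q 0 = 0 := by
    refine le_antisymm ((h 0).trans_eq ?_) (hQ 0)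
    simp [show ((0, 0) : Torus N) = 0 from rfl, hP0]
  let e : Fin 4 → Equiv.Perm (Torus N) := ![shearSnd (-2), shearSnd 2, shearFst (-2), shearFst 2]
  let c : Fin 4 → Torus N → ℝ := ![fun u => cosWeight u.1 / 4, fun u => cosWeight u.1 / 4,
    fun u => cosWeight u.2 / 4, fun u => cosWeight u.2 / 4]
  let w : Fin 4 → Torus N → Torus N → ℝ := ![fun u v => edgeWeight (torusAbs u.2) (torusAbs v.2),
    fun u v => edgeWeight (torusAbs u.2) (torusAbs v.2),
    fun u v => edgeWeight (torusAbs u.1) (torusAbs v.1),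
    fun u v => edgeWeight (torusAbs u.1) (torusAbs v.1)]
  have hc (s u) : 0 ≤ c s u := by
    fin_cases s <;> exact div_nonneg (cosWeight_nonneg _) (by norm_num)
  have hw (s u v) : 0 ≤ w s u v := by fin_cases s <;> exact (edgeWeight_pos _ _).le
  have hww (s u v) : w s u v * w s v u = 1 := by fin_cases s <;> exact edgeWeight_mul_symm _ _
  have rowSum (u : Torus N) (hu : u ≠ 0) :=
    cosWeight_mul_pairWeight_add_le u hu
  simp only [pairWeight] at rowSum
  rw [sq]
  refine sum_sq_le_of_schur e (c := c) (f := fun s u => c s u * w s u (e s u))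
    (g := fun s u => c s u * w s (e s u) u) (by norm_num) (fun s u => mul_nonneg (hc s u) (hw ..))
    (fun s u => mul_nonneg (hc s u) (hw ..)) (fun s u => le_of_eq ?_) hQ (fun u => ?_)
    (fun u hu => ?_) fun v hv => ?_
  · linear_combination -(c s u) ^ 2 * hww s u (e s u)
  · refine (h u).trans_eq ?_
    simp [Fin.sum_univ_four, c, e, shearFst, shearSnd, ← sub_eq_add_neg]
    ring
  · have := rowSum u fun h0 => hu (h0 ▸ hQ0)
    simp [Fin.sum_univ_four, c, e, w, shearFst, shearSnd, ← sub_eq_add_neg]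
    linarith
  · have := rowSum v fun h0 => hv (h0 ▸ hP0)
    simp [Fin.sum_univ_four, c, e, w, shearFst, shearSnd]
    linarith

theorem torusFT_torusAvg (f : Torus N → ℝ) (u : Torus N) :
    torusFT (fun z => (torusAvg f z : ℂ)) u =
      ((1 + ZMod.stdAddChar u.1) * torusFT (fun z => f z) (u.1, u.2 - 2 * u.1) +
        (1 + ZMod.stdAddChar (-u.1)) * torusFT (fun z => f z) (u.1, u.2 + 2 * u.1) +
        (1 + ZMod.stdAddChar u.2) * torusFT (fun z => f z) (u.1 - 2 * u.2, u.2) +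
        (1 + ZMod.stdAddChar (-u.2)) * torusFT (fun z => f z) (u.1 + 2 * u.2, u.2)) / 8 := by
  have fst (k c : ZMod N) := torusFT_shear_fst (fun z => (f z : ℂ)) k c u
  have snd (k c : ZMod N) := torusFT_shear_snd (fun z => (f z : ℂ)) k c u
  have a₁ := fst 2 0
  have a₂ := fst 2 1
  have a₃ := fst (-2) 0
  have a₄ := fst (-2) (-1)
  have b₁ := snd 2 0
  have b₂ := snd 2 1
  have b₃ := snd (-2) 0
  have b₄ := snd (-2) (-1)
  simp only [zero_mul, one_mul, neg_mul, sub_neg_eq_add, AddChar.map_zero_eq_one, add_zero]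
    at a₁ a₂ a₃ a₄ b₁ b₂ b₃ b₄
  rw [add_mul, add_mul, add_mul, add_mul, one_mul, one_mul, one_mul, one_mul, ← a₂, ← a₁, ← a₄,
    ← a₃, ← b₂, ← b₁, ← b₄, ← b₃]
  simp only [torusFT, ← Finset.sum_add_distrib, Finset.sum_div]
  refine Finset.sum_congr rfl fun z _ => ?_
  have avg : torusAvg f z = (f (z.1 + 2 * z.2, z.2) + f (z.1 + 2 * z.2 + 1, z.2) +
      (f (z.1 + -(2 * z.2), z.2) + f (z.1 + -(2 * z.2) + -1, z.2)) +
      (f (z.1, z.2 + 2 * z.1) + f (z.1, z.2 + 2 * z.1 + 1)) +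
      (f (z.1, z.2 + -(2 * z.1)) + f (z.1, z.2 + -(2 * z.1) + -1))) / 8 := by
    simp [torusAvg, Finset.sum_range_succ, torusStep, displacement, neg_add_rev, add_assoc,
      add_comm (-1 : ZMod N)]
  rw [avg]
  push_cast
  ring

theorem norm_torusFT_torusAvg_le (f : Torus N → ℝ) (u : Torus N) :
    ‖torusFT (fun z => (torusAvg f z : ℂ)) u‖ ≤
      (cosWeight u.1 * (‖torusFT (fun z => f z) (u.1, u.2 - 2 * u.1)‖ +
          ‖torusFT (fun z => f z) (u.1, u.2 + 2 * u.1)‖) +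
        cosWeight u.2 * (‖torusFT (fun z => f z) (u.1 - 2 * u.2, u.2)‖ +
          ‖torusFT (fun z => f z) (u.1 + 2 * u.2, u.2)‖)) / 4 := by
  rw [torusFT_torusAvg, norm_div, Complex.norm_ofNat]
  refine (div_le_div_of_nonneg_right norm_add₄_le (by norm_num)).trans_eq ?_
  simp only [norm_mul, norm_one_add_stdAddChar, cosWeight_neg]
  ring

theorem sum_sq_torusAvg_le (f : Torus N → ℝ) (hf : ∑ z, f z = 0) :
    ∑ z, torusAvg f z ^ 2 ≤ (73 / 80) ^ 2 * ∑ z, f z ^ 2 := by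
  have hN : (0 : ℝ) < (N : ℝ) ^ 2 := by
    have := NeZero.pos N
    positivity
  have mean_zero : torusFT (fun z => (f z : ℂ)) 0 = 0 := by
    simp only [torusFT, Prod.fst_zero, Prod.snd_zero, zero_mul, add_zero, neg_zero,
      AddChar.map_zero_eq_one, mul_one]
    exact_mod_cast hf
  have schur := sum_sq_le_of_le_cosWeight_mul (fun u => ‖torusFT (fun z => (f z : ℂ)) u‖)
    (fun u => ‖torusFT (fun z => (torusAvg f z : ℂ)) u‖) (fun u => norm_nonneg _)
    (norm_eq_zero.mpr mean_zero) (norm_torusFT_torusAvg_le f)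
  simp only [sum_norm_sq_torusFT, Complex.norm_real, Real.norm_eq_abs, sq_abs] at schur
  rw [mul_left_comm] at schur
  exact le_of_mul_le_mul_left schur hN

end SpectralGap

/-! ### Random walks and mixing -/

/-- The walk of `t` steps from `z` whose labels are the base-8 digits of `y`, the last one first. -/
def torusWalk {R : Type*} [Ring R] : ℕ → ℕ → R × R → R × R
  | 0, _, z => z
  | t + 1, y, z => torusWalk t (y / 8) (torusStep (y % 8) z)

theorem sum_range_mul {M : Type*} [AddCommMonoid M] (a b : ℕ) (f : ℕ → M) :
    ∑ y ∈ Finset.range (a * b), f y =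
      ∑ p ∈ Finset.range a, ∑ q ∈ Finset.range b, f (p * b + q) := by
  simp only [Finset.sum_range]
  rw [← Fintype.sum_prod_type', ← Equiv.sum_comp finProdFinEquiv]
  simp only [finProdFinEquiv_apply_val, add_comm, mul_comm]

theorem sum_range_eq_sum_zmod_val {M : Type*} [AddCommMonoid M] {N : ℕ} [NeZero N] (f : ℕ → M) :
    ∑ a ∈ Finset.range N, f a = ∑ a : ZMod N, f a.val := by
  obtain ⟨n, rfl⟩ := Nat.exists_eq_succ_of_ne_zero (NeZero.ne N)
  exact Finset.sum_range f

section TorusWalk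

variable {N : ℕ}

theorem sum_torusWalk (t : ℕ) (f : Torus N → ℝ) (z : Torus N) :
    ∑ y ∈ Finset.range (8 ^ t), f (torusWalk t y z) = 8 ^ t * (torusAvg^[t] f) z := by
  induction t generalizing z with
  | zero => simp [torusWalk]
  | succ t ih =>
    have first_step (l) (hl : l ∈ Finset.range 8) :
        ∑ y ∈ Finset.range (8 ^ t), f (torusWalk (t + 1) (y * 8 + l) z) =
          8 ^ t * (torusAvg^[t] f) (torusStep l z) := by
      rw [← ih]
      refine Finset.sum_congr rfl fun y _ => ?_
      rw [Finset.mem_range] at hl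
      rw [torusWalk, show (y * 8 + l) % 8 = l by omega, show (y * 8 + l) / 8 = y by omega]
    rw [pow_succ, sum_range_mul, Finset.sum_comm, Finset.sum_congr rfl first_step,
      ← Finset.mul_sum, Function.iterate_succ_apply', torusAvg]
    ring

variable [NeZero N]

theorem sum_comp_torusStep {M : Type*} [AddCommMonoid M] (l : ℕ) (f : Torus N → M) :
    ∑ z, f (torusStep l z) = ∑ z, f z := by
  by_cases hl : l < 4
  · simp only [torusStep, hl, if_true]
    rw [Fintype.sum_prod_type_right, Fintype.sum_prod_type_right]
    refine Finset.sum_congr rfl fun y _ => ?_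
    exact Equiv.sum_comp (Equiv.addRight (displacement l y)) fun x => f (x, y)
  · simp only [torusStep, hl, if_false]
    rw [Fintype.sum_prod_type, Fintype.sum_prod_type]
    refine Finset.sum_congr rfl fun x _ => ?_
    exact Equiv.sum_comp (Equiv.addRight (displacement (l - 4) x)) fun y => f (x, y)

theorem sum_torusAvg (f : Torus N → ℝ) : ∑ z, torusAvg f z = ∑ z, f z := by
  simp only [torusAvg, ← Finset.sum_div]
  rw [Finset.sum_comm]
  simp only [sum_comp_torusStep, Finset.sum_const, Finset.card_range, nsmul_eq_mul]
  ring

theorem sum_torusAvg_iterate (t : ℕ) (f : Torus N → ℝ) :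
    ∑ z, (torusAvg^[t] f) z = ∑ z, f z := by
  induction t with
  | zero => rfl
  | succ t ih => rw [Function.iterate_succ_apply', sum_torusAvg, ih]

theorem sum_sq_torusAvg_iterate_le (t : ℕ) {f : Torus N → ℝ} (hf : ∑ z, f z = 0) :
    ∑ z, (torusAvg^[t] f) z ^ 2 ≤ ((73 / 80) ^ t) ^ 2 * ∑ z, f z ^ 2 := by
  induction t with
  | zero => simp
  | succ t ih =>
    rw [Function.iterate_succ_apply']
    calc ∑ z, torusAvg (torusAvg^[t] f) z ^ 2
        ≤ (73 / 80) ^ 2 * ∑ z, (torusAvg^[t] f) z ^ 2 :=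
          sum_sq_torusAvg_le _ ((sum_torusAvg_iterate t f).trans hf)
      _ ≤ (73 / 80 : ℝ) ^ 2 * (((73 / 80) ^ t) ^ 2 * ∑ z, f z ^ 2) :=
          mul_le_mul_of_nonneg_left ih (by norm_num)
      _ = _ := by ring

omit [NeZero N] in
theorem card_torus [Fintype (ZMod N)] : (Fintype.card (Torus N) : ℝ) = (N : ℝ) ^ 2 := by
  rw [Fintype.card_prod, ZMod.card, Nat.cast_mul, sq]

theorem sum_torusAvg_iterate_le (t : ℕ) {f : Torus N → ℝ} (hf : ∑ z, f z = 0)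
    (hf1 : ∀ z, |f z| ≤ 1) (A : Finset (Torus N)) :
    ∑ z ∈ A, (torusAvg^[t] f) z ≤ (73 / 80) ^ t * (N : ℝ) ^ 2 := by
  have card_le : (A.card : ℝ) ≤ (N : ℝ) ^ 2 := by
    rw [← card_torus]
    exact_mod_cast A.card_le_univ
  have sum_sq_le : ∑ z, f z ^ 2 ≤ (N : ℝ) ^ 2 := by
    calc ∑ z, f z ^ 2 ≤ ∑ _ : Torus N, (1 : ℝ) :=
          Finset.sum_le_sum fun z _ => (sq_le_one_iff_abs_le_one _).mpr (hf1 z)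
      _ = (N : ℝ) ^ 2 := by simp [← sq]
  refine (abs_le_of_sq_le_sq' ?_ (by positivity)).2
  calc (∑ z ∈ A, (torusAvg^[t] f) z) ^ 2
      ≤ A.card * ∑ z ∈ A, (torusAvg^[t] f) z ^ 2 := sq_sum_le_card_mul_sum_sq
    _ ≤ A.card * ∑ z, (torusAvg^[t] f) z ^ 2 := by
        gcongr
        exact A.subset_univ
    _ ≤ (N : ℝ) ^ 2 * (((73 / 80) ^ t) ^ 2 * (N : ℝ) ^ 2) := by
        gcongr
        exact (sum_sq_torusAvg_iterate_le t hf).trans (by gcongr)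
    _ = ((73 / 80) ^ t * (N : ℝ) ^ 2) ^ 2 := by ring

open Classical in
theorem torusWalk_mixing (t : ℕ) (A B : Finset (Torus N)) :
    ∑ z ∈ A, (((Finset.range (8 ^ t)).filter fun y => torusWalk t y z ∈ B).card : ℝ) ≤
      8 ^ t * (A.card * B.card / (N : ℝ) ^ 2 + (73 / 80) ^ t * (N : ℝ) ^ 2) := by
  have hN : (N : ℝ) ≠ 0 := by exact_mod_cast NeZero.ne N
  set density : ℝ := B.card / (N : ℝ) ^ 2
  have density_nonneg : 0 ≤ density := by positivity
  have density_le_one : density ≤ 1 := by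
    refine div_le_one_of_le₀ ?_ (by positivity)
    rw [← card_torus]
    exact_mod_cast B.card_le_univ
  let f : Torus N → ℝ := fun z => (if z ∈ B then 1 else 0) - density
  have sum_f : ∑ z, f z = 0 := by
    simp only [f, Finset.sum_sub_distrib, Finset.sum_const, Finset.card_univ, nsmul_eq_mul,
      card_torus, density, mul_div_cancel₀ (B.card : ℝ) (pow_ne_zero 2 hN), Finset.sum_ite_mem,
      Finset.univ_inter, mul_one, sub_self]
  have abs_f_le (z : Torus N) : |f z| ≤ 1 := by
    simp only [f, abs_le]
    split_ifs <;> constructor <;> linarith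
  have count (z : Torus N) :
      (((Finset.range (8 ^ t)).filter fun y => torusWalk t y z ∈ B).card : ℝ) =
        8 ^ t * (torusAvg^[t] f) z + 8 ^ t * density := by
    rw [← sum_torusWalk]
    simp [f]
  calc _ = 8 ^ t * (∑ z ∈ A, (torusAvg^[t] f) z) + A.card * (8 ^ t * density) := by
        simp only [count, Finset.sum_add_distrib, ← Finset.mul_sum, Finset.sum_const,
          nsmul_eq_mul]
        ring
    _ ≤ 8 ^ t * ((73 / 80) ^ t * (N : ℝ) ^ 2) + A.card * (8 ^ t * density) := by
        gcongr
        exact sum_torusAvg_iterate_le t sum_f abs_f_le A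
    _ = _ := by ring

end TorusWalk

/-! ### Walks on natural numbers -/

/-- A natural number that is congruent to `displacement l y` modulo `N`. -/
def natDisplacement (N l y : ℕ) : ℕ :=
  match l with
  | 0 => 2 * y
  | 1 => 2 * y + 1
  | 2 => 2 * N - 2 * y
  | _ => 2 * N - (2 * y + 1)

/-- `torusStep` on representatives in `{0, …, N - 1}`. -/
def natStep (N l : ℕ) (p : ℕ × ℕ) : ℕ × ℕ :=
  if l < 4 then ((p.1 + natDisplacement N l p.2) % N, p.2)
  else (p.1, (p.2 + natDisplacement N (l - 4) p.1) % N)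

/-- `torusWalk` on representatives in `{0, …, N - 1}`. -/
def natWalk (N : ℕ) : ℕ → ℕ → ℕ × ℕ → ℕ × ℕ
  | 0, _, p => p
  | t + 1, y, p => natWalk N t (y / 8) (natStep N (y % 8) p)

/-- The walk on the numbers below `2 ^ (2 * h)`, regarded as pairs of numbers below `2 ^ h`. -/
def numWalk (h t y x : ℕ) : ℕ :=
  (natWalk (2 ^ h) t y (x / 2 ^ h, x % 2 ^ h)).1 * 2 ^ h +
    (natWalk (2 ^ h) t y (x / 2 ^ h, x % 2 ^ h)).2

section NatWalk

variable {N : ℕ} {p : ℕ × ℕ}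

theorem natDisplacement_cast {l y : ℕ} (hy : y < N) :
    (natDisplacement N l y : ZMod N) = displacement l (y : ZMod N) := by
  unfold natDisplacement displacement
  split
  · simp
  · simp
  · rw [Nat.cast_sub (by omega)]; simp
  · rw [Nat.cast_sub (by omega)]; simp

theorem natStep_lt {l : ℕ} (hp : p.1 < N ∧ p.2 < N) :
    (natStep N l p).1 < N ∧ (natStep N l p).2 < N := by
  have hN : 0 < N := by omega
  unfold natStep
  split_ifs
  · exact ⟨Nat.mod_lt _ hN, hp.2⟩
  · exact ⟨hp.1, Nat.mod_lt _ hN⟩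

theorem natStep_cast {l : ℕ} (hp : p.1 < N ∧ p.2 < N) :
    (((natStep N l p).1 : ZMod N), ((natStep N l p).2 : ZMod N)) =
      torusStep l ((p.1 : ZMod N), (p.2 : ZMod N)) := by
  unfold natStep torusStep
  split_ifs
  · simp [natDisplacement_cast hp.2]
  · simp [natDisplacement_cast hp.1]

theorem natWalk_lt (t y : ℕ) (hp : p.1 < N ∧ p.2 < N) :
    (natWalk N t y p).1 < N ∧ (natWalk N t y p).2 < N := by
  induction t generalizing y p with
  | zero => exact hp
  | succ _ ih => exact ih _ (natStep_lt hp)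

theorem natWalk_cast (t y : ℕ) (hp : p.1 < N ∧ p.2 < N) :
    (((natWalk N t y p).1 : ZMod N), ((natWalk N t y p).2 : ZMod N)) =
      torusWalk t y ((p.1 : ZMod N), (p.2 : ZMod N)) := by
  induction t generalizing y p with
  | zero => rfl
  | succ t ih => rw [natWalk, torusWalk, ih _ (natStep_lt hp), natStep_cast hp]

end NatWalk

section TorusCode

variable {h : ℕ}

/-- The number below `2 ^ (2 * h)` that corresponds to a point of the torus. -/
def torusCode (z : Torus (2 ^ h)) : ℕ := z.1.val * 2 ^ h + z.2.val

theorem sum_range_eq_sum_torusCode {M : Type*} [AddCommMonoid M] (f : ℕ → M) :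
    ∑ x ∈ Finset.range (2 ^ (2 * h)), f x = ∑ z : Torus (2 ^ h), f (torusCode z) := by
  rw [two_mul, pow_add, sum_range_mul, Fintype.sum_prod_type]
  simp only [sum_range_eq_sum_zmod_val, torusCode]

theorem torusCode_div_mod (z : Torus (2 ^ h)) :
    (torusCode z / 2 ^ h, torusCode z % 2 ^ h) = (z.1.val, z.2.val) := by
  have hz := z.2.val_lt
  rw [torusCode, mul_comm, Nat.mul_add_div (by positivity), Nat.mul_add_mod,
    Nat.div_eq_of_lt hz, Nat.mod_eq_of_lt hz, add_zero]

theorem numWalk_torusCode (t y : ℕ) (z : Torus (2 ^ h)) :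
    numWalk h t y (torusCode z) = torusCode (torusWalk t y z) := by
  have hz : z.1.val < 2 ^ h ∧ z.2.val < 2 ^ h := ⟨z.1.val_lt, z.2.val_lt⟩
  have walk := natWalk_cast t y (p := (z.1.val, z.2.val)) hz
  have walk_lt := natWalk_lt t y (p := (z.1.val, z.2.val)) hz
  simp only [ZMod.natCast_zmod_val] at walk
  rw [numWalk, torusCode_div_mod, ← Prod.mk.eta (p := z), ← walk, torusCode,
    ZMod.val_natCast_of_lt walk_lt.1, ZMod.val_natCast_of_lt walk_lt.2]

theorem mul_add_lt_two_pow_two_mul {a b : ℕ} (ha : a < 2 ^ h) (hb : b < 2 ^ h) :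
    a * 2 ^ h + b < 2 ^ (2 * h) := by
  rw [two_mul, pow_add]
  nlinarith

theorem div_mod_lt {x : ℕ} (hx : x < 2 ^ (2 * h)) : x / 2 ^ h < 2 ^ h ∧ x % 2 ^ h < 2 ^ h := by
  refine ⟨Nat.div_lt_of_lt_mul ?_, Nat.mod_lt _ (by positivity)⟩
  rwa [← pow_add, ← two_mul]

theorem numWalk_lt {t y x : ℕ} (hx : x < 2 ^ (2 * h)) : numWalk h t y x < 2 ^ (2 * h) :=
  have walk_lt := natWalk_lt t y (p := (x / 2 ^ h, x % 2 ^ h)) (div_mod_lt hx)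
  mul_add_lt_two_pow_two_mul walk_lt.1 walk_lt.2

open Classical in
theorem numWalk_mixing (h t : ℕ) (A B : ℕ → Prop) :
    ∑ x ∈ (Finset.range (2 ^ (2 * h))).filter A,
        (((Finset.range (8 ^ t)).filter fun y => B (numWalk h t y x)).card : ℝ) ≤
      8 ^ t * (((Finset.range (2 ^ (2 * h))).filter A).card *
        ((Finset.range (2 ^ (2 * h))).filter B).card / 2 ^ (2 * h) +
          (73 / 80) ^ t * 2 ^ (2 * h)) := by
  have card_eq (P : ℕ → Prop) : ((Finset.range (2 ^ (2 * h))).filter P).card =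
      (Finset.univ.filter fun z : Torus (2 ^ h) => P (torusCode z)).card := by
    rw [Finset.card_filter, Finset.card_filter, sum_range_eq_sum_torusCode]
  have mixing := torusWalk_mixing t (Finset.univ.filter fun z : Torus (2 ^ h) => A (torusCode z))
    (Finset.univ.filter fun z : Torus (2 ^ h) => B (torusCode z))
  rw [show ((2 ^ h : ℕ) : ℝ) ^ 2 = 2 ^ (2 * h) by push_cast; rw [← pow_mul, mul_comm]] at mixing
  rw [card_eq A, card_eq B]
  refine le_trans (le_of_eq ?_) mixing
  rw [Finset.sum_filter, Finset.sum_filter, sum_range_eq_sum_torusCode]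
  simp only [numWalk_torusCode, Finset.mem_filter, Finset.mem_univ, true_and]

end TorusCode

/-! ### Adaptive processes with few branches -/

/-- The state after `r` steps from `s` on the inputs `x 0, x 1, …`. -/
def endState {S X : Type*} (step : S → X → S) : ℕ → S → (ℕ → X) → S
  | 0, s, _ => s
  | r + 1, s, x => endState step r (step s (x 0)) fun i => x (i + 1)

/-- One of the first `r` inputs `x 0, x 1, …` is bad for the state in which it is read; the time
at the beginning is `j`. -/
def EverBad {S X : Type*} (step : S → X → S) (bad : ℕ → S → X → Prop) :
    ℕ → ℕ → S → (ℕ → X) → Prop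
  | 0, _, _, _ => False
  | r + 1, j, s, x => bad j s (x 0) ∨ EverBad step bad r (j + 1) (step s (x 0)) fun i => x (i + 1)

section Adaptive

variable {S X : Type*} {step : S → X → S} {bad : ℕ → S → X → Prop}

theorem everBad_add (r r' j : ℕ) (s : S) (x : ℕ → X) :
    EverBad step bad (r + r') j s x ↔ EverBad step bad r j s x ∨
      EverBad step bad r' (j + r) (endState step r s x) fun i => x (r + i) := by
  induction r generalizing j s x with
  | zero => simp [EverBad, endState]
  | succ r ih =>
    rw [show r + 1 + r' = (r + r') + 1 by ring, EverBad, EverBad, endState, ih, or_assoc,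
      show j + 1 + r = j + (r + 1) by ring]
    simp only [show ∀ i, r + i + 1 = r + 1 + i from fun i => by ring]

theorem everBad_congr {r : ℕ} {x x' : ℕ → X} (h : ∀ i < r, x i = x' i) (j : ℕ) (s : S) :
    EverBad step bad r j s x ↔ EverBad step bad r j s x' := by
  induction r generalizing j s x x' with
  | zero => simp [EverBad]
  | succ r ih => rw [EverBad, EverBad, h 0 (by omega), ih fun i hi => h (i + 1) (by omega)]

theorem endState_congr {r : ℕ} {x x' : ℕ → X} (h : ∀ i < r, x i = x' i) (s : S) :
    endState step r s x = endState step r s x' := by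
  induction r generalizing s x x' with
  | zero => simp [endState]
  | succ r ih => rw [endState, endState, h 0 (by omega), ih fun i hi => h (i + 1) (by omega)]

open Classical in
theorem exists_endStates {K : ℕ} (hstep : ∀ s, ∃ T : Finset S, T.card ≤ K ∧ ∀ x, step s x ∈ T)
    (r : ℕ) (s : S) : ∃ T : Finset S, T.card ≤ K ^ r ∧ ∀ x, endState step r s x ∈ T := by
  induction r generalizing s with
  | zero => exact ⟨{s}, by simp, fun _ => by simp [endState]⟩
  | succ r ih =>
    obtain ⟨T, hT, hs⟩ := hstep s
    choose U hU hmem using ih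
    refine ⟨T.biUnion U, ?_, fun x => ?_⟩
    · calc (T.biUnion U).card ≤ T.card * K ^ r :=
            Finset.card_biUnion_le_card_mul _ _ _ fun s _ => hU s
        _ ≤ K * K ^ r := Nat.mul_le_mul_right _ hT
        _ = K ^ (r + 1) := by ring
    · rw [endState, Finset.mem_biUnion]
      exact ⟨_, hs _, hmem _ _⟩

end Adaptive

/-! ### The generator -/

/-- The number of steps of the walk that joins the two halves of the output of the generator of
level `i + 1`: enough to fool `2 ^ i` steps with `2 ^ D` branches each, up to an error `2⁻ᵉ`. -/
def walkLength (D e i : ℕ) : ℕ := 8 * (D * 2 ^ i + e)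

/-- Half of the seed length at level `i` of the generator. -/
def halfLength (D e h₀ : ℕ) : ℕ → ℕ
  | 0 => h₀
  | i + 1 => halfLength D e h₀ i + 12 * (D * 2 ^ i + e)

/-- The block with index `r < 2 ^ i` of the output of the generator of level `i` on the seed `z`:
the lower part of the seed is the seed of the first half of the output, its upper part labels a walk
from there to the seed of the second half. -/
def generator (D e h₀ : ℕ) : ℕ → ℕ → ℕ → ℕ
  | 0, z, _ => z
  | i + 1, z, r =>
    if 2 ^ i ≤ r then
      generator D e h₀ i (numWalk (halfLength D e h₀ i) (walkLength D e i)
        (z / 2 ^ (2 * halfLength D e h₀ i)) (z % 2 ^ (2 * halfLength D e h₀ i))) (r - 2 ^ i)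
    else generator D e h₀ i (z % 2 ^ (2 * halfLength D e h₀ i)) r

section Generator

variable {D e h₀ i : ℕ}

theorem two_pow_halfLength_succ (D e h₀ i : ℕ) :
    2 ^ (2 * halfLength D e h₀ (i + 1)) =
      8 ^ walkLength D e i * 2 ^ (2 * halfLength D e h₀ i) := by
  rw [show (8 : ℕ) = 2 ^ 3 by norm_num, ← pow_mul, ← pow_add, halfLength, walkLength]
  congr 1
  ring

theorem generator_lt (D e h₀ i z r : ℕ) (hz : z < 2 ^ (2 * halfLength D e h₀ i)) :
    generator D e h₀ i z r < 2 ^ (2 * h₀) := by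
  induction i generalizing z r with
  | zero => exact hz
  | succ i ih =>
    have mod_lt : z % 2 ^ (2 * halfLength D e h₀ i) < 2 ^ (2 * halfLength D e h₀ i) :=
      Nat.mod_lt _ (by positivity)
    rw [generator]
    split_ifs
    · exact ih _ _ (numWalk_lt mod_lt)
    · exact ih _ _ mod_lt

theorem generator_succ_of_lt {x y r : ℕ} (hx : x < 2 ^ (2 * halfLength D e h₀ i))
    (hr : r < 2 ^ i) :
    generator D e h₀ (i + 1) (y * 2 ^ (2 * halfLength D e h₀ i) + x) r =
      generator D e h₀ i x r := by
  rw [generator, if_neg hr.not_ge, Nat.mul_add_mod_of_lt hx]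

theorem generator_succ_two_pow_add {x y r : ℕ} (hx : x < 2 ^ (2 * halfLength D e h₀ i)) :
    generator D e h₀ (i + 1) (y * 2 ^ (2 * halfLength D e h₀ i) + x) (2 ^ i + r) =
      generator D e h₀ i (numWalk (halfLength D e h₀ i) (walkLength D e i) y x) r := by
  rw [generator, if_pos (Nat.le_add_right _ _), Nat.add_sub_cancel_left,
    Nat.mul_add_mod_of_lt hx, mul_comm, Nat.mul_add_div (by positivity), Nat.div_eq_of_lt hx,
    add_zero]

theorem card_mul_decay_le {K c : ℕ} (hK : K ≤ 2 ^ D) (hc : c ≤ K ^ 2 ^ i) :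
    (c : ℝ) * (73 / 80) ^ walkLength D e i ≤ (1 / 2) ^ e := by
  have hc2 : (c : ℝ) ≤ 2 ^ (D * 2 ^ i) := by
    rw [pow_mul]
    exact_mod_cast hc.trans (Nat.pow_le_pow_left hK _)
  calc (c : ℝ) * (73 / 80) ^ walkLength D e i
      ≤ 2 ^ (D * 2 ^ i) * (1 / 2) ^ (D * 2 ^ i + e) := by
        rw [walkLength, pow_mul]
        gcongr
        norm_num
    _ = (1 / 2) ^ e := by
        rw [pow_add, ← mul_assoc, ← mul_pow]
        norm_num

open Classical in
theorem card_filter_range_mul_le {a b : ℕ} {Z E : ℕ → Prop} {F : ℕ → ℕ → Prop}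
    (h : ∀ x < b, ∀ y, Z (y * b + x) → E x ∨ F x y) :
    ((Finset.range (a * b)).filter Z).card ≤ a * ((Finset.range b).filter E).card +
      ∑ x ∈ Finset.range b, ((Finset.range a).filter (F x)).card := by
  rw [Finset.card_filter, sum_range_mul, Finset.sum_comm, Finset.card_filter, Finset.mul_sum,
    ← Finset.sum_add_distrib]
  refine Finset.sum_le_sum fun x hx => ?_
  have hx := Finset.mem_range.mp hx
  by_cases hE : E x
  · calc ∑ y ∈ Finset.range a, (if Z (y * b + x) then 1 else 0) ≤ ∑ y ∈ Finset.range a, 1 :=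
          Finset.sum_le_sum fun y _ => by split_ifs <;> simp
      _ ≤ _ := by simp [hE]
  · rw [if_neg hE, mul_zero, zero_add, ← Finset.card_filter]
    exact Finset.card_le_card <| Finset.monotone_filter_right _ fun y _ hZ =>
      (h x hx y hZ).resolve_left hE

open Classical in
theorem sum_card_numWalk_le {S : Type*} {h t : ℕ} {T : Finset S} {g : ℕ → S}
    (hg : ∀ x, g x ∈ T) {B : S → ℕ → Prop} {b : ℝ}
    (hB : ∀ v, (((Finset.range (2 ^ (2 * h))).filter (B v)).card : ℝ) ≤ 2 ^ (2 * h) * b) :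
    ∑ x ∈ Finset.range (2 ^ (2 * h)),
        (((Finset.range (8 ^ t)).filter fun y => B (g x) (numWalk h t y x)).card : ℝ) ≤
      8 ^ t * (2 ^ (2 * h) * (b + T.card * (73 / 80) ^ t)) := by
  let fiber (v : S) : Finset ℕ := (Finset.range (2 ^ (2 * h))).filter fun x => g x = v
  have fiber_bound (v : S) : ∑ x ∈ fiber v,
      (((Finset.range (8 ^ t)).filter fun y => B (g x) (numWalk h t y x)).card : ℝ) ≤
        8 ^ t * ((fiber v).card * b + (73 / 80) ^ t * 2 ^ (2 * h)) := by
    rw [Finset.sum_congr rfl fun x hx => by rw [(Finset.mem_filter.1 hx).2]]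
    refine (numWalk_mixing h t (fun x => g x = v) (B v)).trans ?_
    gcongr
    rw [div_le_iff₀ (by positivity), mul_assoc, mul_comm b]
    exact mul_le_mul_of_nonneg_left (hB v) (Nat.cast_nonneg _)
  have sum_card_fiber : ∑ v ∈ T, ((fiber v).card : ℝ) = 2 ^ (2 * h) := by
    have := Finset.card_eq_sum_card_fiberwise (s := Finset.range (2 ^ (2 * h)))
      fun x _ => hg x
    rw [Finset.card_range] at this
    exact_mod_cast this.symm
  calc _ = ∑ v ∈ T, ∑ x ∈ fiber v,
        (((Finset.range (8 ^ t)).filter fun y => B (g x) (numWalk h t y x)).card : ℝ) :=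
        (Finset.sum_fiberwise_of_maps_to (fun x _ => hg x) _).symm
    _ ≤ ∑ v ∈ T, 8 ^ t * ((fiber v).card * b + (73 / 80) ^ t * 2 ^ (2 * h)) :=
        Finset.sum_le_sum fun v _ => fiber_bound v
    _ = 8 ^ t * (2 ^ (2 * h) * (b + T.card * (73 / 80) ^ t)) := by
        rw [← Finset.mul_sum, Finset.sum_add_distrib, ← Finset.sum_mul, sum_card_fiber,
          Finset.sum_const, nsmul_eq_mul]
        ring

variable {S X : Type*} {step : S → X → S} {bad : ℕ → S → X → Prop}

theorem everBad_generator_succ {x y : ℕ} (hx : x < 2 ^ (2 * halfLength D e h₀ i))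
    (dec : ℕ → X) (j : ℕ) (s : S) :
    EverBad step bad (2 ^ (i + 1)) j s (fun r =>
        dec (generator D e h₀ (i + 1) (y * 2 ^ (2 * halfLength D e h₀ i) + x) r)) ↔
      EverBad step bad (2 ^ i) j s (fun r => dec (generator D e h₀ i x r)) ∨
        EverBad step bad (2 ^ i) (j + 2 ^ i)
          (endState step (2 ^ i) s fun r => dec (generator D e h₀ i x r)) fun r =>
            dec (generator D e h₀ i (numWalk (halfLength D e h₀ i) (walkLength D e i) y x) r) := by
  have first_half (r) (hr : r < 2 ^ i) := congrArg dec (generator_succ_of_lt (y := y) hx hr)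
  rw [pow_succ, mul_two, everBad_add, everBad_congr first_half, endState_congr first_half]
  simp only [generator_succ_two_pow_add hx]

open Classical in
/-- The second half of the output depends on the first only through the end state, which takes few
values, so that the walk replaces a fresh seed at the cost of its mixing error. -/
theorem card_everBad_generator_le {K : ℕ} (e h₀ : ℕ) (hK : K ≤ 2 ^ D)
    (hstep : ∀ s, ∃ T : Finset S, T.card ≤ K ∧ ∀ x, step s x ∈ T) (dec : ℕ → X) (δ : ℕ → ℝ)
    (hbad : ∀ j s, (((Finset.range (2 ^ (2 * h₀))).filter fun v => bad j s (dec v)).card : ℝ) ≤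
      2 ^ (2 * h₀) * δ j) (i j : ℕ) (s : S) :
    (((Finset.range (2 ^ (2 * halfLength D e h₀ i))).filter fun z =>
      EverBad step bad (2 ^ i) j s fun r => dec (generator D e h₀ i z r)).card : ℝ) ≤
      2 ^ (2 * halfLength D e h₀ i) *
        (∑ j' ∈ Finset.range (2 ^ i), δ (j + j') + (2 ^ i - 1) * (1 / 2) ^ e) := by
  induction i generalizing j s with
  | zero => simpa [halfLength, generator, EverBad] using hbad j s
  | succ i ih =>
    set h := halfLength D e h₀ i
    set t := walkLength D e i
    let err (j : ℕ) : ℝ := ∑ j' ∈ Finset.range (2 ^ i), δ (j + j') + (2 ^ i - 1) * (1 / 2) ^ e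
    let blocks (z r : ℕ) : X := dec (generator D e h₀ i z r)
    obtain ⟨T, card_T, end_mem_T⟩ := exists_endStates hstep (2 ^ i) s
    have second_half := sum_card_numWalk_le (h := h) (t := t) (fun x => end_mem_T (blocks x))
      (B := fun v z => EverBad step bad (2 ^ i) (j + 2 ^ i) v (blocks z))
      (ih (j + 2 ^ i))
    have halves := card_filter_range_mul_le (a := 8 ^ t)
      (Z := fun z => EverBad step bad (2 ^ (i + 1)) j s fun r =>
        dec (generator D e h₀ (i + 1) z r))
      fun x hx y => (everBad_generator_succ hx dec j s).mp
    rw [← two_pow_halfLength_succ] at halves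
    calc _ ≤ (8 : ℝ) ^ t * ((Finset.range (2 ^ (2 * h))).filter fun x =>
            EverBad step bad (2 ^ i) j s (blocks x)).card +
          ∑ x ∈ Finset.range (2 ^ (2 * h)), (((Finset.range (8 ^ t)).filter fun y =>
            EverBad step bad (2 ^ i) (j + 2 ^ i) (endState step (2 ^ i) s (blocks x))
              (blocks (numWalk h t y x))).card : ℝ) := by exact_mod_cast halves
      _ ≤ 8 ^ t * (2 ^ (2 * h) * err j) +
          8 ^ t * (2 ^ (2 * h) * (err (j + 2 ^ i) + (1 / 2) ^ e)) := by
        gcongr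
        · exact ih j s
        · refine second_half.trans ?_
          gcongr
          exact card_mul_decay_le hK card_T
      _ = 2 ^ (2 * halfLength D e h₀ (i + 1)) * (∑ j' ∈ Finset.range (2 ^ (i + 1)), δ (j + j') +
          (2 ^ (i + 1) - 1) * (1 / 2) ^ e) := by
        have hpow : (2 : ℝ) ^ (2 * halfLength D e h₀ (i + 1)) = 8 ^ t * 2 ^ (2 * h) := by
          exact_mod_cast two_pow_halfLength_succ D e h₀ i
        rw [hpow, pow_succ 2 i, mul_two, Finset.sum_range_add]
        simp only [err, add_assoc]
        ring

end Generator

/-! ### Shifting and rounding -/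

/-- `x` rounded down to a multiple of `c`. -/
def roundTo (x c : ℝ) : ℝ := (⌊x / c⌋ : ℝ) * c

section RoundTo

variable {x y c : ℝ}

theorem roundTo_le (hc : 0 < c) : roundTo x c ≤ x :=
  (le_div_iff₀ hc).mp (Int.floor_le (x / c))

theorem sub_lt_roundTo (hc : 0 < c) : x - c < roundTo x c := by
  rw [sub_lt_iff_lt_add, roundTo, ← add_one_mul]
  exact (div_lt_iff₀ hc).mp (Int.lt_floor_add_one (x / c))

theorem roundTo_mono (hc : 0 ≤ c) (hxy : x ≤ y) : roundTo x c ≤ roundTo y c := by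
  unfold roundTo
  gcongr

theorem roundTo_lt_roundTo_iff (hc : 0 < c) :
    roundTo x c < roundTo y c ↔ ∃ m : ℤ, x < m * c ∧ m * c ≤ y := by
  rw [roundTo, roundTo, mul_lt_mul_iff_left₀ hc, Int.cast_lt]
  simp only [← div_lt_iff₀ hc, ← le_div_iff₀ hc, ← Int.floor_lt, ← Int.le_floor]
  exact ⟨fun h => ⟨_, h, le_rfl⟩, fun ⟨_, hx, hy⟩ => hx.trans_le hy⟩

end RoundTo

/-- The width of the cells to which coordinates are rounded. It is large enough for one boundary
between cells to be moved out of the way of `d₀` intervals of length `2 * ε`. -/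
def cellWidth (ε : ℝ) (d₀ : ℕ) : ℝ := (d₀ + 1) * (2 * ε)

/-- The coordinate `x`, shifted by `D * (2 * ε)` and rounded. -/
def shiftRound (ε : ℝ) (d₀ D : ℕ) (x : ℝ) : ℝ := roundTo (x + D * (2 * ε)) (cellWidth ε d₀)

/-- After the shift with index `D`, the `ε`-neighbourhood of `x` meets two cells. -/
def Straddles (ε : ℝ) (d₀ D : ℕ) (x : ℝ) : Prop :=
  shiftRound ε d₀ D (x - ε) < shiftRound ε d₀ D (x + ε)

section Shift

variable {ε : ℝ} {d₀ D D' : ℕ} {x y : ℝ}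

theorem cellWidth_pos (hε : 0 < ε) (d₀ : ℕ) : 0 < cellWidth ε d₀ := by
  unfold cellWidth
  positivity

theorem cellWidth_le (hε : 0 < ε) (hd₀ : 1 ≤ d₀) : cellWidth ε d₀ ≤ 4 * (ε * d₀) := by
  have : ε * 1 ≤ ε * d₀ := by gcongr; exact_mod_cast hd₀
  unfold cellWidth
  linarith

theorem abs_shiftRound_sub_le (hε : 0 < ε) (hD : D ≤ d₀) :
    |shiftRound ε d₀ D x - x| ≤ cellWidth ε d₀ := by
  have lower := sub_lt_roundTo (x := x + D * (2 * ε)) (cellWidth_pos hε d₀)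
  have upper := roundTo_le (x := x + D * (2 * ε)) (cellWidth_pos hε d₀)
  have shift_nonneg : 0 ≤ D * (2 * ε) := by positivity
  have shift_le : D * (2 * ε) ≤ cellWidth ε d₀ := by
    unfold cellWidth
    gcongr
    exact_mod_cast hD.trans (Nat.le_succ d₀)
  unfold shiftRound
  rw [abs_le]
  constructor <;> linarith

theorem shiftRound_eq_of_abs_sub_le (hε : 0 < ε) (h : ¬Straddles ε d₀ D x) (hxy : |x - y| ≤ ε) :
    shiftRound ε d₀ D x = shiftRound ε d₀ D y := by
  have mono {u v : ℝ} (huv : u ≤ v) : shiftRound ε d₀ D u ≤ shiftRound ε d₀ D v :=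
    roundTo_mono (cellWidth_pos hε d₀).le (by gcongr)
  have constant {v : ℝ} (hv : |x - v| ≤ ε) : shiftRound ε d₀ D v = shiftRound ε d₀ D (x - ε) := by
    obtain ⟨_, _⟩ := abs_le.mp hv
    exact le_antisymm ((mono (by linarith)).trans (not_lt.mp h)) (mono (by linarith))
  rw [constant hxy, constant (by simpa using hε.le)]

theorem not_straddles_of_lt (hε : 0 < ε) (hDD' : D < D') (hD' : D' ≤ d₀)
    (h : Straddles ε d₀ D x) : ¬Straddles ε d₀ D' x := by
  intro h'
  have hc := cellWidth_pos hε d₀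
  obtain ⟨m, lt_m, m_le⟩ := (roundTo_lt_roundTo_iff hc).mp h
  obtain ⟨m', lt_m', m'_le⟩ := (roundTo_lt_roundTo_iff hc).mp h'
  have hDD'ε : (D + 1) * ε ≤ D' * ε := by gcongr; exact_mod_cast hDD'
  have hD'ε : D' * ε ≤ d₀ * ε := by gcongr
  have hDε : 0 ≤ D * ε := by positivity
  have m_lt_m' : m < m' := by
    have : m * cellWidth ε d₀ < m' * cellWidth ε d₀ := by linarith
    exact_mod_cast lt_of_mul_lt_mul_right this hc.le
  have next_cell : (m + 1) * cellWidth ε d₀ ≤ m' * cellWidth ε d₀ := by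
    gcongr
    exact_mod_cast m_lt_m'
  unfold cellWidth at *
  linarith

theorem Straddles.index_unique (hε : 0 < ε) (hD : D ≤ d₀) (hD' : D' ≤ d₀)
    (h : Straddles ε d₀ D x) (h' : Straddles ε d₀ D' x) : D = D' := by
  rcases lt_trichotomy D D' with hlt | heq | hgt
  · exact absurd h' (not_straddles_of_lt hε hlt hD' h)
  · exact heq
  · exact absurd h (not_straddles_of_lt hε hgt hD h')

end Shift

/-- After the shift with index `D`, none of the `ε`-neighbourhoods of the coordinates of `v` in the
block with index `q` meets two cells. Blocks consist of `d₀` consecutive coordinates. -/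
def GoodShift (ε : ℝ) (d₀ : ℕ) {d : ℕ} (v : Fin d → ℝ) (q D : ℕ) : Prop :=
  ∀ j : Fin d, (j : ℕ) / d₀ = q → ¬Straddles ε d₀ D (v j)

open Classical in
/-- The index of the shift of the block with index `q`. -/
def blockShift (ε : ℝ) (d₀ : ℕ) {d : ℕ} (v : Fin d → ℝ) (q : ℕ) : ℕ :=
  Nat.findGreatest (GoodShift ε d₀ v q) d₀

/-- `μ` shifted and rounded, with the shifts that are chosen for `v`. -/
def roundLike (ε : ℝ) (d₀ : ℕ) {d : ℕ} (v μ : Fin d → ℝ) : Fin d → ℝ :=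
  fun j => shiftRound ε d₀ (blockShift ε d₀ v (j / d₀)) (μ j)

/-- The answer of the steward to the value `v` of the current function. -/
def roundVec (ε : ℝ) (d₀ : ℕ) {d : ℕ} (v : Fin d → ℝ) : Fin d → ℝ := roundLike ε d₀ v v

section Round

variable {ε : ℝ} {d₀ d : ℕ}

theorem exists_goodShift (hε : 0 < ε) (hd₀ : 0 < d₀) (v : Fin d → ℝ) (q : ℕ) :
    ∃ D ≤ d₀, GoodShift ε d₀ v q D := by
  unfold GoodShift
  by_contra! hbad
  choose j hj hstraddles using hbad
  obtain ⟨D, D', hne, heq⟩ := Fintype.exists_ne_map_eq_of_card_lt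
    (fun D : Fin (d₀ + 1) => (⟨j D (Fin.is_le D) % d₀, Nat.mod_lt _ hd₀⟩ : Fin d₀)) (by simp)
  have same_coordinate : j D (Fin.is_le D) = j D' (Fin.is_le D') := by
    rw [Fin.ext_iff, ← Nat.div_add_mod (j D _ : ℕ) d₀, ← Nat.div_add_mod (j D' _ : ℕ) d₀, hj, hj,
      Fin.mk.inj heq]
  have straddles' := hstraddles D' (Fin.is_le D')
  rw [← same_coordinate] at straddles'
  exact hne (Fin.ext ((hstraddles D _).index_unique hε (Fin.is_le D) (Fin.is_le D') straddles'))

open Classical in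
theorem blockShift_le (v : Fin d → ℝ) (q : ℕ) : blockShift ε d₀ v q ≤ d₀ :=
  Nat.findGreatest_le d₀

open Classical in
theorem goodShift_blockShift (hε : 0 < ε) (hd₀ : 0 < d₀) (v : Fin d → ℝ) (q : ℕ) :
    GoodShift ε d₀ v q (blockShift ε d₀ v q) :=
  have ⟨_, hD, hgood⟩ := exists_goodShift hε hd₀ v q
  Nat.findGreatest_spec hD hgood

theorem roundVec_eq_roundLike (hε : 0 < ε) (hd₀ : 0 < d₀) {v μ : Fin d → ℝ}
    (h : ‖v - μ‖ ≤ ε) : roundVec ε d₀ v = roundLike ε d₀ v μ :=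
  funext fun j => shiftRound_eq_of_abs_sub_le hε (goodShift_blockShift hε hd₀ v _ j rfl)
    ((norm_le_pi_norm (v - μ) j).trans h)

theorem norm_roundLike_sub_le (hε : 0 < ε) (v μ : Fin d → ℝ) :
    ‖roundLike ε d₀ v μ - μ‖ ≤ cellWidth ε d₀ :=
  (pi_norm_le_iff_of_nonneg (cellWidth_pos hε d₀).le).mpr fun _ =>
    abs_shiftRound_sub_le hε (blockShift_le v _)

theorem div_lt_ceilDiv (hd₀ : 0 < d₀) (j : Fin d) : (j : ℕ) / d₀ < d ⌈/⌉ d₀ := by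
  by_contra! h
  exact absurd ((ceilDiv_le_iff_le_mul hd₀).mp h) (not_le.mpr ((Nat.mul_div_le j d₀).trans_lt j.2))

open Classical in
theorem exists_finset_roundLike_mem (ε : ℝ) (hd₀ : 0 < d₀) (μ : Fin d → ℝ) :
    ∃ T : Finset (Fin d → ℝ), T.card ≤ (d₀ + 1) ^ (d ⌈/⌉ d₀) ∧ ∀ v, roundLike ε d₀ v μ ∈ T := by
  let roundWith (shifts : Fin (d ⌈/⌉ d₀) → Fin (d₀ + 1)) (j : Fin d) : ℝ :=
    shiftRound ε d₀ (shifts ⟨j / d₀, div_lt_ceilDiv hd₀ j⟩) (μ j)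
  refine ⟨Finset.univ.image roundWith, Finset.card_image_le.trans (by simp), fun v => ?_⟩
  exact Finset.mem_image.mpr ⟨fun q => ⟨blockShift ε d₀ v q, Nat.lt_succ_of_le (blockShift_le v _)⟩,
    Finset.mem_univ _, rfl⟩

end Round

/-! ### The answers of the steward and their correctness -/

section CompareProcesses

variable {S X : Type*} {step step' : S → X → S} {bad : ℕ → S → X → Prop}

theorem endState_succ (r : ℕ) (s : S) (x : ℕ → X) :
    endState step (r + 1) s x = step (endState step r s x) (x r) := by
  induction r generalizing s x with
  | zero => rfl
  | succ r ih => rw [endState, ih, endState]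

theorem EverBad.mono {r r' j : ℕ} {s : S} {x : ℕ → X} (h : EverBad step bad r j s x)
    (hr : r ≤ r') : EverBad step bad r' j s x := by
  obtain ⟨q, rfl⟩ := Nat.exists_eq_add_of_le hr
  exact (everBad_add r q j s x).mpr (Or.inl h)

theorem not_bad_of_not_everBad {r i j : ℕ} {s : S} {x : ℕ → X} (h : ¬EverBad step bad r j s x)
    (hi : i < r) : ¬bad (j + i) (endState step i s x) (x i) := by
  obtain ⟨r', rfl⟩ := Nat.exists_eq_add_of_lt hi
  rw [add_assoc, everBad_add, EverBad] at h
  tauto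

theorem endState_eq_of_not_everBad {r j : ℕ} {s : S} {x : ℕ → X}
    (hstep : ∀ i < r, ∀ s x, ¬bad (j + i) s x → step s x = step' s x)
    (h : ¬EverBad step bad r j s x) : endState step r s x = endState step' r s x := by
  induction r with
  | zero => rfl
  | succ r ih =>
    rw [endState_succ, endState_succ, hstep r r.lt_succ_self _ _ (not_bad_of_not_everBad h
      r.lt_succ_self),
      ih (fun i hi => hstep i (hi.trans r.lt_succ_self)) fun h' => h (h'.mono r.le_succ)]

end CompareProcesses

section Answers

variable {n d : ℕ}

/-- The list of answers after a further query `x` to the function chosen by `f`. -/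
def answerStep (ε : ℝ) (d₀ : ℕ) (f : List (Fin d → ℝ) → Bits n → Fin d → ℝ)
    (s : List (Fin d → ℝ)) (x : Bits n) : List (Fin d → ℝ) :=
  s ++ [roundVec ε d₀ (f s x)]

/-- The first `r` answers to functions chosen by `f`, queried at `x 0, x 1, …`. -/
def answersTo (ε : ℝ) (d₀ : ℕ) (f : List (Fin d → ℝ) → Bits n → Fin d → ℝ) (x : ℕ → Bits n)
    (r : ℕ) : List (Fin d → ℝ) :=
  endState (answerStep ε d₀ f) r [] x

variable {ε : ℝ} {d₀ : ℕ} {f : List (Fin d → ℝ) → Bits n → Fin d → ℝ} {x : ℕ → Bits n}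

theorem answersTo_succ (r : ℕ) : answersTo ε d₀ f x (r + 1) =
    answersTo ε d₀ f x r ++ [roundVec ε d₀ (f (answersTo ε d₀ f x r) (x r))] :=
  endState_succ r [] x

theorem length_answersTo (r : ℕ) : (answersTo ε d₀ f x r).length = r := by
  induction r with
  | zero => rfl
  | succ r ih => rw [answersTo_succ, List.length_append, ih, List.length_singleton]

theorem answersTo_prefix {i r : ℕ} (h : i ≤ r) :
    answersTo ε d₀ f x i <+: answersTo ε d₀ f x r := by
  induction h with
  | refl => exact List.prefix_rfl
  | step _ ih => exact ih.trans (answersTo_succ (f := f) _ ▸ List.prefix_append _ _)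

theorem take_answersTo {i r : ℕ} (h : i ≤ r) :
    (answersTo ε d₀ f x r).take i = answersTo ε d₀ f x i := by
  rw [List.prefix_iff_eq_take.mp (answersTo_prefix (f := f) h), length_answersTo]

theorem getElem_answersTo {i r : ℕ} (h : i < (answersTo ε d₀ f x r).length) :
    (answersTo ε d₀ f x r)[i] = roundVec ε d₀ (f (answersTo ε d₀ f x i) (x i)) := by
  rw [length_answersTo] at h
  rw [← (answersTo_prefix h).getElem (by simp [length_answersTo])]
  simp only [answersTo_succ]
  exact List.getElem_concat_length (by rw [length_answersTo]) _

end Answers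

section Owner

variable {n d : ℕ} {ε δ : ℝ}

/-- The list of answers after a further round in which the shifts are chosen as for the query `x`
but applied to the point of concentration, so that there are few possible answers. -/
def idealStep (ε : ℝ) (d₀ : ℕ) (O : Owner n d ε δ) (s : List (Fin d → ℝ)) (x : Bits n) :
    List (Fin d → ℝ) :=
  s ++ [roundLike ε d₀ (O.func s x) (O.point s)]

/-- The query `x` in round `j < k` misses the point of concentration. -/
def BadQuery (ε : ℝ) (k : ℕ) (O : Owner n d ε δ) (j : ℕ) (s : List (Fin d → ℝ)) (x : Bits n) :
    Prop :=
  j < k ∧ ε < ‖O.func s x - O.point s‖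

theorem norm_roundVec_sub_le_of_not_everBad (hε : 0 < ε) {d₀ k : ℕ} (hd₀ : 0 < d₀)
    {O : Owner n d ε δ} {x : ℕ → Bits n}
    (h : ¬EverBad (idealStep ε d₀ O) (BadQuery ε k O) k 0 [] x) {i : ℕ} (hi : i < k) :
    ‖roundVec ε d₀ (O.func (answersTo ε d₀ O.func x i) (x i)) -
      O.point (answersTo ε d₀ O.func x i)‖ ≤ cellWidth ε d₀ := by
  have good {i : ℕ} (hi : i < k) {s : List (Fin d → ℝ)} {x : Bits n}
      (hs : ¬BadQuery ε k O (0 + i) s x) : ‖O.func s x - O.point s‖ ≤ ε :=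
    not_lt.mp fun hlt => hs ⟨by omega, hlt⟩
  have ideal_eq : endState (idealStep ε d₀ O) i [] x = answersTo ε d₀ O.func x i :=
    endState_eq_of_not_everBad (fun j hj s y hs => by
      rw [idealStep, answerStep, roundVec_eq_roundLike hε hd₀ (good (hj.trans hi) hs)])
      fun h' => h (h'.mono hi.le)
  rw [← ideal_eq, roundVec_eq_roundLike hε hd₀ (good hi (not_bad_of_not_everBad h hi))]
  exact norm_roundLike_sub_le hε _ _

/-! ### Uniform bit strings -/

/-- The bit string whose entries are the binary digits of `v`. -/
def bitsOf (n v : ℕ) : Bits n := fun j => v.testBit j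

theorem bitsOf_mul_add {n u : ℕ} (p : ℕ) (hu : u < 2 ^ n) :
    bitsOf n (p * 2 ^ n + u) = bitsOf n u := by
  funext j
  simp only [bitsOf, mul_comm p, Nat.testBit_two_pow_mul_add p hu, j.2, if_true]

theorem bitsOf_injOn (n : ℕ) : Set.InjOn (bitsOf n) {v | v < 2 ^ n} := by
  intro u hu v hv huv
  refine Nat.eq_of_testBit_eq fun i => ?_
  rcases Nat.lt_or_ge i n with hi | hi
  · exact congrFun huv ⟨i, hi⟩
  · have hpow := Nat.pow_le_pow_right two_pos hi
    rw [Nat.testBit_lt_two_pow (hu.trans_le hpow), Nat.testBit_lt_two_pow (hv.trans_le hpow)]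

open Classical in
theorem card_filter_bitsOf_mem_le (n : ℕ) (E : Set (Bits n)) :
    ((Finset.range (2 ^ n)).filter fun v => bitsOf n v ∈ E).card ≤ E.ncard := by
  rw [Set.ncard_eq_toFinset_card']
  refine Finset.card_le_card_of_injOn (bitsOf n)
    (fun v hv => by simpa using (Finset.mem_filter.mp hv).2) ((bitsOf_injOn n).mono fun v hv => ?_)
  exact Finset.mem_range.mp (Finset.mem_filter.mp hv).1

open Classical in
theorem card_filter_bitsOf_mem_le_mul_uniformProb {n h : ℕ} (hn : n ≤ h) (E : Set (Bits n)) :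
    (((Finset.range (2 ^ h)).filter fun v => bitsOf n v ∈ E).card : ℝ) ≤
      2 ^ h * uniformProb E := by
  obtain ⟨q, rfl⟩ := Nat.exists_eq_add_of_le' hn
  have card_eq : ((Finset.range (2 ^ (q + n))).filter fun v => bitsOf n v ∈ E).card =
      2 ^ q * ((Finset.range (2 ^ n)).filter fun v => bitsOf n v ∈ E).card := by
    rw [Finset.card_filter, pow_add, sum_range_mul, Finset.card_filter]
    rw [Finset.sum_congr rfl fun p _ => Finset.sum_congr rfl fun u hu => by
      rw [bitsOf_mul_add p (Finset.mem_range.mp hu)]]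
    rw [Finset.sum_const, Finset.card_range, smul_eq_mul]
  calc (((Finset.range (2 ^ (q + n))).filter fun v => bitsOf n v ∈ E).card : ℝ)
      ≤ 2 ^ q * E.ncard := by
        rw [card_eq]
        exact_mod_cast Nat.mul_le_mul_left _ (card_filter_bitsOf_mem_le n E)
    _ = 2 ^ (q + n) * uniformProb E := by
        rw [uniformProb, Fintype.card_fun, Fintype.card_bool, Fintype.card_fin, Nat.cast_pow,
          Nat.cast_ofNat, pow_add, mul_assoc, mul_div_cancel₀ _ (by positivity)]

theorem sum_range_ite_lt (δ : ℝ) {k m : ℕ} (hk : k ≤ m) :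
    ∑ j ∈ Finset.range m, (if j < k then δ else 0) = k * δ := by
  have range_filter : (Finset.range m).filter (· < k) = Finset.range k := by grind
  rw [← Finset.sum_filter, range_filter, Finset.sum_const, Finset.card_range, nsmul_eq_mul]

open Classical in
theorem card_everBad_idealStep_le {d₀ k D e h₀ l : ℕ} {γ : ℝ} (hd₀ : 0 < d₀)
    (hD : (d₀ + 1) ^ (d ⌈/⌉ d₀) ≤ 2 ^ D) (hl : k ≤ 2 ^ l) (hn : n ≤ 2 * h₀)
    (he : 2 ^ l * (1 / 2 : ℝ) ^ e ≤ γ) (O : Owner n d ε δ) :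
    (((Finset.range (2 ^ (2 * halfLength D e h₀ l))).filter fun z =>
      EverBad (idealStep ε d₀ O) (BadQuery ε k O) (2 ^ l) 0 [] fun r =>
        bitsOf n (generator D e h₀ l z r)).card : ℝ) ≤
      2 ^ (2 * halfLength D e h₀ l) * (k * δ + γ) := by
  have few_branches (s : List (Fin d → ℝ)) : ∃ T : Finset (List (Fin d → ℝ)),
      T.card ≤ (d₀ + 1) ^ (d ⌈/⌉ d₀) ∧ ∀ x, idealStep ε d₀ O s x ∈ T := by
    obtain ⟨T, card_T, hT⟩ := exists_finset_roundLike_mem ε hd₀ (O.point s)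
    exact ⟨T.image fun y => s ++ [y], Finset.card_image_le.trans card_T,
      fun x => Finset.mem_image_of_mem _ (hT _)⟩
  have card_bad_le (j : ℕ) (s : List (Fin d → ℝ)) :
      (((Finset.range (2 ^ (2 * h₀))).filter fun v => BadQuery ε k O j s (bitsOf n v)).card : ℝ) ≤
        2 ^ (2 * h₀) * if j < k then δ else 0 := by
    by_cases hj : j < k
    · simp only [BadQuery, hj, true_and, if_true]
      exact (card_filter_bitsOf_mem_le_mul_uniformProb hn {x | ε < ‖O.func s x - O.point s‖}).trans
        (mul_le_mul_of_nonneg_left (O.concentrated s) (by positivity))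
    · simp [BadQuery, hj]
  refine (card_everBad_generator_le e h₀ hD few_branches (bitsOf n) _ card_bad_le l 0 []).trans ?_
  have error_le : (2 ^ l - 1) * (1 / 2 : ℝ) ^ e ≤ γ := le_trans (by gcongr; linarith) he
  simp only [zero_add, sum_range_ite_lt δ hl]
  gcongr

end Owner

/-! ### Numbers from coins -/

/-- The number whose binary digits are those of `a`, followed by `l`. -/
def coinNumber : List Bool → ℕ → ℕ
  | [], a => a
  | b :: l, a => coinNumber l (2 * a + b.toNat)

theorem coinNumber_inj {l l' : List Bool} (hlen : l.length = l'.length) {a a' : ℕ}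
    (h : coinNumber l a = coinNumber l' a') : a = a' ∧ l = l' := by
  induction l generalizing l' a a' with
  | nil =>
    obtain rfl := List.length_eq_zero_iff.mp hlen.symm
    exact ⟨h, rfl⟩
  | cons b l ih =>
    obtain ⟨b', l', rfl⟩ := List.exists_cons_of_length_eq_add_one hlen.symm
    obtain ⟨heq, rfl⟩ := ih (Nat.succ.inj hlen) h
    cases b <;> cases b' <;> simp_all <;> omega

theorem coinNumber_lt (l : List Bool) (a : ℕ) : coinNumber l a < (a + 1) * 2 ^ l.length := by
  induction l generalizing a with
  | nil => simp [coinNumber]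
  | cons b l ih =>
    have := b.toNat_lt
    calc coinNumber (b :: l) a < (2 * a + b.toNat + 1) * 2 ^ l.length := ih (2 * a + b.toNat)
      _ ≤ 2 * (a + 1) * 2 ^ l.length := Nat.mul_le_mul_right _ (by omega)
      _ = (a + 1) * 2 ^ (b :: l).length := by rw [List.length_cons, pow_succ]; ring

theorem coinNumber_ofFn_lt {m : ℕ} (z : Bits m) : coinNumber (List.ofFn z) 0 < 2 ^ m := by
  simpa using coinNumber_lt (List.ofFn z) 0

open Classical in
theorem uniformProb_coinNumber_le {m : ℕ} {p : ℝ} {P : ℕ → Prop}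
    (h : (((Finset.range (2 ^ m)).filter P).card : ℝ) ≤ 2 ^ m * p) :
    uniformProb {z : Bits m | P (coinNumber (List.ofFn z) 0)} ≤ p := by
  have ncard_le : {z : Bits m | P (coinNumber (List.ofFn z) 0)}.ncard ≤
      ((Finset.range (2 ^ m)).filter P).card := by
    rw [Set.ncard_eq_toFinset_card']
    refine Finset.card_le_card_of_injOn (fun z => coinNumber (List.ofFn z) 0) (fun z hz => ?_)
      fun z _ z' _ heq => List.ofFn_injective (coinNumber_inj (by simp) heq).2
    simpa using ⟨coinNumber_ofFn_lt z, by simpa using hz⟩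
  rw [uniformProb, Fintype.card_fun, Fintype.card_bool, Fintype.card_fin, Nat.cast_pow,
    Nat.cast_ofNat, div_le_iff₀' (by positivity)]
  exact (Nat.cast_le.mpr ncard_le).trans h

/-! ### Rules for programs -/

/-- An exponent `e` such that a program whose loops are passed through at most `N` times takes at
most `(N + 3) ^ e` steps. -/
def Prog.degree : Prog → ℕ
  | .skip | .setN _ _ | .setR _ _ | .coin _ => 0
  | .query _ _ | .answer _ => 1
  | .seq p q | .ite _ p q => max p.degree q.degree + 1
  | .loop _ p => p.degree + 2

/-- Started in `s`, the program halts in a state that satisfies `Q`, within the number of steps that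
its degree allows for if loops are passed through at most `N` times. -/
def Runs {n d : ℕ} (k : ℕ) (f : List (Fin d → ℝ) → Bits n → Fin d → ℝ) (N : ℕ) (p : Prog)
    (Q : State d → Prop) (s : State d) : Prop :=
  ∃ t s', Exec k f p s t s' ∧ t ≤ (N + 3) ^ p.degree ∧ Q s'

section Rules

variable {n d k : ℕ} {f : List (Fin d → ℝ) → Bits n → Fin d → ℝ} {N : ℕ} {s : State d}
  {Q Q' : State d → Prop} {p q : Prog}

theorem Runs.mono (h : Runs k f N p Q s) (hQ : ∀ s', Q s' → Q' s') : Runs k f N p Q' s :=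
  have ⟨t, s', hx, ht, hs'⟩ := h
  ⟨t, s', hx, ht, hQ s' hs'⟩

theorem Runs.skip (h : Q s) : Runs k f N .skip Q s :=
  ⟨1, s, .skip s, le_rfl, h⟩

theorem Runs.setN {a x : NExpr}
    (h : Q { s with nat := Function.update s.nat (a.val s) (x.val s) }) :
    Runs k f N (.setN a x) Q s :=
  ⟨1, _, .setN s a x, le_rfl, h⟩

theorem Runs.setR {a : NExpr} {x : RExpr}
    (h : Q { s with real := Function.update s.real (a.val s) (x.val s) }) :
    Runs k f N (.setR a x) Q s :=
  ⟨1, _, .setR s a x, le_rfl, h⟩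

theorem Runs.coin {a : NExpr} {b : Bool} {l : List Bool} (hs : s.coins = b :: l)
    (h : Q { s with nat := Function.update s.nat (a.val s) b.toNat, coins := l }) :
    Runs k f N (.coin a) Q s :=
  ⟨1, _, .coin s a b l hs, le_rfl, h⟩

theorem Runs.query {a b : NExpr} (hN : n + d ≤ N) (hk : s.answers.length < k)
    (hq : s.queried = false)
    (h : Q { s with
      real := s.storeVec (b.val s) (f s.answers (s.readBits n (a.val s))), queried := true }) :
    Runs k f N (.query a b) Q s :=
  ⟨_, _, .query s a b hk hq, by rw [Prog.degree, pow_one]; omega, h⟩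

theorem Runs.answer {a : NExpr} (hN : d ≤ N) (hk : s.answers.length < k) (hq : s.queried = true)
    (h : Q { s with answers := s.answers ++ [s.readVec (a.val s)], queried := false }) :
    Runs k f N (.answer a) Q s :=
  ⟨_, _, .answer s a hk hq, by rw [Prog.degree, pow_one]; omega, h⟩

theorem pow_add_pow_lt_pow_max (N a b : ℕ) :
    (N + 3) ^ a + (N + 3) ^ b < (N + 3) ^ (max a b + 1) := by
  have hab : (N + 3) ^ a ≤ (N + 3) ^ max a b ∧ (N + 3) ^ b ≤ (N + 3) ^ max a b :=
    ⟨Nat.pow_le_pow_right (by omega) (le_max_left a b),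
      Nat.pow_le_pow_right (by omega) (le_max_right a b)⟩
  have hpos : 0 < (N + 3) ^ max a b := by positivity
  have : 3 * (N + 3) ^ max a b ≤ (N + 3) ^ (max a b + 1) := by
    rw [pow_succ']
    gcongr
    omega
  omega

theorem Runs.seq (h : Runs k f N p (fun s₁ => Runs k f N q Q s₁) s) :
    Runs k f N (.seq p q) Q s := by
  obtain ⟨t₁, s₁, h₁, ht₁, t₂, s₂, h₂, ht₂, hq⟩ := h
  refine ⟨_, s₂, .seq p q s s₁ s₂ t₁ t₂ h₁ h₂, ?_, hq⟩
  exact (add_le_add ht₁ ht₂).trans (pow_add_pow_lt_pow_max N _ _).le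

theorem Runs.ite {b : Test} (h₁ : b.Holds s → Runs k f N p Q s)
    (h₂ : ¬b.Holds s → Runs k f N q Q s) : Runs k f N (.ite b p q) Q s := by
  have hlt := pow_add_pow_lt_pow_max N p.degree q.degree
  by_cases hb : b.Holds s
  · obtain ⟨t, s', hx, ht, hq⟩ := h₁ hb
    exact ⟨_, s', .iteTrue b p q s s' t hb hx, by rw [Prog.degree]; omega, hq⟩
  · obtain ⟨t, s', hx, ht, hq⟩ := h₂ hb
    exact ⟨_, s', .iteFalse b p q s s' t hb hx, by rw [Prog.degree]; omega, hq⟩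

theorem Runs.loop {b : Test} (I : ℕ → State d → Prop) (c : ℕ) (hc : c ≤ N) (h0 : I 0 s)
    (hstep : ∀ j < c, ∀ s, I j s → b.Holds s ∧ Runs k f N p (I (j + 1)) s)
    (hend : ∀ s, I c s → ¬b.Holds s ∧ Q s) : Runs k f N (.loop b p) Q s := by
  have exec_rest (j : ℕ) (hj : j ≤ c) (s : State d) (hs : I (c - j) s) : ∃ t s',
      Exec k f (.loop b p) s t s' ∧ t ≤ j * ((N + 3) ^ p.degree + 1) + 1 ∧ Q s' := by
    induction j generalizing s with
    | zero => exact ⟨1, s, .loopFalse b p s (hend s hs).1, by omega, (hend s hs).2⟩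
    | succ j ih =>
      obtain ⟨hb, t₁, s₁, hx₁, ht₁, hI⟩ := hstep (c - (j + 1)) (by omega) s hs
      rw [show c - (j + 1) + 1 = c - j by omega] at hI
      obtain ⟨t₂, s₂, hx₂, ht₂, hq⟩ := ih (by omega) s₁ hI
      exact ⟨_, s₂, .loopTrue b p s s₁ s₂ t₁ t₂ hb hx₁ hx₂, by rw [add_mul, one_mul]; omega, hq⟩
  obtain ⟨t, s', hx, ht, hq⟩ := exec_rest c le_rfl s (by rwa [Nat.sub_self])
  refine ⟨t, s', hx, ht.trans ?_, hq⟩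
  have hpos : 0 < (N + 3) ^ p.degree := by positivity
  calc c * ((N + 3) ^ p.degree + 1) + 1 ≤ (N + 1) * ((N + 3) ^ p.degree + (N + 3) ^ p.degree) := by
        nlinarith
    _ = 2 * (N + 1) * (N + 3) ^ p.degree := by ring
    _ ≤ (N + 3) ^ 2 * (N + 3) ^ p.degree := Nat.mul_le_mul_right _ (by nlinarith)
    _ = (N + 3) ^ (Prog.loop b p).degree := by rw [← pow_add, Prog.degree, add_comm 2]

/-- The state is `s`, except that its natural memory satisfies `R`. -/
def NatPost (s : State d) (R : (ℕ → ℕ) → Prop) (s' : State d) : Prop :=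
  ∃ g, s' = { s with nat := g } ∧ R g

theorem Runs.bindNat {R : (ℕ → ℕ) → Prop} {s' : State d} (h : Runs k f N p (NatPost s R) s')
    (hQ : ∀ g, R g → Q { s with nat := g }) : Runs k f N p Q s' :=
  h.mono fun _ ⟨g, hg, hR⟩ => hg ▸ hQ g hR

theorem Runs.bindNat_seq {R : (ℕ → ℕ) → Prop} {s' : State d} (h : Runs k f N p (NatPost s R) s')
    (hQ : ∀ g, R g → Runs k f N q Q { s with nat := g }) : Runs k f N (.seq p q) Q s' :=
  Runs.seq (h.bindNat hQ)

theorem Runs.natLoop {g : ℕ → ℕ} {b : Test} (I : ℕ → (ℕ → ℕ) → Prop) (c : ℕ) (hc : c ≤ N)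
    (h0 : I 0 g)
    (hstep : ∀ j < c, ∀ g, I j g → b.Holds { s with nat := g } ∧
      Runs k f N p (NatPost s (I (j + 1))) { s with nat := g })
    (hend : ∀ g, I c g → ¬b.Holds { s with nat := g } ∧ Q { s with nat := g }) :
    Runs k f N (.loop b p) Q { s with nat := g } := by
  refine Runs.loop (fun j => NatPost s (I j)) c hc ⟨g, rfl, h0⟩ ?_ ?_
  · rintro j hj _ ⟨g, rfl, hg⟩
    exact hstep j hj g hg
  · rintro _ ⟨g, rfl, hg⟩
    exact hend g hg

theorem Runs.assign_seq {g : ℕ → ℕ} {a : ℕ} {x : NExpr}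
    (h : Runs k f N q Q { s with nat := Function.update g a (x.val { s with nat := g }) }) :
    Runs k f N (.seq (.setN (.const a) x) q) Q { s with nat := g } :=
  Runs.seq (Runs.setN h)

theorem Runs.assign_nat {g : ℕ → ℕ} {R : (ℕ → ℕ) → Prop} {a : ℕ} {x : NExpr}
    (h : R (Function.update g a (x.val { s with nat := g }))) :
    Runs k f N (.setN (.const a) x) (NatPost s R) { s with nat := g } :=
  Runs.setN ⟨_, rfl, h⟩

theorem Runs.skip_nat {g : ℕ → ℕ} {R : (ℕ → ℕ) → Prop} (h : R g) :
    Runs k f N .skip (NatPost s R) { s with nat := g } :=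
  Runs.skip ⟨_, rfl, h⟩

end Rules

/-! ### Notation for programs -/

/-- The constant `c`. -/
abbrev num (c : ℕ) : NExpr := .const c

/-- The content of the natural register `a`. -/
abbrev reg (a : ℕ) : NExpr := .mem (.const a)

/-- Store the value of `x` in the natural register `a`. -/
abbrev assign (a : ℕ) (x : NExpr) : Prog := .setN (.const a) x

/-- The content of the real register `a`. -/
abbrev realReg (a : ℕ) : RExpr := .mem (.const a)

/-- Store the value of `x` in the real register `a`. -/
abbrev assignReal (a : ℕ) (x : RExpr) : Prog := .setR (.const a) x

instance : Add NExpr := ⟨.add⟩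
instance : Sub NExpr := ⟨.sub⟩
instance : Add RExpr := ⟨.add⟩
instance : Sub RExpr := ⟨.sub⟩

infixr:50 " ;; " => Prog.seq

section Values

variable {d : ℕ} (s : State d)

@[simp, grind =]
theorem val_const (c : ℕ) : (NExpr.const c).val s = c := rfl

@[simp, grind =]
theorem val_mem (x : NExpr) : (NExpr.mem x).val s = s.nat (x.val s) := rfl

@[simp, grind =]
theorem val_add (x y : NExpr) : (x + y).val s = x.val s + y.val s := rfl

@[simp, grind =]
theorem val_sub (x y : NExpr) : (x - y).val s = x.val s - y.val s := rfl

@[simp, grind =]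
theorem realVal_const (c : ℕ) : (RExpr.const c).val s = c := rfl

@[simp, grind =]
theorem realVal_mem (x : NExpr) : (RExpr.mem x).val s = s.real (x.val s) := rfl

@[simp, grind =]
theorem realVal_add (x y : RExpr) : (x + y).val s = x.val s + y.val s := rfl

@[simp, grind =]
theorem realVal_sub (x y : RExpr) : (x - y).val s = x.val s - y.val s := rfl

@[simp, grind =]
theorem realVal_roundDown (x y : RExpr) :
    (RExpr.roundDown x y).val s = roundTo (x.val s) (y.val s) := rfl

@[simp, grind =]
theorem holds_ltN (x y : NExpr) : (Test.ltN x y).Holds s ↔ x.val s < y.val s := Iff.rfl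

@[simp, grind =]
theorem holds_ltR (x y : RExpr) : (Test.ltR x y).Holds s ↔ x.val s < y.val s := Iff.rfl

@[simp, grind =]
theorem holds_not (b : Test) : (Test.not b).Holds s ↔ ¬b.Holds s := Iff.rfl

end Values

/-- The natural memories agree on the registers below `c` and from `64` on. Subprograms use the
registers from some `c` on for their arguments, results and intermediate values; the registers from
`64` on are reserved for the points at which functions are queried. -/
abbrev AgreesOff (c : ℕ) (g g' : ℕ → ℕ) : Prop := ∀ a, a < c ∨ 64 ≤ a → g' a = g a

/-! ### Arithmetic programs -/

namespace Reg

/-- The number that `shiftProg` shifts. -/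
abbrev shifted : ℕ := 60

/-- The number of binary places by which `shiftProg` shifts. -/
abbrev shiftCount : ℕ := 61

/-- The dividend of `divProg`, and then the remainder. -/
abbrev dividend : ℕ := 50

/-- The binary logarithm of the divisor of `divProg`. -/
abbrev divExp : ℕ := 51

/-- A bound for the number of binary digits of the quotient computed by `divProg`. -/
abbrev quotientLen : ℕ := 52

/-- The quotient computed by `divProg`. -/
abbrev quotient : ℕ := 53

end Reg

/-- Shift a number to the left. -/
def shiftProg : Prog :=
  .loop (.ltN (num 0) (reg Reg.shiftCount))
    (assign Reg.shifted (reg Reg.shifted + reg Reg.shifted) ;;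
      assign Reg.shiftCount (reg Reg.shiftCount - num 1))

/-- The next digit of a binary long division. -/
def divStepProg : Prog :=
  assign Reg.quotientLen (reg Reg.quotientLen - num 1) ;;
  assign Reg.shifted (num 1) ;;
  assign Reg.shiftCount (reg Reg.divExp + reg Reg.quotientLen) ;;
  shiftProg ;;
  assign Reg.quotient (reg Reg.quotient + reg Reg.quotient) ;;
  .ite (.ltN (reg Reg.dividend) (reg Reg.shifted)) .skip
    (assign Reg.dividend (reg Reg.dividend - reg Reg.shifted) ;;
      assign Reg.quotient (reg Reg.quotient + num 1))

/-- Divide by a power of two with remainder. -/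
def divProg : Prog :=
  assign Reg.quotient (num 0) ;; .loop (.ltN (num 0) (reg Reg.quotientLen)) divStepProg

section Arithmetic

variable {n d k : ℕ} {f : List (Fin d → ℝ) → Bits n → Fin d → ℝ} {N : ℕ}

theorem shiftProg_runs (s : State d) (u : ℕ → ℕ) (hN : u Reg.shiftCount ≤ N) :
    Runs k f N shiftProg (NatPost s fun g =>
      g Reg.shifted = u Reg.shifted * 2 ^ u Reg.shiftCount ∧ AgreesOff 60 u g)
      { s with nat := u } := by
  refine Runs.natLoop (fun j g => g Reg.shifted = u Reg.shifted * 2 ^ j ∧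
    g Reg.shiftCount = u Reg.shiftCount - j ∧ AgreesOff 60 u g) _ hN
    ⟨by simp, by simp, fun _ _ => rfl⟩ ?_ ?_
  · rintro j hj g ⟨hshifted, hcount, hg⟩
    refine ⟨by grind, Runs.assign_seq (Runs.assign_nat ?_)⟩
    grind
  · rintro g ⟨hshifted, hcount, hg⟩
    exact ⟨by grind, g, rfl, hshifted, hg⟩

theorem div_mod_two_pow_succ (v c : ℕ) :
    v / 2 ^ c = 2 * (v / 2 ^ (c + 1)) + v / 2 ^ c % 2 ∧
      v % 2 ^ (c + 1) = v % 2 ^ c + 2 ^ c * (v / 2 ^ c % 2) := by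
  rw [pow_succ, Nat.mod_mul, ← Nat.div_div_eq_div_mul]
  exact ⟨(Nat.div_add_mod _ _).symm, rfl⟩

theorem div_mod_two_pow_of_lt {v c : ℕ} (h : v % 2 ^ (c + 1) < 2 ^ c) :
    v / 2 ^ c = v / 2 ^ (c + 1) + v / 2 ^ (c + 1) ∧ v % 2 ^ c = v % 2 ^ (c + 1) := by
  obtain ⟨hdiv, hmod⟩ := div_mod_two_pow_succ v c
  rcases Nat.mod_two_eq_zero_or_one (v / 2 ^ c) with hdigit | hdigit <;>
    rw [hdigit] at hdiv hmod <;> omega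

theorem div_mod_two_pow_of_le {v c : ℕ} (h : 2 ^ c ≤ v % 2 ^ (c + 1)) :
    v / 2 ^ c = v / 2 ^ (c + 1) + v / 2 ^ (c + 1) + 1 ∧ v % 2 ^ c = v % 2 ^ (c + 1) - 2 ^ c := by
  obtain ⟨hdiv, hmod⟩ := div_mod_two_pow_succ v c
  have := Nat.mod_lt v (Nat.two_pow_pos c)
  rcases Nat.mod_two_eq_zero_or_one (v / 2 ^ c) with hdigit | hdigit <;>
    rw [hdigit] at hdiv hmod <;> omega

theorem divStepProg_runs (s : State d) (u : ℕ → ℕ) {v c : ℕ} (hN : c ≤ N)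
    (hlen : 0 < u Reg.quotientLen) (hc : u Reg.divExp + u Reg.quotientLen = c + 1)
    (hrem : u Reg.dividend = v % 2 ^ (c + 1)) (hquot : u Reg.quotient = v / 2 ^ (c + 1)) :
    Runs k f N divStepProg (NatPost s fun g => g Reg.dividend = v % 2 ^ c ∧
      g Reg.quotient = v / 2 ^ c ∧ g Reg.divExp = u Reg.divExp ∧
      g Reg.quotientLen = u Reg.quotientLen - 1 ∧ AgreesOff 50 u g) { s with nat := u } := by
  refine Runs.assign_seq (Runs.assign_seq (Runs.assign_seq (Runs.bindNat_seq
    (shiftProg_runs _ _ (by grind)) ?_)))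
  rintro g ⟨hshifted, hg⟩
  replace hshifted : g Reg.shifted = 2 ^ c := by
    rw [hshifted, ← show u Reg.divExp + (u Reg.quotientLen - 1) = c by omega]
    simp
  refine Runs.assign_seq (Runs.ite (fun hlt => Runs.skip_nat ?_) fun hle =>
    Runs.assign_seq (Runs.assign_nat ?_))
  · simp only [holds_ltN, val_mem, val_const] at hlt
    obtain ⟨hdiv, hmod⟩ := div_mod_two_pow_of_lt (v := v) (c := c) (by grind)
    grind
  · simp only [holds_ltN, val_mem, val_const] at hle
    obtain ⟨hdiv, hmod⟩ := div_mod_two_pow_of_le (v := v) (c := c) (by grind)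
    simp only [val_add, val_sub, val_mem, val_const] at hg ⊢
    grind

theorem divProg_runs (s : State d) (u : ℕ → ℕ) (hN : u Reg.divExp + u Reg.quotientLen ≤ N)
    (hlt : u Reg.dividend < 2 ^ (u Reg.divExp + u Reg.quotientLen)) :
    Runs k f N divProg (NatPost s fun g =>
      g Reg.dividend = u Reg.dividend % 2 ^ u Reg.divExp ∧
      g Reg.quotient = u Reg.dividend / 2 ^ u Reg.divExp ∧ AgreesOff 50 u g)
      { s with nat := u } := by
  refine Runs.assign_seq (Runs.natLoop (fun j g =>
    g Reg.dividend = u Reg.dividend % 2 ^ (u Reg.divExp + u Reg.quotientLen - j) ∧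
    g Reg.quotient = u Reg.dividend / 2 ^ (u Reg.divExp + u Reg.quotientLen - j) ∧
    g Reg.divExp = u Reg.divExp ∧ g Reg.quotientLen = u Reg.quotientLen - j ∧ AgreesOff 50 u g)
    (u Reg.quotientLen) (by omega) ?_ ?_ ?_)
  · simp [Nat.mod_eq_of_lt hlt, Nat.div_eq_of_lt hlt]
    grind
  · rintro j hj g ⟨hrem, hquot, hexp, hlen, hg⟩
    refine ⟨by grind, (divStepProg_runs s g (v := u Reg.dividend)
      (c := u Reg.divExp + u Reg.quotientLen - (j + 1)) (by omega) (by omega) (by omega)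
      ?_ ?_).bindNat fun g' hg' => ⟨g', rfl, by grind⟩⟩ <;> grind
  · rintro g ⟨hrem, hquot, -, hlen, hg⟩
    refine ⟨by grind, g, rfl, ?_, ?_, hg⟩
    · rw [hrem, Nat.add_sub_cancel]
    · rw [hquot, Nat.add_sub_cancel]

end Arithmetic

/-! ### The program for the generator -/

namespace Reg

/-- The parameter `D` of the generator. -/
abbrev walkScale : ℕ := 6

/-- The parameter `e` of the generator. -/
abbrev errorExp : ℕ := 7

/-- The parameter `h₀` of the generator: half of the length of a block, rounded up. -/
abbrev halfBlock : ℕ := 8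

/-- The level of the generator. -/
abbrev level : ℕ := 4

/-- Half of the length of the seed of the generator. -/
abbrev halfSeed : ℕ := 9

/-- The seed of the generator. -/
abbrev seed : ℕ := 10

/-- The number of the current round, which is the index of the block to be computed. -/
abbrev roundIndex : ℕ := 11

/-- The seed at the current level of the evaluation of the generator, and finally the block. -/
abbrev vertex : ℕ := 30

/-- The current level of the evaluation of the generator. -/
abbrev curLevel : ℕ := 31

/-- The index, at the current level, of the block to be computed. -/
abbrev index : ℕ := 32

/-- Half of the length of the seed at the current level. -/
abbrev halfLen : ℕ := 33

/-- Half of the length of the walk at the current level. -/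
abbrev halfWalkLen : ℕ := 34

/-- The number of bits of a block that still have to be written. -/
abbrev bitIndex : ℕ := 36

/-- The first coordinate of the position of the walk. -/
abbrev posX : ℕ := 40

/-- The second coordinate of the position of the walk. -/
abbrev posY : ℕ := 41

/-- The base-`8` number whose digits label the remaining steps of the walk. -/
abbrev labels : ℕ := 42

/-- The number of the remaining steps of the walk. -/
abbrev steps : ℕ := 43

/-- The number of values of a coordinate. -/
abbrev modulus : ℕ := 44

/-- The label of the current step of the walk. -/
abbrev label : ℕ := 45

/-- The displacement of the moving coordinate. -/
abbrev offset : ℕ := 46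

/-- The coordinate at rest. -/
abbrev atRest : ℕ := 47

/-- The first of the registers that contain the point at which a function is queried. -/
abbrev point : ℕ := 64

end Reg

open Reg

/-- Compute `natDisplacement`. -/
def displacementProg : Prog :=
  .ite (.ltN (reg label) (num 1)) (assign offset (reg atRest + reg atRest))
    (.ite (.ltN (reg label) (num 2)) (assign offset (reg atRest + reg atRest + num 1))
      (.ite (.ltN (reg label) (num 3))
        (assign offset (reg modulus + reg modulus - (reg atRest + reg atRest)))
        (assign offset (reg modulus + reg modulus - (reg atRest + reg atRest + num 1)))))

/-- Reduce the register `a` to the modulus. -/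
def reduceProg (a : ℕ) : Prog :=
  .loop (.not (.ltN (reg a) (reg modulus))) (assign a (reg a - reg modulus))

/-- Move the coordinate in the register `a` by the displacement given by the one in `b`. -/
def moveProg (a b : ℕ) : Prog :=
  assign atRest (reg b) ;; displacementProg ;; assign a (reg a + reg offset) ;; reduceProg a

/-- Compute `natStep`. -/
def stepProg : Prog :=
  .ite (.ltN (reg label) (num 4)) (moveProg posX posY)
    (assign label (reg label - num 4) ;; moveProg posY posX)

/-- Split the next label off and make the step with this label. -/
def walkStepProg : Prog :=
  assign steps (reg steps - num 1) ;; assign dividend (reg labels) ;; assign divExp (num 3) ;;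
  assign quotientLen (reg steps + reg steps + reg steps) ;; divProg ;;
  assign labels (reg quotient) ;; assign label (reg dividend) ;; stepProg

/-- Compute `natWalk`. -/
def walkProg : Prog := .loop (.ltN (num 0) (reg steps)) walkStepProg

/-- Split a vertex into its coordinates. -/
def splitVertexProg : Prog :=
  assign dividend (reg vertex) ;; assign divExp (reg halfLen) ;;
  assign quotientLen (reg halfLen) ;; divProg ;; assign posX (reg quotient) ;;
  assign posY (reg dividend) ;; assign shifted (num 1) ;; assign shiftCount (reg halfLen) ;;
  shiftProg ;; assign modulus (reg shifted)

/-- Compute `numWalk`. -/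
def numWalkProg : Prog :=
  splitVertexProg ;; walkProg ;; assign shifted (reg posX) ;; assign shiftCount (reg halfLen) ;;
  shiftProg ;; assign vertex (reg shifted + reg posY)

/-- Go down one level and compute the lengths for it. -/
def lengthsProg : Prog :=
  assign curLevel (reg curLevel - num 1) ;; assign shifted (reg walkScale) ;;
  assign shiftCount (reg curLevel) ;; shiftProg ;;
  assign halfWalkLen (reg shifted + reg errorExp) ;;
  assign halfWalkLen (reg halfWalkLen + reg halfWalkLen + (reg halfWalkLen + reg halfWalkLen)) ;;
  assign halfLen (reg halfLen - (reg halfWalkLen + reg halfWalkLen + reg halfWalkLen))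

/-- Split a seed into a seed of the next level and the labels of a walk, and compute the number of
blocks of the next level. -/
def splitSeedProg : Prog :=
  assign dividend (reg vertex) ;; assign divExp (reg halfLen + reg halfLen) ;;
  assign quotientLen (reg halfWalkLen + reg halfWalkLen + (reg halfWalkLen + reg halfWalkLen) +
    (reg halfWalkLen + reg halfWalkLen)) ;;
  divProg ;; assign vertex (reg dividend) ;; assign labels (reg quotient) ;;
  assign shifted (num 1) ;; assign shiftCount (reg curLevel) ;; shiftProg

/-- Walk to the seed of the second half of the output if the block is there. -/
def selectProg : Prog :=
  .ite (.ltN (reg index) (reg shifted)) .skip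
    (assign index (reg index - reg shifted) ;; assign steps (reg halfWalkLen + reg halfWalkLen) ;;
      numWalkProg)

/-- Compute `generator`. -/
def generatorProg : Prog :=
  assign vertex (reg seed) ;; assign curLevel (reg level) ;; assign index (reg roundIndex) ;;
  assign halfLen (reg halfSeed) ;;
  .loop (.ltN (num 0) (reg curLevel)) (lengthsProg ;; splitSeedProg ;; selectProg)

/-- Write the next bit of a block. -/
def bitProg : Prog :=
  assign bitIndex (reg bitIndex - num 1) ;; assign shifted (num 1) ;;
  assign shiftCount (reg bitIndex) ;; shiftProg ;;
  .ite (.ltN (reg vertex) (reg shifted)) (.setN (num point + reg bitIndex) (num 0))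
    (assign vertex (reg vertex - reg shifted) ;; .setN (num point + reg bitIndex) (num 1))

/-- Write the bits of a block. -/
def bitsProg : Prog :=
  assign bitIndex (reg halfBlock + reg halfBlock) ;; .loop (.ltN (num 0) (reg bitIndex)) bitProg

section Generator

variable {n d k : ℕ} {f : List (Fin d → ℝ) → Bits n → Fin d → ℝ} {N : ℕ}

theorem displacementProg_runs (s : State d) (u : ℕ → ℕ) :
    Runs k f N displacementProg (NatPost s fun g =>
      g = Function.update u offset (natDisplacement (u modulus) (u label) (u atRest)))
      { s with nat := u } := by
  refine Runs.ite (fun h₀ => Runs.assign_nat ?_) fun h₀ => Runs.ite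
    (fun h₁ => Runs.assign_nat ?_) fun h₁ => Runs.ite
    (fun h₂ => Runs.assign_nat ?_) (fun h₂ => Runs.assign_nat ?_)
  all_goals simp only [holds_ltN, val_add, val_sub, val_mem, val_const, ← two_mul] at *
  · rw [show u label = 0 by omega, natDisplacement]
  · rw [show u label = 1 by omega, natDisplacement]
  · rw [show u label = 2 by omega, natDisplacement]
  · obtain ⟨l, hl⟩ := Nat.exists_eq_add_of_le' (show 3 ≤ u label by omega)
    rw [hl]
    rfl

theorem reduceProg_runs (s : State d) (u : ℕ → ℕ) {a : ℕ} (ha : a ≠ modulus) (hN : 3 ≤ N)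
    (hpos : 0 < u modulus) (h : u a < 3 * u modulus) :
    Runs k f N (reduceProg a) (NatPost s fun g => g = Function.update u a (u a % u modulus))
      { s with nat := u } := by
  have hdiv : u a / u modulus < 3 := by rwa [Nat.div_lt_iff_lt_mul hpos]
  have hmod := Nat.div_add_mod (u a) (u modulus)
  have hlt := Nat.mod_lt (u a) hpos
  refine Runs.natLoop (fun j g => g = Function.update u a (u a - u modulus * j)) (u a / u modulus)
    (by omega) (by simp) ?_ ?_
  · rintro j hj _ rfl
    have hle := Nat.mul_le_mul_left (u modulus) (Nat.succ_le_of_lt hj)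
    rw [Nat.mul_succ] at hle
    refine ⟨?_, Runs.assign_nat ?_⟩ <;>
      simp only [holds_not, holds_ltN, val_sub, val_mem, val_const, Function.update_self,
        Function.update_of_ne ha.symm, Function.update_idem, Nat.mul_succ, Nat.sub_sub]
    omega
  · rintro _ rfl
    refine ⟨?_, _, rfl, by congr 1; omega⟩
    simp only [holds_not, holds_ltN, val_mem, val_const, Function.update_self,
      Function.update_of_ne ha.symm]
    omega

theorem natDisplacement_le {m l y : ℕ} (hy : y < m) : natDisplacement m l y ≤ 2 * m := by
  unfold natDisplacement
  split <;> omega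

theorem moveProg_runs (s : State d) (u : ℕ → ℕ) {a b : ℕ} (ha : a < modulus)
    (hN : 3 ≤ N) (hua : u a < u modulus) (hub : u b < u modulus) :
    Runs k f N (moveProg a b) (NatPost s fun g =>
      AgreesOff label (Function.update u a
        ((u a + natDisplacement (u modulus) (u label) (u b)) % u modulus)) g)
      { s with nat := u } := by
  have hdisp := natDisplacement_le (l := u label) hub
  refine Runs.assign_seq (Runs.bindNat_seq (displacementProg_runs s _) ?_)
  rintro _ rfl
  refine Runs.assign_seq ((reduceProg_runs s _ (by omega) hN ?_ ?_).bindNat ?_)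
  · grind
  · grind
  · rintro _ rfl
    exact ⟨_, rfl, by grind⟩

theorem stepProg_runs (s : State d) (u : ℕ → ℕ) (hN : 3 ≤ N) (hX : u posX < u modulus)
    (hY : u posY < u modulus) :
    Runs k f N stepProg (NatPost s fun g =>
      (g posX, g posY) = natStep (u modulus) (u label) (u posX, u posY) ∧
      g labels = u labels ∧ g steps = u steps ∧ g modulus = u modulus ∧ AgreesOff posX u g)
      { s with nat := u } := by
  refine Runs.ite (fun h => ?_) (fun h => ?_) <;> simp only [holds_ltN, val_mem, val_const] at h
  · refine (moveProg_runs s u (by decide) hN hX hY).bindNat fun g hg => ⟨g, rfl, ?_⟩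
    rw [natStep, if_pos h]
    grind
  · refine Runs.assign_seq ((moveProg_runs s _ (by decide) hN ?_ ?_).bindNat
      fun g hg => ⟨g, rfl, ?_⟩)
    · grind
    · grind
    · rw [natStep, if_neg h]
      grind

theorem walkStepProg_runs (s : State d) (u : ℕ → ℕ) {t : ℕ} (hN : 3 ≤ N) (htN : 3 * (t + 1) ≤ N)
    (ht : u steps = t + 1) (hlabels : u labels < 8 ^ (t + 1)) (hX : u posX < u modulus)
    (hY : u posY < u modulus) :
    Runs k f N walkStepProg (NatPost s fun g => g steps = t ∧ g modulus = u modulus ∧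
      g labels < 8 ^ t ∧ g posX < u modulus ∧ g posY < u modulus ∧
      natWalk (u modulus) t (g labels) (g posX, g posY) =
        natWalk (u modulus) (t + 1) (u labels) (u posX, u posY) ∧ AgreesOff posX u g)
      { s with nat := u } := by
  have pow_eq : (8 : ℕ) ^ (t + 1) = 2 ^ (3 + (t + t + t)) := by
    rw [show (8 : ℕ) = 2 ^ 3 by norm_num, ← pow_mul]
    ring
  refine Runs.assign_seq (Runs.assign_seq (Runs.assign_seq (Runs.assign_seq
    (Runs.bindNat_seq (divProg_runs s _ ?_ ?_) ?_))))
  · grind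
  · simpa [ht, ← pow_eq] using hlabels
  rintro g ⟨hrem, hquot, hg⟩
  simp only [val_add, val_sub, val_mem, val_const] at hrem hquot hg
  obtain ⟨hdigit, hrest, hsteps, hmodulus, hX', hY', hg⟩ :
      g dividend = u labels % 8 ∧ g quotient = u labels / 8 ∧ g steps = t ∧
      g modulus = u modulus ∧ g posX = u posX ∧ g posY = u posY ∧ AgreesOff posX u g := by
    grind
  refine Runs.assign_seq (Runs.assign_seq ((stepProg_runs s _ hN ?_ ?_).bindNat ?_))
  · grind
  · grind
  rintro g' ⟨hstep, hlabels', hsteps', hmodulus', hg'⟩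
  simp only [val_mem, val_const] at hstep hlabels' hsteps' hmodulus' hg'
  refine ⟨g', rfl, ?_⟩
  have hlt := natStep_lt (l := u labels % 8) (p := (u posX, u posY)) ⟨hX, hY⟩
  rw [pow_succ'] at hlabels
  have := Nat.div_lt_of_lt_mul hlabels
  rw [natWalk]
  grind

theorem walkProg_runs (s : State d) (u : ℕ → ℕ) (hN : 3 ≤ N) (hstepsN : 3 * u steps ≤ N)
    (hlabels : u labels < 8 ^ u steps) (hX : u posX < u modulus) (hY : u posY < u modulus) :
    Runs k f N walkProg (NatPost s fun g =>
      (g posX, g posY) = natWalk (u modulus) (u steps) (u labels) (u posX, u posY) ∧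
      AgreesOff posX u g) { s with nat := u } := by
  refine Runs.natLoop (fun j g => g steps = u steps - j ∧ g modulus = u modulus ∧
    g labels < 8 ^ (u steps - j) ∧ g posX < u modulus ∧ g posY < u modulus ∧
    natWalk (u modulus) (u steps - j) (g labels) (g posX, g posY) =
      natWalk (u modulus) (u steps) (u labels) (u posX, u posY) ∧ AgreesOff posX u g)
    (u steps) (by omega) ⟨rfl, rfl, hlabels, hX, hY, rfl, fun _ _ => rfl⟩ ?_ ?_
  · rintro j hj g ⟨hsteps, hmodulus, hlabels, hX, hY, hwalk, hg⟩
    obtain ⟨t, ht⟩ := Nat.exists_eq_add_of_lt hj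
    rw [show u steps - j = t + 1 by omega] at hsteps hlabels hwalk
    rw [show u steps - (j + 1) = t by omega]
    refine ⟨by grind, (walkStepProg_runs s g hN (by omega) hsteps hlabels (by omega)
      (by omega)).bindNat fun g' hg' => ⟨g', rfl, ?_⟩⟩
    rw [hmodulus] at hg'
    grind
  · rintro g ⟨hsteps, -, -, -, -, hwalk, hg⟩
    rw [Nat.sub_self, natWalk] at hwalk
    exact ⟨by grind, g, rfl, hwalk, hg⟩

theorem splitVertexProg_runs (s : State d) (u : ℕ → ℕ) (hN : 2 * u halfLen ≤ N)
    (hvertex : u vertex < 2 ^ (2 * u halfLen)) :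
    Runs k f N splitVertexProg (NatPost s fun g => g posX = u vertex / 2 ^ u halfLen ∧
      g posY = u vertex % 2 ^ u halfLen ∧ g modulus = 2 ^ u halfLen ∧ g labels = u labels ∧
      g steps = u steps ∧ AgreesOff posX u g) { s with nat := u } := by
  refine Runs.assign_seq (Runs.assign_seq (Runs.assign_seq
    (Runs.bindNat_seq (divProg_runs s _ ?_ ?_) ?_)))
  · grind
  · simpa [two_mul] using hvertex
  rintro g ⟨hrem, hquot, hg⟩
  simp only [val_mem, val_const] at hrem hquot hg
  obtain ⟨hrem, hquot, hg⟩ : g dividend = u vertex % 2 ^ u halfLen ∧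
      g quotient = u vertex / 2 ^ u halfLen ∧ AgreesOff 50 u g := by
    grind
  refine Runs.assign_seq (Runs.assign_seq (Runs.assign_seq (Runs.assign_seq
    (Runs.bindNat_seq (shiftProg_runs s _ ?_) ?_))))
  · grind
  rintro g' ⟨hpow, hg'⟩
  simp only [val_mem, val_const] at hpow hg'
  refine Runs.assign_nat ?_
  simp only [val_mem, val_const]
  grind (splits := 20)

theorem numWalkProg_runs (s : State d) (u : ℕ → ℕ) (hN : 3 ≤ N) (hhalfN : 2 * u halfLen ≤ N)
    (hstepsN : 3 * u steps ≤ N) (hvertex : u vertex < 2 ^ (2 * u halfLen))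
    (hlabels : u labels < 8 ^ u steps) :
    Runs k f N numWalkProg (NatPost s fun g => AgreesOff posX
      (Function.update u vertex (numWalk (u halfLen) (u steps) (u labels) (u vertex))) g)
      { s with nat := u } := by
  refine Runs.bindNat_seq (splitVertexProg_runs s u hhalfN hvertex) ?_
  rintro g ⟨hX, hY, hmodulus, hlabels', hsteps, hg⟩
  have hlt := div_mod_lt hvertex
  refine Runs.bindNat_seq (walkProg_runs s g hN ?_ ?_ ?_ ?_) ?_
  · grind
  · grind
  · grind
  · grind
  rintro g' ⟨hwalk, hg'⟩
  rw [hX, hY, hmodulus, hlabels', hsteps] at hwalk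
  refine Runs.assign_seq (Runs.assign_seq (Runs.bindNat_seq (shiftProg_runs s _ ?_) ?_))
  · grind
  rintro g'' ⟨hshifted, hg''⟩
  simp only [val_mem, val_const] at hshifted hg''
  refine Runs.assign_nat ?_
  rw [numWalk, ← hwalk]
  grind

theorem lengthsProg_runs (s : State d) (u : ℕ → ℕ) {D e h₀ i : ℕ} (hN : i ≤ N)
    (hD : u walkScale = D) (he : u errorExp = e) (hlevel : u curLevel = i + 1)
    (hlen : u halfLen = halfLength D e h₀ (i + 1)) :
    Runs k f N lengthsProg (NatPost s fun g => g curLevel = i ∧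
      g halfWalkLen + g halfWalkLen = walkLength D e i ∧ g halfLen = halfLength D e h₀ i ∧
      g vertex = u vertex ∧ g index = u index ∧ AgreesOff vertex u g) { s with nat := u } := by
  rw [halfLength] at hlen
  refine Runs.assign_seq (Runs.assign_seq (Runs.assign_seq
    (Runs.bindNat_seq (shiftProg_runs s _ ?_) ?_)))
  · grind
  rintro g ⟨hpow, hg⟩
  simp only [val_sub, val_mem, val_const] at hpow hg
  obtain ⟨hpow, hlevel', herr, hlen', hvertex, hindex, hg⟩ :
      g shifted = D * 2 ^ i ∧ g curLevel = i ∧ g errorExp = e ∧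
      g halfLen = u halfLen ∧ g vertex = u vertex ∧ g index = u index ∧ AgreesOff vertex u g := by
    grind
  refine Runs.assign_seq (Runs.assign_seq (Runs.assign_nat ?_))
  simp only [val_add, val_sub, val_mem, val_const]
  rw [walkLength]
  grind

theorem splitSeedProg_runs (s : State d) (u : ℕ → ℕ) {t : ℕ} (hlevelN : u curLevel ≤ N)
    (hN : 2 * u halfLen + 3 * t ≤ N) (ht : u halfWalkLen + u halfWalkLen = t)
    (hvertex : u vertex < 8 ^ t * 2 ^ (2 * u halfLen)) :
    Runs k f N splitSeedProg (NatPost s fun g => g vertex = u vertex % 2 ^ (2 * u halfLen) ∧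
      g labels = u vertex / 2 ^ (2 * u halfLen) ∧ g shifted = 2 ^ u curLevel ∧
      g curLevel = u curLevel ∧ g index = u index ∧ g halfLen = u halfLen ∧
      g halfWalkLen = u halfWalkLen ∧ AgreesOff vertex u g) { s with nat := u } := by
  refine Runs.assign_seq (Runs.assign_seq (Runs.assign_seq
    (Runs.bindNat_seq (divProg_runs s _ ?_ ?_) ?_)))
  · grind
  · have pow_eq : 2 ^ (2 * u halfLen + 3 * t) = 8 ^ t * 2 ^ (2 * u halfLen) := by
      rw [pow_add, pow_mul 2 3, mul_comm]
      norm_num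
    rw [← pow_eq] at hvertex
    simp +decide only [val_add, val_mem, val_const, Function.update_of_ne, Function.update_self,
      ne_eq]
    grind
  rintro g ⟨hrem, hquot, hg⟩
  simp +decide only [val_add, val_mem, val_const, Function.update_of_ne, Function.update_self,
    ne_eq, ← two_mul] at hrem hquot hg
  replace hg : AgreesOff 50 u g := by grind
  refine Runs.assign_seq (Runs.assign_seq (Runs.assign_seq (Runs.assign_seq
    ((shiftProg_runs s _ ?_).bindNat ?_))))
  · grind
  rintro g' ⟨hpow, hg'⟩
  simp +decide only [val_mem, val_const, Function.update_of_ne, Function.update_self, ne_eq]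
    at hpow hg'
  exact ⟨g', rfl, by grind⟩

theorem selectProg_runs (s : State d) (u : ℕ → ℕ) {t : ℕ} (hN : 3 ≤ N)
    (hlenN : 2 * u halfLen ≤ N) (htN : 3 * t ≤ N) (ht : u halfWalkLen + u halfWalkLen = t)
    (hvertex : u vertex < 2 ^ (2 * u halfLen)) (hlabels : u labels < 8 ^ t) :
    Runs k f N selectProg (NatPost s fun g =>
      (g vertex, g index) = (if u shifted ≤ u index then
        (numWalk (u halfLen) t (u labels) (u vertex), u index - u shifted)
        else (u vertex, u index)) ∧
      g curLevel = u curLevel ∧ g halfLen = u halfLen ∧ AgreesOff vertex u g)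
      { s with nat := u } := by
  refine Runs.ite (fun h => Runs.skip_nat ?_) (fun h => Runs.assign_seq (Runs.assign_seq
    ((numWalkProg_runs s _ hN ?_ ?_ ?_ ?_).bindNat fun g hg => ⟨g, rfl, ?_⟩)))
  all_goals simp only [holds_ltN, val_mem, val_const, not_lt] at h
  · exact ⟨by rw [if_neg h.not_ge], rfl, rfl, fun _ _ => rfl⟩
  · grind
  · grind
  · grind
  · grind
  · simp only [val_add, val_sub, val_mem, val_const] at hg
    rw [if_pos h]
    grind

theorem halfLength_mono (D e h₀ : ℕ) : Monotone (halfLength D e h₀) :=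
  monotone_nat_of_le_succ fun _ => Nat.le_add_right _ _

theorem generatorStep_runs (s : State d) (u : ℕ → ℕ) {D e h₀ i : ℕ} (hN : 3 ≤ N) (hiN : i ≤ N)
    (hlenN : 2 * u halfLen ≤ N) (hD : u walkScale = D) (he : u errorExp = e)
    (hlevel : u curLevel = i + 1) (hlen : u halfLen = halfLength D e h₀ (i + 1))
    (hvertex : u vertex < 2 ^ (2 * u halfLen)) :
    Runs k f N (lengthsProg ;; splitSeedProg ;; selectProg) (NatPost s fun g => g curLevel = i ∧
      g halfLen = halfLength D e h₀ i ∧ g vertex < 2 ^ (2 * g halfLen) ∧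
      generator D e h₀ i (g vertex) (g index) =
        generator D e h₀ (i + 1) (u vertex) (u index) ∧
      AgreesOff vertex u g) { s with nat := u } := by
  have hN' : 2 * halfLength D e h₀ i + 3 * walkLength D e i ≤ N := by
    rw [hlen, halfLength] at hlenN
    rw [walkLength]
    omega
  rw [hlen, two_pow_halfLength_succ] at hvertex
  refine Runs.bindNat_seq (lengthsProg_runs s u hiN hD he hlevel hlen) ?_
  rintro g ⟨hlevel₁, hwalk₁, hlen₁, hvertex₁, hindex₁, hg₁⟩
  refine Runs.bindNat_seq (splitSeedProg_runs s g (by omega) (by rwa [hlen₁]) hwalk₁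
    (by rwa [hvertex₁, hlen₁])) ?_
  rintro g' ⟨hvertex₂, hlabels₂, hpow₂, hlevel₂, hindex₂, hlen₂, hwalk₂, hg₂⟩
  rw [hlen₁, hvertex₁] at hvertex₂ hlabels₂
  rw [hlen₁] at hlen₂
  have hmod := Nat.mod_lt (u vertex) (Nat.two_pow_pos (2 * halfLength D e h₀ i))
  have hdiv := Nat.div_lt_of_lt_mul (mul_comm (8 ^ _) (2 ^ _) ▸ hvertex)
  refine (selectProg_runs s g' (t := walkLength D e i) hN (by rw [hlen₂]; omega) (by omega)
    (by rw [hwalk₂, hwalk₁]) (by rwa [hvertex₂, hlen₂]) (by rwa [hlabels₂])).bindNat ?_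
  rintro g'' ⟨hsel, hlevel₃, hlen₃, hg₃⟩
  have hlt := numWalk_lt (t := walkLength D e i)
    (y := u vertex / 2 ^ (2 * halfLength D e h₀ i)) hmod
  refine ⟨g'', rfl, by omega, by rw [hlen₃, hlen₂], ?_, ?_, by grind⟩
  · rw [hlen₃, hlen₂]
    grind
  · rw [generator]
    grind

theorem generatorProg_runs (s : State d) (u : ℕ → ℕ) (hN : 3 ≤ N) (hlevelN : u level ≤ N)
    (hlen : u halfSeed = halfLength (u walkScale) (u errorExp) (u halfBlock) (u level))
    (hlenN : 2 * u halfSeed ≤ N) (hseed : u seed < 2 ^ (2 * u halfSeed)) :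
    Runs k f N generatorProg (NatPost s fun g => g vertex = generator (u walkScale) (u errorExp)
        (u halfBlock) (u level) (u seed) (u roundIndex) ∧ AgreesOff vertex u g)
      { s with nat := u } := by
  set G := generator (u walkScale) (u errorExp) (u halfBlock)
  set H := halfLength (u walkScale) (u errorExp) (u halfBlock)
  refine Runs.assign_seq (Runs.assign_seq (Runs.assign_seq (Runs.assign_seq ?_)))
  simp only [val_mem, val_const]
  refine Runs.natLoop (fun j g => g curLevel = u level - j ∧ g halfLen = H (u level - j) ∧
    g vertex < 2 ^ (2 * g halfLen) ∧
    G (u level - j) (g vertex) (g index) = G (u level) (u seed) (u roundIndex) ∧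
    AgreesOff vertex u g) (u level) hlevelN (by grind) ?_ ?_
  · rintro j hj g ⟨hlevel, hlen', hvertex, hgen, hg⟩
    obtain ⟨i, hi⟩ : ∃ i, u level - j = i + 1 := ⟨u level - j - 1, by omega⟩
    have hmono : H (i + 1) ≤ H (u level) := halfLength_mono _ _ _ (by omega)
    rw [hi] at hlevel hlen' hgen
    rw [show u level - (j + 1) = i by omega]
    refine ⟨by grind, (generatorStep_runs s g hN (by omega) (by omega) (by grind) (by grind)
      hlevel hlen' hvertex).bindNat fun g' hg' => ⟨g', rfl, by grind⟩⟩
  · rintro g ⟨hlevel, -, -, hgen, hg⟩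
    rw [Nat.sub_self] at hgen
    exact ⟨by grind, g, rfl, hgen, hg⟩

theorem bitProg_runs (s : State d) (u : ℕ → ℕ) {v c : ℕ} (hN : c ≤ N) (hindex : u bitIndex = c + 1)
    (hv : u vertex = v % 2 ^ (c + 1)) :
    Runs k f N bitProg (NatPost s fun g => g bitIndex = c ∧ g vertex = v % 2 ^ c ∧
      g (point + c) = (v.testBit c).toNat ∧ ∀ a, a < vertex ∨ point + c < a → g a = u a)
      { s with nat := u } := by
  refine Runs.assign_seq (Runs.assign_seq (Runs.assign_seq
    (Runs.bindNat_seq (shiftProg_runs s _ ?_) ?_)))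
  · grind
  rintro g ⟨hpow, hg⟩
  simp only [val_sub, val_mem, val_const] at hpow hg
  obtain ⟨hpow, hindex', hv', hg⟩ : g shifted = 2 ^ c ∧ g bitIndex = c ∧
      g vertex = v % 2 ^ (c + 1) ∧ AgreesOff vertex u g := by
    grind
  have hbit := Nat.testBit_eq_decide_div_mod_eq (x := v) (i := c)
  refine Runs.ite (fun h => Runs.setN ⟨_, rfl, ?_⟩)
    (fun h => Runs.assign_seq (Runs.setN ⟨_, rfl, ?_⟩))
  all_goals simp only [holds_ltN, val_mem, val_const, hpow, hv', not_lt] at h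
  · obtain ⟨hdiv, hmod⟩ := div_mod_two_pow_of_lt h
    simp only [val_add, val_mem, val_const]
    grind
  · obtain ⟨hdiv, hmod⟩ := div_mod_two_pow_of_le h
    simp only [val_add, val_sub, val_mem, val_const]
    grind

theorem bitsProg_runs (s : State d) (u : ℕ → ℕ) (hN : 2 * u halfBlock ≤ N)
    (hvertex : u vertex < 2 ^ (2 * u halfBlock)) :
    Runs k f N bitsProg (NatPost s fun g =>
      (∀ q < 2 * u halfBlock, g (point + q) = ((u vertex).testBit q).toNat) ∧
      ∀ a < vertex, g a = u a) { s with nat := u } := by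
  refine Runs.assign_seq ?_
  simp only [val_add, val_mem, val_const, ← two_mul]
  refine Runs.natLoop (fun j g => g bitIndex = 2 * u halfBlock - j ∧
    g vertex = u vertex % 2 ^ (2 * u halfBlock - j) ∧
    (∀ q, 2 * u halfBlock - j ≤ q → q < 2 * u halfBlock →
      g (point + q) = ((u vertex).testBit q).toNat) ∧
    ∀ a < vertex, g a = u a) (2 * u halfBlock) hN ?_ ?_ ?_
  · rw [Nat.sub_zero, Nat.mod_eq_of_lt hvertex]
    grind
  · rintro j hj g ⟨hindex, hrest, hbits, hg⟩
    obtain ⟨c, hc⟩ : ∃ c, 2 * u halfBlock - j = c + 1 := ⟨2 * u halfBlock - j - 1, by omega⟩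
    rw [hc] at hindex hrest hbits
    rw [show 2 * u halfBlock - (j + 1) = c by omega]
    refine ⟨by grind, (bitProg_runs s g (by omega) hindex hrest).bindNat ?_⟩
    rintro g' ⟨hindex', hrest', hbit, hg'⟩
    refine ⟨g', rfl, hindex', hrest', fun q hcq hq => ?_, by grind⟩
    rcases hcq.eq_or_lt with rfl | hlt
    · exact hbit
    · rw [hg' _ (by grind), hbits q hlt hq]
  · rintro g ⟨hindex, -, hbits, hg⟩
    exact ⟨by grind, g, rfl, fun q hq => hbits q (by omega) hq, hg⟩

end Generator

/-! ### The program for rounding -/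

namespace Reg

/-- The dimension `d`. -/
abbrev dim : ℕ := 2

/-- The length `d₀` of a block of coordinates. -/
abbrev blockSize : ℕ := 3

/-- The first coordinate of the current block. -/
abbrev blockStart : ℕ := 20

/-- The first coordinate after the current block. -/
abbrev blockEnd : ℕ := 21

/-- The index of the current shift. -/
abbrev shift : ℕ := 22

/-- Whether the current shift is good for the current block. -/
abbrev good : ℕ := 23

/-- The current coordinate. -/
abbrev coord : ℕ := 24

end Reg

namespace RealReg

/-- The accuracy `ε`. -/
abbrev accuracy : ℕ := 0

/-- The width of the cells. -/
abbrev cell : ℕ := 4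

/-- The length of the current shift. -/
abbrev shiftLength : ℕ := 5

/-- The first of the `d` registers that contain the vector to be rounded. The `d` registers after
these receive the rounded vector. -/
abbrev value : ℕ := 8

end RealReg

open RealReg

/-- The current coordinate of the vector to be rounded. -/
abbrev coordinate : RExpr := .mem (num value + reg coord)

/-- Decide whether the current shift is good for the current block. -/
def checkProg : Prog :=
  assign good (num 1) ;; assign coord (reg blockStart) ;;
    .loop (.ltN (reg coord) (reg blockEnd))
      (.ite (.ltR
            (.roundDown (coordinate - realReg accuracy + realReg shiftLength) (realReg cell))
            (.roundDown (coordinate + realReg accuracy + realReg shiftLength) (realReg cell)))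
          (assign good (num 0)) .skip ;;
        assign coord (reg coord + num 1))

/-- Round the current block with the current shift. -/
def writeProg : Prog :=
  assign coord (reg blockStart) ;;
    .loop (.ltN (reg coord) (reg blockEnd))
      (.setR (num value + reg dim + reg coord)
          (.roundDown (coordinate + realReg shiftLength) (realReg cell)) ;;
        assign coord (reg coord + num 1))

/-- If the current shift is good for the current block, round the block. Go to the next shift. -/
def tryShiftProg : Prog :=
  checkProg ;; .ite (.ltN (num 0) (reg good)) writeProg .skip ;;
    assignReal shiftLength (realReg shiftLength + (realReg accuracy + realReg accuracy)) ;;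
    assign shift (reg shift + num 1)

/-- Round the current block with the last good shift. -/
def blockProg : Prog :=
  assign shift (num 0) ;; assignReal shiftLength (.const 0) ;;
    .loop (.ltN (reg shift) (reg blockSize + num 1)) tryShiftProg

/-- Compute the end of the current block from its start. -/
def blockEndProg : Prog :=
  assign blockEnd (reg blockStart + reg blockSize) ;;
    .ite (.ltN (reg dim) (reg blockEnd)) (assign blockEnd (reg dim)) .skip

/-- Compute `roundVec`. -/
def roundProg : Prog :=
  assign blockStart (num 0) ;;
    .loop (.ltN (reg blockStart) (reg dim))
      (blockEndProg ;; blockProg ;; assign blockStart (reg blockStart + reg blockSize))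

section MemoryRules

variable {n d k : ℕ} {f : List (Fin d → ℝ) → Bits n → Fin d → ℝ} {N : ℕ} {s : State d}
  {Q : State d → Prop} {p q : Prog} {R : (ℕ → ℕ) → (ℕ → ℝ) → Prop} {g : ℕ → ℕ} {ρ : ℕ → ℝ}

/-- The state is `s`, except that its memories satisfy `R`. -/
def MemPost (s : State d) (R : (ℕ → ℕ) → (ℕ → ℝ) → Prop) (s' : State d) : Prop :=
  ∃ g ρ, s' = { s with nat := g, real := ρ } ∧ R g ρ

theorem Runs.bindMem {s' : State d} (h : Runs k f N p (MemPost s R) s')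
    (hQ : ∀ g ρ, R g ρ → Q { s with nat := g, real := ρ }) : Runs k f N p Q s' :=
  h.mono fun _ ⟨g, ρ, hs', hR⟩ => hs' ▸ hQ g ρ hR

theorem Runs.bindMem_seq {s' : State d} (h : Runs k f N p (MemPost s R) s')
    (hQ : ∀ g ρ, R g ρ → Runs k f N q Q { s with nat := g, real := ρ }) :
    Runs k f N (.seq p q) Q s' :=
  Runs.seq (h.bindMem hQ)

theorem Runs.memLoop {b : Test} (I : ℕ → (ℕ → ℕ) → (ℕ → ℝ) → Prop) (c : ℕ) (hc : c ≤ N)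
    (h0 : I 0 g ρ)
    (hstep : ∀ j < c, ∀ g ρ, I j g ρ → b.Holds { s with nat := g, real := ρ } ∧
      Runs k f N p (MemPost s (I (j + 1))) { s with nat := g, real := ρ })
    (hend : ∀ g ρ, I c g ρ → ¬b.Holds { s with nat := g, real := ρ } ∧
      Q { s with nat := g, real := ρ }) :
    Runs k f N (.loop b p) Q { s with nat := g, real := ρ } := by
  refine Runs.loop (fun j => MemPost s (I j)) c hc ⟨g, ρ, rfl, h0⟩ ?_ ?_
  · rintro j hj _ ⟨g, ρ, rfl, hg⟩
    exact hstep j hj g ρ hg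
  · rintro _ ⟨g, ρ, rfl, hg⟩
    exact hend g ρ hg

theorem Runs.assign_mem {a : ℕ} {x : NExpr}
    (h : R (Function.update g a (x.val { s with nat := g, real := ρ })) ρ) :
    Runs k f N (.setN (.const a) x) (MemPost s R) { s with nat := g, real := ρ } :=
  Runs.setN ⟨_, _, rfl, h⟩

theorem Runs.assign_mem_seq {a : ℕ} {x : NExpr}
    (h : Runs k f N q Q { s with
      nat := Function.update g a (x.val { s with nat := g, real := ρ }), real := ρ }) :
    Runs k f N (.seq (.setN (.const a) x) q) Q { s with nat := g, real := ρ } :=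
  Runs.seq (Runs.setN h)

theorem Runs.setR_seq {a : NExpr} {x : RExpr}
    (h : Runs k f N q Q { s with
      nat := g
      real := Function.update ρ (a.val { s with nat := g, real := ρ })
        (x.val { s with nat := g, real := ρ }) }) :
    Runs k f N (.seq (.setR a x) q) Q { s with nat := g, real := ρ } :=
  Runs.seq (Runs.setR h)

end MemoryRules

/-- The memories contain the input of the program for rounding. -/
structure RoundingInput {d : ℕ} (ε : ℝ) (d₀ : ℕ) (v : Fin d → ℝ) (u : ℕ → ℕ) (ρ : ℕ → ℝ) :
    Prop where
  dim_eq : u dim = d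
  blockSize_eq : u blockSize = d₀
  accuracy_eq : ρ accuracy = ε
  cell_eq : ρ cell = cellWidth ε d₀
  value_eq : ∀ j : Fin d, ρ (value + j) = v j

/-- The memories contain the input of the program for rounding, and the current block has the
index `q`. -/
structure RoundingBlock {d : ℕ} (ε : ℝ) (d₀ : ℕ) (v : Fin d → ℝ) (q : ℕ) (u : ℕ → ℕ)
    (ρ : ℕ → ℝ) : Prop extends RoundingInput ε d₀ v u ρ where
  blockStart_eq : u blockStart = q * d₀
  blockEnd_eq : u blockEnd = min (q * d₀ + d₀) d
  blockStart_lt : q * d₀ < d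

/-- The real registers that precede the register `b` are unchanged, except for the length of the
current shift. -/
abbrev RealAgreesBelow (b : ℕ) (ρ ρ' : ℕ → ℝ) : Prop := ∀ a < b, a ≠ shiftLength → ρ' a = ρ a

section Rounding

variable {n d k : ℕ} {f : List (Fin d → ℝ) → Bits n → Fin d → ℝ} {N : ℕ} {ε : ℝ} {d₀ q D : ℕ}
  {v : Fin d → ℝ} {u u' : ℕ → ℕ} {ρ ρ' : ℕ → ℝ}

theorem RoundingInput.of_agree (h : RoundingInput ε d₀ v u ρ) (hu : AgreesOff blockStart u u')
    (hρ : RealAgreesBelow (value + d) ρ ρ') : RoundingInput ε d₀ v u' ρ' where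
  dim_eq := (hu dim (by grind)).trans h.dim_eq
  blockSize_eq := (hu blockSize (by grind)).trans h.blockSize_eq
  accuracy_eq := (hρ accuracy (by grind) (by grind)).trans h.accuracy_eq
  cell_eq := (hρ cell (by grind) (by grind)).trans h.cell_eq
  value_eq j := (hρ (value + j) (by grind) (by grind)).trans (h.value_eq j)

theorem RoundingBlock.of_agree (h : RoundingBlock ε d₀ v q u ρ) (hu : AgreesOff shift u u')
    (hρ : RealAgreesBelow (value + d) ρ ρ') : RoundingBlock ε d₀ v q u' ρ' where
  toRoundingInput := h.toRoundingInput.of_agree (by grind) hρ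
  blockStart_eq := (hu blockStart (by grind)).trans h.blockStart_eq
  blockEnd_eq := (hu blockEnd (by grind)).trans h.blockEnd_eq
  blockStart_lt := h.blockStart_lt

theorem div_eq_iff_mem_block (hd₀ : 1 ≤ d₀) (j : Fin d) :
    (j : ℕ) / d₀ = q ↔ q * d₀ ≤ j ∧ (j : ℕ) < min (q * d₀ + d₀) d := by
  rw [Nat.div_eq_iff hd₀]
  have := j.isLt
  omega

theorem forall_block_iff {P : Fin d → Prop} (hd₀ : 1 ≤ d₀) (h : RoundingBlock ε d₀ v q u ρ) :
    (∀ j : Fin d, (j : ℕ) / d₀ = q → P j) ↔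
      ∀ j : Fin d, u blockStart ≤ j → (j : ℕ) < u blockEnd → P j := by
  simp only [div_eq_iff_mem_block hd₀, h.blockStart_eq, h.blockEnd_eq, and_imp]

theorem forall_fin_lt_succ_iff {P : Fin d → Prop} {a b : ℕ} (hb : b < d) (hab : a ≤ b) :
    (∀ j : Fin d, a ≤ j → (j : ℕ) < b + 1 → P j) ↔
      (∀ j : Fin d, a ≤ j → (j : ℕ) < b → P j) ∧ P ⟨b, hb⟩ := by
  refine ⟨fun h => ⟨fun j ha hlt => h j ha (by omega), h _ hab b.lt_succ_self⟩, ?_⟩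
  rintro ⟨h, h_last⟩ j ha hlt
  rcases Nat.lt_succ_iff_lt_or_eq.mp hlt with hlt | rfl
  · exact h j ha hlt
  · exact h_last

theorem checkProg_runs (s : State d) (h : RoundingBlock ε d₀ v q u s.real) (hd₀ : 1 ≤ d₀)
    (hN : d ≤ N) (hD : s.real shiftLength = D * (2 * ε)) :
    Runs k f N checkProg (NatPost s fun g =>
      (0 < g good ↔ GoodShift ε d₀ v q D) ∧ AgreesOff good u g) { s with nat := u } := by
  have hlt : u blockStart < u blockEnd ∧ u blockEnd ≤ d := by
    have := h.blockStart_lt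
    rw [h.blockStart_eq, h.blockEnd_eq]
    omega
  refine Runs.assign_seq (Runs.assign_seq (Runs.natLoop (fun i g =>
    g coord = u blockStart + i ∧ (0 < g good ↔ ∀ j : Fin d, u blockStart ≤ j →
      (j : ℕ) < u blockStart + i → ¬Straddles ε d₀ D (v j)) ∧ AgreesOff good u g)
    (u blockEnd - u blockStart) (by omega) ?_ ?_ ?_))
  · grind
  · rintro i hi g ⟨hcoord, hgood, hg⟩
    have hcoord_lt : u blockStart + i < d := by omega
    have value_coord := h.value_eq ⟨_, hcoord_lt⟩
    have straddles_iff : (Test.ltR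
        (.roundDown (coordinate - realReg accuracy + realReg shiftLength) (realReg cell))
        (.roundDown (coordinate + realReg accuracy + realReg shiftLength)
          (realReg cell))).Holds { s with nat := g } ↔
        Straddles ε d₀ D (v ⟨_, hcoord_lt⟩) := by
      simp only [holds_ltR, realVal_roundDown, realVal_add, realVal_sub, realVal_mem, val_add,
        val_const, val_mem, hcoord, value_coord, hD, h.accuracy_eq, h.cell_eq, Straddles,
        shiftRound]
    rw [← add_assoc, forall_fin_lt_succ_iff hcoord_lt (by omega)]
    refine ⟨by grind, Runs.seq (Runs.ite (fun hbad => ?_) fun hgood' => ?_)⟩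
    · rw [straddles_iff] at hbad
      refine Runs.setN (Runs.assign_nat ⟨by grind, ?_, by grind⟩)
      grind
    · rw [straddles_iff] at hgood'
      refine Runs.skip (Runs.assign_nat ⟨by grind, ?_, by grind⟩)
      grind
  · rintro g ⟨hcoord, hgood, hg⟩
    rw [Nat.add_sub_cancel' hlt.1.le] at hcoord hgood
    exact ⟨by grind, g, rfl, hgood.trans (forall_block_iff hd₀ h).symm, hg⟩

theorem writeProg_runs (s : State d) (h : RoundingBlock ε d₀ v q u ρ) (hd₀ : 1 ≤ d₀)
    (hN : d ≤ N) (hD : ρ shiftLength = D * (2 * ε)) :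
    Runs k f N writeProg (MemPost s fun g ρ' =>
      (∀ j : Fin d, (j : ℕ) / d₀ = q → ρ' (value + d + j) = shiftRound ε d₀ D (v j)) ∧
        (∀ a < value + d + q * d₀, ρ' a = ρ a) ∧ AgreesOff good u g)
      { s with nat := u, real := ρ } := by
  have hlt : u blockStart < u blockEnd ∧ u blockEnd ≤ d := by
    have := h.blockStart_lt
    rw [h.blockStart_eq, h.blockEnd_eq]
    omega
  simp only [forall_block_iff hd₀ h, ← h.blockStart_eq]
  refine Runs.assign_mem_seq (Runs.memLoop (fun i g ρ' => g coord = u blockStart + i ∧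
    (∀ j : Fin d, u blockStart ≤ j → (j : ℕ) < u blockStart + i →
      ρ' (value + d + j) = shiftRound ε d₀ D (v j)) ∧
    (∀ a < value + d + u blockStart, ρ' a = ρ a) ∧ AgreesOff good u g)
    (u blockEnd - u blockStart) (by omega) ?_ ?_ ?_)
  · grind
  · rintro i hi g ρ' ⟨hcoord, hout, hρ, hg⟩
    have hdim : g dim = d := (hg dim (by grind)).trans h.dim_eq
    have hcoord_lt : u blockStart + i < d := by omega
    have value_coord : ρ' (value + (u blockStart + i)) = v ⟨_, hcoord_lt⟩ := by
      rw [hρ _ (by omega), ← h.value_eq]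
    refine ⟨by grind, Runs.setR_seq (Runs.assign_mem ?_)⟩
    simp only [realVal_roundDown, realVal_add, realVal_mem, val_add, val_const, val_mem, hcoord,
      hdim, value_coord, hρ shiftLength (by grind), hρ cell (by grind), hD, h.cell_eq]
    rw [← shiftRound, ← add_assoc (u blockStart), forall_fin_lt_succ_iff hcoord_lt (by omega)]
    grind
  · rintro g ρ' ⟨hcoord, hout, hρ, hg⟩
    rw [Nat.add_sub_cancel' hlt.1.le] at hcoord hout
    exact ⟨by grind, g, ρ', rfl, hout, hρ, hg⟩

open Classical in
theorem tryShiftProg_runs (s : State d) (h : RoundingBlock ε d₀ v q u ρ) (hd₀ : 1 ≤ d₀)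
    (hN : d ≤ N) (hD : ρ shiftLength = D * (2 * ε)) :
    Runs k f N tryShiftProg (MemPost s fun g ρ' =>
      g shift = u shift + 1 ∧ ρ' shiftLength = (D + 1 : ℕ) * (2 * ε) ∧
        (∀ j : Fin d, (j : ℕ) / d₀ = q → ρ' (value + d + j) =
          if GoodShift ε d₀ v q D then shiftRound ε d₀ D (v j) else ρ (value + d + j)) ∧
        RealAgreesBelow (value + d + q * d₀) ρ ρ' ∧ AgreesOff shift u g)
      { s with nat := u, real := ρ } := by
  have next_shift : D * (2 * ε) + (ε + ε) = (D + 1 : ℕ) * (2 * ε) := by push_cast; ring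
  refine Runs.bindNat_seq (checkProg_runs { s with real := ρ } h hd₀ hN hD) ?_
  rintro g ⟨hgood, hg⟩
  refine Runs.seq (Runs.ite (fun hpos => ?_) fun hzero => ?_)
  · have hD_good : GoodShift ε d₀ v q D := hgood.mp hpos
    refine (writeProg_runs s (h.of_agree (by grind) fun _ _ _ => rfl) hd₀ hN hD).bindMem ?_
    rintro g' ρ' ⟨hout, hρ, hg'⟩
    refine Runs.setR_seq (Runs.assign_mem ⟨by grind, ?_, ?_, by grind, by grind⟩)
    · simp only [val_const, Function.update_self, realVal_add, realVal_mem,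
        hρ accuracy (by grind), hρ shiftLength (by grind), h.accuracy_eq, hD, next_shift]
    · simp only [if_pos hD_good]
      grind
  · have hD_bad : ¬GoodShift ε d₀ v q D := fun hD_good => hzero (hgood.mpr hD_good)
    refine Runs.skip (Runs.setR_seq (Runs.assign_mem ⟨by grind, ?_, ?_, by grind, by grind⟩))
    · simp only [val_const, Function.update_self, realVal_add, realVal_mem, h.accuracy_eq, hD,
        next_shift]
    · simp only [if_neg hD_bad]
      grind

/-- `D'` is the last shift before the shift `D` that is good for the block with index `q`. -/
def IsLastGoodShift (ε : ℝ) (d₀ : ℕ) (v : Fin d → ℝ) (q D D' : ℕ) : Prop :=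
  D' < D ∧ GoodShift ε d₀ v q D' ∧ ∀ D'' < D, D' < D'' → ¬GoodShift ε d₀ v q D''

theorem isLastGoodShift_blockShift (hε : 0 < ε) (hd₀ : 1 ≤ d₀) (v : Fin d → ℝ) (q : ℕ) :
    IsLastGoodShift ε d₀ v q (d₀ + 1) (blockShift ε d₀ v q) := by
  classical
  exact ⟨Nat.lt_succ_of_le (blockShift_le ..), goodShift_blockShift hε hd₀ v q,
    fun D hD hlt => Nat.findGreatest_is_greatest hlt (Nat.le_of_lt_succ hD)⟩

theorem blockProg_runs (s : State d) (hε : 0 < ε) (h : RoundingBlock ε d₀ v q u ρ)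
    (hd₀ : 1 ≤ d₀) (hN : d ≤ N) (hd₀N : d₀ + 1 ≤ N) :
    Runs k f N blockProg (MemPost s fun g ρ' =>
      (∀ j : Fin d, (j : ℕ) / d₀ = q → ρ' (value + d + j) = roundVec ε d₀ v j) ∧
        RealAgreesBelow (value + d + q * d₀) ρ ρ' ∧ AgreesOff shift u g)
      { s with nat := u, real := ρ } := by
  refine Runs.assign_mem_seq (Runs.setR_seq (Runs.memLoop (fun D g ρ' =>
    g shift = D ∧ ρ' shiftLength = D * (2 * ε) ∧
    (∀ D', IsLastGoodShift ε d₀ v q D D' → ∀ j : Fin d, (j : ℕ) / d₀ = q →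
      ρ' (value + d + j) = shiftRound ε d₀ D' (v j)) ∧
    RealAgreesBelow (value + d + q * d₀) ρ ρ' ∧ AgreesOff shift u g) (d₀ + 1) hd₀N ?_ ?_ ?_))
  · refine ⟨by grind, by simp, fun D' hD' => absurd hD'.1 (Nat.not_lt_zero D'), by grind, by grind⟩
  · rintro D hD g ρ' ⟨hshift, hlength, hout, hρ, hg⟩
    have hsize : g blockSize = d₀ := (hg blockSize (by grind)).trans h.blockSize_eq
    refine ⟨by grind, (tryShiftProg_runs s (h.of_agree hg (by grind)) hd₀ hN hlength).bindMem ?_⟩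
    rintro g' ρ'' ⟨hshift', hlength', hout', hρ', hg'⟩
    refine ⟨g', ρ'', rfl, by grind, hlength', ?_, by grind, by grind⟩
    rintro D' ⟨hlt, hgood, hlast⟩ j hj
    rw [hout' j hj]
    rcases Nat.lt_succ_iff_lt_or_eq.mp hlt with hlt | rfl
    · rw [if_neg (hlast D D.lt_succ_self hlt)]
      exact hout D' ⟨hlt, hgood, fun D'' hD'' => hlast D'' (by omega)⟩ j hj
    · rw [if_pos hgood]
  · rintro g ρ' ⟨hshift, -, hout, hρ, hg⟩
    have hsize : g blockSize = d₀ := (hg blockSize (by grind)).trans h.blockSize_eq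
    refine ⟨by grind, g, ρ', rfl, fun j hj => ?_, hρ, hg⟩
    rw [roundVec, roundLike, hj]
    exact hout _ (isLastGoodShift_blockShift hε hd₀ v q) j hj

theorem lt_ceilDiv_iff {m : ℕ} (hd₀ : 1 ≤ d₀) : q < m ⌈/⌉ d₀ ↔ q * d₀ < m := by
  rw [← not_le, ceilDiv_le_iff_le_mul hd₀, not_le, mul_comm]

theorem ceilDiv_le_self {m : ℕ} (hd₀ : 1 ≤ d₀) : m ⌈/⌉ d₀ ≤ m := by
  rw [ceilDiv_le_iff_le_mul hd₀]
  exact Nat.le_mul_of_pos_left m hd₀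

theorem blockEndProg_runs (s : State d) (u : ℕ → ℕ) : Runs k f N blockEndProg (NatPost s fun g =>
    g blockEnd = min (u blockStart + u blockSize) (u dim) ∧ AgreesOff blockEnd u g)
    { s with nat := u } := by
  refine Runs.assign_seq (Runs.ite (fun hlt => Runs.assign_nat ?_) fun hge => Runs.skip_nat ?_) <;>
    grind

theorem blockProg_advance_runs (s : State d) (hε : 0 < ε) (h : RoundingBlock ε d₀ v q u ρ)
    (hd₀ : 1 ≤ d₀) (hN : d ≤ N) (hd₀N : d₀ + 1 ≤ N)
    (hout : ∀ j : Fin d, j < q * d₀ → ρ (value + d + j) = roundVec ε d₀ v j) :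
    Runs k f N (blockProg ;; assign blockStart (reg blockStart + reg blockSize))
      (MemPost s fun g ρ' => g blockStart = (q + 1) * d₀ ∧
        (∀ j : Fin d, j < (q + 1) * d₀ → ρ' (value + d + j) = roundVec ε d₀ v j) ∧
        RealAgreesBelow (value + d) ρ ρ' ∧ AgreesOff blockStart u g)
      { s with nat := u, real := ρ } := by
  have next_block : q * d₀ + d₀ = (q + 1) * d₀ := (Nat.succ_mul q d₀).symm
  refine Runs.bindMem_seq (blockProg_runs s hε h hd₀ hN hd₀N) ?_
  rintro g ρ' ⟨hblock, hρ, hg⟩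
  have hstart : g blockStart = q * d₀ := (hg blockStart (by grind)).trans h.blockStart_eq
  have hsize : g blockSize = d₀ := (hg blockSize (by grind)).trans h.blockSize_eq
  refine Runs.assign_mem ⟨by grind, fun j hj => ?_, by grind, by grind⟩
  rcases lt_or_ge (j : ℕ) (q * d₀) with hlt | hge
  · grind
  · exact hblock j ((div_eq_iff_mem_block hd₀ j).mpr ⟨hge, by omega⟩)

theorem roundProg_runs (s : State d) (hε : 0 < ε) (h : RoundingInput ε d₀ v u ρ) (hd₀ : 1 ≤ d₀)
    (hN : d ≤ N) (hd₀N : d₀ + 1 ≤ N) :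
    Runs k f N roundProg (MemPost s fun g ρ' =>
      (∀ j : Fin d, ρ' (value + d + j) = roundVec ε d₀ v j) ∧
        RealAgreesBelow (value + d) ρ ρ' ∧ AgreesOff blockStart u g)
      { s with nat := u, real := ρ } := by
  refine Runs.assign_mem_seq (Runs.memLoop (fun q g ρ' => g blockStart = q * d₀ ∧
    (∀ j : Fin d, j < q * d₀ → ρ' (value + d + j) = roundVec ε d₀ v j) ∧
    RealAgreesBelow (value + d) ρ ρ' ∧ AgreesOff blockStart u g) (d ⌈/⌉ d₀)
    ((ceilDiv_le_self hd₀).trans hN) (by grind) ?_ ?_)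
  · rintro q hq g ρ' ⟨hstart, hout, hρ, hg⟩
    have hlt := (lt_ceilDiv_iff hd₀).mp hq
    have hinput := h.of_agree hg hρ
    have hdim := hinput.dim_eq
    have hsize := hinput.blockSize_eq
    refine ⟨by grind, Runs.bindNat_seq (blockEndProg_runs { s with real := ρ' } g) ?_⟩
    rintro g' ⟨hend, hg'⟩
    have hblock : RoundingBlock ε d₀ v q g' ρ' :=
      { hinput.of_agree (by grind) fun _ _ _ => rfl with
        blockStart_eq := by grind
        blockEnd_eq := by grind
        blockStart_lt := hlt }
    refine (blockProg_advance_runs s hε hblock hd₀ hN hd₀N hout).bindMem ?_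
    rintro g'' ρ'' ⟨hstart', hout', hρ', hg''⟩
    exact ⟨g'', ρ'', rfl, hstart', hout', by grind, by grind⟩
  · rintro g ρ' ⟨hstart, hout, hρ, hg⟩
    have hdim := (h.of_agree hg hρ).dim_eq
    have hle : d ≤ d ⌈/⌉ d₀ * d₀ := not_lt.mp fun hlt => lt_irrefl _ ((lt_ceilDiv_iff hd₀).mpr hlt)
    exact ⟨by grind, g, ρ', rfl, fun j => hout j (by omega), hρ, hg⟩

end Rounding

/-! ### The program for the initialization -/

namespace Reg

/-- The number `n` of bits of a point. -/
abbrev bitCount : ℕ := 0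

/-- The number `k` of rounds. -/
abbrev roundCount : ℕ := 1

/-- The binary logarithm of the number of shifts, rounded up. -/
abbrev shiftExp : ℕ := 5

/-- The argument of `clogProg`. This is the first of the registers for intermediate values of the
initialization. -/
abbrev argument : ℕ := 12

/-- The current power of two, or a multiple of it. -/
abbrev power : ℕ := 13

/-- The exponent of the current power of two. -/
abbrev exponent : ℕ := 14

/-- The counter of a loop. -/
abbrev counter : ℕ := 15

/-- The next term of a sum. -/
abbrev term : ℕ := 16

/-- The random bit that was read last. -/
abbrev coinBit : ℕ := 17

end Reg

namespace RealReg

/-- The bound `γ` for the additional probability of failure. -/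
abbrev confidence : ℕ := 2

/-- The product of `γ` and a power of two. -/
abbrev scaledConfidence : ℕ := 3

end RealReg

/-- Compute the binary logarithm, rounded up. -/
def clogProg : Prog :=
  assign exponent (num 0) ;; assign power (num 1) ;;
    .loop (.ltN (reg power) (reg argument))
      (assign power (reg power + reg power) ;; assign exponent (reg exponent + num 1))

/-- Compute the product of the number of blocks and `shiftExp`. -/
def walkScaleProg : Prog :=
  assign walkScale (num 0) ;; assign counter (num 0) ;;
    .loop (.ltN (reg counter) (reg dim))
      (assign walkScale (reg walkScale + reg shiftExp) ;;
        assign counter (reg counter + reg blockSize))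

/-- Compute the sum of `level` and the binary logarithm of `1 / γ`, rounded up. -/
def errorExpProg : Prog :=
  assign errorExp (reg level) ;; assignReal scaledConfidence (realReg confidence) ;;
    .loop (.ltR (realReg scaledConfidence) (.const 1))
      (assignReal scaledConfidence (realReg scaledConfidence + realReg scaledConfidence) ;;
        assign errorExp (reg errorExp + num 1))

/-- Compute half of the number of bits of a point, rounded up. -/
def halfBlockProg : Prog :=
  assign halfBlock (num 0) ;;
    .loop (.ltN (reg halfBlock + reg halfBlock) (reg bitCount))
      (assign halfBlock (reg halfBlock + num 1))

/-- Compute half of the length of the seed of the generator. -/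
def halfSeedProg : Prog :=
  assign halfSeed (reg halfBlock) ;; assign power (reg walkScale) ;; assign counter (num 0) ;;
    .loop (.ltN (reg counter) (reg level))
      (assign term (reg power + reg errorExp) ;; assign term (reg term + reg term + reg term) ;;
        assign halfSeed (reg halfSeed + (reg term + reg term + reg term + reg term)) ;;
        assign power (reg power + reg power) ;; assign counter (reg counter + num 1))

/-- Draw the seed of the generator. -/
def seedProg : Prog :=
  assign seed (num 0) ;; assign counter (num 0) ;;
    .loop (.ltN (reg counter) (reg halfSeed + reg halfSeed))
      (.coin (num coinBit) ;; assign seed (reg seed + reg seed + reg coinBit) ;;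
        assign counter (reg counter + num 1))

/-- Compute the width of the cells. -/
def cellProg : Prog :=
  assign counter (num 0) ;; assignReal cell (.const 0) ;;
    .loop (.ltN (reg counter) (reg blockSize + num 1))
      (assignReal cell (realReg cell + (realReg accuracy + realReg accuracy)) ;;
        assign counter (reg counter + num 1))

/-- The registers that precede those for the intermediate values of the initialization are
unchanged, except for the register `c`. -/
abbrev AgreesExcept (c : ℕ) (g g' : ℕ → ℕ) : Prop := ∀ a < argument, a ≠ c → g' a = g a

/-- The binary logarithm of `1 / γ`, rounded up. -/
def logInvCeil (γ : ℝ) : ℕ := ⌈Real.logb 2 (1 / γ)⌉₊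

section Initialization

variable {n d k : ℕ} {f : List (Fin d → ℝ) → Bits n → Fin d → ℝ} {N : ℕ}

theorem clogProg_runs (s : State d) (u : ℕ → ℕ) (hN : u argument ≤ N) :
    Runs k f N clogProg (NatPost s fun g =>
      g exponent = Nat.clog 2 (u argument) ∧ AgreesExcept exponent u g) { s with nat := u } := by
  have clog_le : Nat.clog 2 (u argument) ≤ N :=
    (Nat.clog_le_of_le_pow Nat.lt_two_pow_self.le).trans hN
  refine Runs.assign_seq (Runs.assign_seq (Runs.natLoop (fun j g => g exponent = j ∧
    g power = 2 ^ j ∧ g argument = u argument ∧ AgreesExcept exponent u g) _ clog_le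
    (by grind) ?_ ?_))
  · rintro j hj g ⟨hexp, hpower, harg, hg⟩
    rw [Nat.lt_clog_iff_pow_lt one_lt_two] at hj
    exact ⟨by grind, Runs.assign_seq (Runs.assign_nat (by grind))⟩
  · rintro g ⟨hexp, hpower, harg, hg⟩
    have := Nat.le_pow_clog one_lt_two (u argument)
    exact ⟨by grind, g, rfl, hexp, hg⟩

theorem walkScaleProg_runs (s : State d) (u : ℕ → ℕ) (hN : u dim ≤ N) (hsize : 1 ≤ u blockSize) :
    Runs k f N walkScaleProg (NatPost s fun g =>
      g walkScale = u dim ⌈/⌉ u blockSize * u shiftExp ∧ AgreesExcept walkScale u g)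
      { s with nat := u } := by
  refine Runs.assign_seq (Runs.assign_seq (Runs.natLoop (fun q g =>
    g walkScale = q * u shiftExp ∧ g counter = q * u blockSize ∧ AgreesExcept walkScale u g) _
    ((ceilDiv_le_self hsize).trans hN) (by grind) ?_ ?_))
  · rintro q hq g ⟨hscale, hcounter, hg⟩
    rw [lt_ceilDiv_iff hsize] at hq
    exact ⟨by grind, Runs.assign_seq (Runs.assign_nat (by grind))⟩
  · rintro g ⟨hscale, hcounter, hg⟩
    have := (lt_ceilDiv_iff (m := u dim) hsize).not.mp (lt_irrefl _)
    exact ⟨by grind, g, rfl, hscale, hg⟩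

theorem lt_logInvCeil_iff {γ : ℝ} (hγ : 0 < γ) {j : ℕ} : j < logInvCeil γ ↔ γ * 2 ^ j < 1 := by
  rw [logInvCeil, Nat.lt_ceil, Real.lt_logb_iff_rpow_lt one_lt_two (by positivity),
    Real.rpow_natCast, lt_div_iff₀ hγ, mul_comm]

theorem errorExpProg_runs (s : State d) (u : ℕ → ℕ) (ρ : ℕ → ℝ) (hγ : 0 < ρ confidence)
    (hN : logInvCeil (ρ confidence) ≤ N) :
    Runs k f N errorExpProg (MemPost s fun g ρ' =>
      g errorExp = u level + logInvCeil (ρ confidence) ∧ ρ' accuracy = ρ accuracy ∧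
        AgreesExcept errorExp u g) { s with nat := u, real := ρ } := by
  refine Runs.assign_mem_seq (Runs.setR_seq (Runs.memLoop (fun j g ρ' =>
    g errorExp = u level + j ∧ ρ' scaledConfidence = ρ confidence * 2 ^ j ∧
      ρ' accuracy = ρ accuracy ∧ AgreesExcept errorExp u g) _ hN (by grind) ?_ ?_))
  · rintro j hj g ρ' ⟨herror, hscaled, haccuracy, hg⟩
    rw [lt_logInvCeil_iff hγ] at hj
    exact ⟨by grind, Runs.setR_seq (Runs.assign_mem (by grind))⟩
  · rintro g ρ' ⟨herror, hscaled, haccuracy, hg⟩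
    have := (lt_logInvCeil_iff hγ).not.mp (lt_irrefl _)
    exact ⟨by grind, g, ρ', rfl, herror, haccuracy, hg⟩

theorem halfBlockProg_runs (s : State d) (u : ℕ → ℕ) (hN : u bitCount ≤ N) :
    Runs k f N halfBlockProg (NatPost s fun g =>
      g halfBlock = (u bitCount + 1) / 2 ∧ AgreesExcept halfBlock u g) { s with nat := u } := by
  refine Runs.assign_seq (Runs.natLoop (fun j g => g halfBlock = j ∧ AgreesExcept halfBlock u g)
    ((u bitCount + 1) / 2) (by omega) (by grind) ?_ ?_)
  · rintro j hj g ⟨hhalf, hg⟩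
    exact ⟨by grind, Runs.assign_nat (by grind)⟩
  · rintro g ⟨hhalf, hg⟩
    exact ⟨by grind, g, rfl, hhalf, hg⟩

theorem halfSeedProg_runs (s : State d) (u : ℕ → ℕ) (hN : u level ≤ N) :
    Runs k f N halfSeedProg (NatPost s fun g =>
      g halfSeed = halfLength (u walkScale) (u errorExp) (u halfBlock) (u level) ∧
        AgreesExcept halfSeed u g) { s with nat := u } := by
  refine Runs.assign_seq (Runs.assign_seq (Runs.assign_seq (Runs.natLoop (fun j g =>
    g halfSeed = halfLength (u walkScale) (u errorExp) (u halfBlock) j ∧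
      g power = u walkScale * 2 ^ j ∧ g counter = j ∧ AgreesExcept halfSeed u g) _ hN ?_ ?_ ?_)))
  · grind [halfLength]
  · rintro j hj g ⟨hhalf, hpower, hcounter, hg⟩
    exact ⟨by grind, Runs.assign_seq (Runs.assign_seq (Runs.assign_seq (Runs.assign_seq
      (Runs.assign_nat (by grind [halfLength])))))⟩
  · rintro g ⟨hhalf, -, hcounter, hg⟩
    exact ⟨by grind, g, rfl, hhalf, hg⟩

theorem seedProg_runs (s : State d) (u : ℕ → ℕ) (hN : 2 * u halfSeed ≤ N)
    (hcoins : s.coins.length = 2 * u halfSeed) :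
    Runs k f N seedProg (fun s' => ∃ g, s' = { s with nat := g, coins := [] } ∧
      g seed = coinNumber s.coins 0 ∧ AgreesExcept seed u g) { s with nat := u } := by
  refine Runs.assign_seq (Runs.assign_seq (Runs.loop (fun j s' => ∃ g l,
    s' = { s with nat := g, coins := l } ∧ l.length = 2 * u halfSeed - j ∧
      coinNumber l (g seed) = coinNumber s.coins 0 ∧ g counter = j ∧ AgreesExcept seed u g) _ hN
    ⟨_, s.coins, rfl, by grind⟩ ?_ ?_))
  · rintro j hj _ ⟨g, l, rfl, hl, hseed, hcounter, hg⟩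
    obtain ⟨b, l, rfl⟩ := List.exists_cons_of_length_pos (l := l) (by omega)
    refine ⟨by grind, Runs.seq (Runs.coin rfl (Runs.seq (Runs.setN (Runs.setN
      ⟨_, l, rfl, by grind, ?_, by grind, by grind⟩))))⟩
    rw [← hseed, coinNumber]
    grind
  · rintro _ ⟨g, l, rfl, hl, hseed, hcounter, hg⟩
    obtain rfl := List.eq_nil_of_length_eq_zero (l := l) (by omega)
    exact ⟨by grind, g, rfl, hseed, hg⟩

theorem cellProg_runs (s : State d) (u : ℕ → ℕ) (ρ : ℕ → ℝ) (hN : u blockSize + 1 ≤ N) :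
    Runs k f N cellProg (MemPost s fun g ρ' =>
      ρ' cell = cellWidth (ρ accuracy) (u blockSize) ∧ ρ' accuracy = ρ accuracy ∧
        ∀ a < argument, g a = u a) { s with nat := u, real := ρ } := by
  refine Runs.assign_mem_seq (Runs.setR_seq (Runs.memLoop (fun j g ρ' =>
    g counter = j ∧ ρ' cell = j * (2 * ρ accuracy) ∧ ρ' accuracy = ρ accuracy ∧
      ∀ a < argument, g a = u a) _ hN (by grind) ?_ ?_))
  · rintro j hj g ρ' ⟨hcounter, hcell, haccuracy, hg⟩
    exact ⟨by grind, Runs.setR_seq (Runs.assign_mem (by grind))⟩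
  · rintro g ρ' ⟨hcounter, hcell, haccuracy, hg⟩
    exact ⟨by grind, g, ρ', rfl, by rw [hcell, cellWidth, Nat.cast_succ], haccuracy, hg⟩

end Initialization

/-! ### The steward -/

/-- The binary logarithm, rounded up, of a bound for the number of ways to choose a shift for every
block. It serves as the parameter `D` of the generator. -/
def shiftBits (d d₀ : ℕ) : ℕ := d ⌈/⌉ d₀ * Nat.clog 2 (d₀ + 1)

/-- The parameter `e` of the generator, chosen such that the errors of all the levels of the
generator add up to at most `γ`. -/
def errorExponent (k : ℕ) (γ : ℝ) : ℕ := Nat.clog 2 k + logInvCeil γ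

/-- Half of the number of random bits of the steward. -/
def halfCoins (n k d d₀ : ℕ) (γ : ℝ) : ℕ :=
  halfLength (shiftBits d d₀) (errorExponent k γ) ((n + 1) / 2) (Nat.clog 2 k)

/-- The query of the steward in round `r` when its random bits represent the number `v`. -/
def stewardQuery (n k d d₀ : ℕ) (γ : ℝ) (v r : ℕ) : Bits n :=
  bitsOf n (generator (shiftBits d d₀) (errorExponent k γ) ((n + 1) / 2) (Nat.clog 2 k) v r)

/-- Compute the binary logarithms, rounded up, of the number of rounds and of the number of
shifts. -/
def logsProg : Prog :=
  assign argument (reg roundCount) ;; clogProg ;; assign level (reg exponent) ;;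
    assign argument (reg blockSize + num 1) ;; clogProg ;; assign shiftExp (reg exponent)

/-- Compute the parameters of the generator. -/
def parametersProg : Prog :=
  walkScaleProg ;; errorExpProg ;; halfBlockProg ;; halfSeedProg

/-- Initialize the steward. -/
def initProg : Prog :=
  logsProg ;; parametersProg ;; seedProg ;; cellProg ;; assign roundIndex (num 0)

/-- Compute the point to be queried in the current round. -/
def pointProg : Prog := generatorProg ;; bitsProg

/-- Perform one round of the interaction. -/
def interactionProg : Prog :=
  pointProg ;; .query (num point) (num value) ;; roundProg ;; .answer (num value + reg dim) ;;
    assign roundIndex (reg roundIndex + num 1)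

/-- The one-query steward. -/
def stewardProg : Prog :=
  .ite (.ltN (num 0) (reg roundCount))
    (initProg ;; .loop (.ltN (reg roundIndex) (reg roundCount)) interactionProg) .skip

/-- The memories of the steward at the beginning of round `r`, when its random bits represent the
number `v`. -/
structure StewardMemory (n k d d₀ : ℕ) (ε γ : ℝ) (v r : ℕ) (u : ℕ → ℕ) (ρ : ℕ → ℝ) : Prop where
  roundCount_eq : u roundCount = k
  dim_eq : u dim = d
  blockSize_eq : u blockSize = d₀
  level_eq : u level = Nat.clog 2 k
  walkScale_eq : u walkScale = shiftBits d d₀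
  errorExp_eq : u errorExp = errorExponent k γ
  halfBlock_eq : u halfBlock = (n + 1) / 2
  halfSeed_eq : u halfSeed = halfCoins n k d d₀ γ
  seed_eq : u seed = v
  roundIndex_eq : u roundIndex = r
  accuracy_eq : ρ accuracy = ε
  cell_eq : ρ cell = cellWidth ε d₀

/-- `N` bounds the numbers of passes through the loops of the steward. -/
structure IsLoopBound (n k d d₀ : ℕ) (γ : ℝ) (N : ℕ) : Prop where
  dim_le : n + d + 2 ≤ N
  rounds_le : k ≤ N
  logInvCeil_le : logInvCeil γ ≤ N
  coins_le : 2 * halfCoins n k d d₀ γ ≤ N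

section Steward

variable {n d k : ℕ} {f : List (Fin d → ℝ) → Bits n → Fin d → ℝ} {N d₀ v r : ℕ} {ε δ γ : ℝ}
  {u u' : ℕ → ℕ} {ρ ρ' : ℕ → ℝ}

theorem clog_two_le_self (m : ℕ) : Nat.clog 2 m ≤ m :=
  Nat.clog_le_of_le_pow Nat.lt_two_pow_self.le

theorem StewardMemory.of_agree (h : StewardMemory n k d d₀ ε γ v r u ρ)
    (hu : ∀ a < argument, u' a = u a) (hρ : RealAgreesBelow value ρ ρ') :
    StewardMemory n k d d₀ ε γ v r u' ρ' where
  roundCount_eq := (hu _ (by grind)).trans h.roundCount_eq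
  dim_eq := (hu _ (by grind)).trans h.dim_eq
  blockSize_eq := (hu _ (by grind)).trans h.blockSize_eq
  level_eq := (hu _ (by grind)).trans h.level_eq
  walkScale_eq := (hu _ (by grind)).trans h.walkScale_eq
  errorExp_eq := (hu _ (by grind)).trans h.errorExp_eq
  halfBlock_eq := (hu _ (by grind)).trans h.halfBlock_eq
  halfSeed_eq := (hu _ (by grind)).trans h.halfSeed_eq
  seed_eq := (hu _ (by grind)).trans h.seed_eq
  roundIndex_eq := (hu _ (by grind)).trans h.roundIndex_eq
  accuracy_eq := (hρ _ (by grind) (by grind)).trans h.accuracy_eq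
  cell_eq := (hρ _ (by grind) (by grind)).trans h.cell_eq

theorem StewardMemory.next_round (h : StewardMemory n k d d₀ ε γ v r u ρ) :
    StewardMemory n k d d₀ ε γ v (r + 1) (Function.update u roundIndex (r + 1)) ρ := by
  constructor <;> grind [StewardMemory]

theorem logsProg_runs (s : State d) (u : ℕ → ℕ) (hk : u roundCount ≤ N)
    (hd₀ : u blockSize + 1 ≤ N) :
    Runs k f N logsProg (NatPost s fun g => g level = Nat.clog 2 (u roundCount) ∧
      g shiftExp = Nat.clog 2 (u blockSize + 1) ∧ ∀ a < level, g a = u a)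
      { s with nat := u } := by
  refine Runs.assign_seq (Runs.bindNat_seq (clogProg_runs s _ (by grind)) ?_)
  rintro g ⟨hlog, hg⟩
  refine Runs.assign_seq (Runs.assign_seq (Runs.bindNat_seq (clogProg_runs s _ (by grind)) ?_))
  rintro g' ⟨hlog', hg'⟩
  exact Runs.assign_nat (by grind)

theorem parametersProg_runs (s : State d) (u : ℕ → ℕ) (ρ : ℕ → ℝ) (hγ : 0 < ρ confidence)
    (hdim : u dim ≤ N) (hsize : 1 ≤ u blockSize) (hlog : logInvCeil (ρ confidence) ≤ N)
    (hbits : u bitCount ≤ N) (hlevel : u level ≤ N) :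
    Runs k f N parametersProg (MemPost s fun g ρ' =>
      g walkScale = u dim ⌈/⌉ u blockSize * u shiftExp ∧
      g errorExp = u level + logInvCeil (ρ confidence) ∧ g halfBlock = (u bitCount + 1) / 2 ∧
      g halfSeed = halfLength (g walkScale) (g errorExp) (g halfBlock) (g level) ∧
      ρ' accuracy = ρ accuracy ∧ ∀ a < shiftExp, g a = u a) { s with nat := u, real := ρ } := by
  refine Runs.bindNat_seq (walkScaleProg_runs { s with real := ρ } u hdim hsize) ?_
  rintro g₁ ⟨hscale, hg₁⟩
  refine Runs.bindMem_seq (errorExpProg_runs s g₁ ρ hγ hlog) ?_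
  rintro g₂ ρ' ⟨herror, haccuracy, hg₂⟩
  refine Runs.bindNat_seq (halfBlockProg_runs { s with real := ρ' } g₂ (by grind)) ?_
  rintro g₃ ⟨hhalf, hg₃⟩
  refine (halfSeedProg_runs { s with real := ρ' } g₃ (by grind)).bindNat ?_
  rintro g₄ ⟨hseed, hg₄⟩
  exact ⟨g₄, ρ', rfl, by grind⟩

theorem initProg_runs (hγ : 0 < γ) (hN : IsLoopBound n k d d₀ γ N) (hd₀ : 1 ≤ d₀) (hd : d₀ ≤ d)
    (z : Bits (2 * halfCoins n k d d₀ γ)) :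
    Runs k f N initProg (fun s => s.answers = [] ∧ s.queried = false ∧
      StewardMemory n k d d₀ ε γ (coinNumber (List.ofFn z) 0) 0 s.nat s.real)
      (State.init d [n, k, d, d₀] [ε, δ, γ] z) := by
  obtain ⟨dim_le, rounds_le, logInvCeil_le, coins_le⟩ := hN
  set s := State.init d [n, k, d, d₀] [ε, δ, γ] z
  obtain ⟨hn, hk, hdim, hsize⟩ : s.nat bitCount = n ∧ s.nat roundCount = k ∧ s.nat dim = d ∧
    s.nat blockSize = d₀ := ⟨rfl, rfl, rfl, rfl⟩
  obtain ⟨hε', hγ'⟩ : s.real accuracy = ε ∧ s.real confidence = γ := ⟨rfl, rfl⟩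
  refine Runs.bindNat_seq (logsProg_runs s s.nat (by omega) (by omega)) ?_
  rintro g₁ ⟨hlevel, hexp, hg₁⟩
  have hlevelN := clog_two_le_self k
  refine Runs.bindMem_seq (parametersProg_runs s g₁ s.real (by rwa [hγ']) (by grind) (by grind)
    (by rwa [hγ']) (by grind) (by grind)) ?_
  rintro g₂ ρ ⟨hscale, herror, hhalf, hseedLen, haccuracy, hg₂⟩
  replace hscale : g₂ walkScale = shiftBits d d₀ := by grind [shiftBits]
  replace herror : g₂ errorExp = errorExponent k γ := by grind [errorExponent]
  replace hseedLen : g₂ halfSeed = halfCoins n k d d₀ γ := by grind [halfCoins]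
  refine Runs.seq ((seedProg_runs { s with real := ρ } g₂ (by rwa [hseedLen])
    (by rw [hseedLen]; exact List.length_ofFn)).mono ?_)
  rintro _ ⟨g₃, rfl, hseed, hg₃⟩
  replace hseed : g₃ seed = coinNumber (List.ofFn z) 0 := hseed
  refine Runs.bindMem_seq (cellProg_runs { s with coins := [] } g₃ ρ (by grind)) ?_
  rintro g₄ ρ' ⟨hcell, haccuracy', hg₄⟩
  refine Runs.setN ⟨rfl, rfl, ?_⟩
  constructor <;> grind

theorem readBits_eq_bitsOf (s : State d) {a v : ℕ}
    (h : ∀ q < n, s.nat (a + q) = (v.testBit q).toNat) : s.readBits n a = bitsOf n v := by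
  funext j
  simp only [State.readBits, bitsOf, h j j.isLt]
  cases v.testBit j <;> rfl

theorem pointProg_runs (s : State d) (h : StewardMemory n k d d₀ ε γ v r s.nat s.real)
    (hN : IsLoopBound n k d d₀ γ N) (hd : 1 ≤ d) (hv : v < 2 ^ (2 * halfCoins n k d d₀ γ)) :
    Runs k f N pointProg (NatPost s fun g =>
      State.readBits { s with nat := g } n point = stewardQuery n k d d₀ γ v r ∧
        StewardMemory n k d d₀ ε γ v r g s.real) s := by
  obtain ⟨dim_le, rounds_le, -, coins_le⟩ := hN
  have level_le := clog_two_le_self k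
  have halfBlock_le : (n + 1) / 2 ≤ halfCoins n k d d₀ γ :=
    halfLength_mono (shiftBits d d₀) _ _ (Nat.zero_le (Nat.clog 2 k))
  refine Runs.bindNat_seq (generatorProg_runs s s.nat (by omega) (by grind [StewardMemory]) ?_
    (by grind [StewardMemory]) (by grind [StewardMemory])) ?_
  · rw [h.halfSeed_eq, h.walkScale_eq, h.errorExp_eq, h.halfBlock_eq, h.level_eq, halfCoins]
  rw [h.walkScale_eq, h.errorExp_eq, h.halfBlock_eq, h.level_eq, h.seed_eq, h.roundIndex_eq]
  rintro g ⟨hvertex, hg⟩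
  have hhalf : g halfBlock = (n + 1) / 2 := (hg _ (by grind)).trans h.halfBlock_eq
  refine (bitsProg_runs s g (by omega) ?_).bindNat ?_
  · rw [hvertex, hhalf]
    exact generator_lt _ _ _ _ _ _ hv
  · rintro g' ⟨hbits, hg'⟩
    rw [hvertex, hhalf] at hbits
    exact ⟨g', rfl, readBits_eq_bitsOf _ fun q hq => hbits q (by omega),
      h.of_agree (by grind) fun _ _ _ => rfl⟩

theorem storeVec_of_lt (s : State d) (w : Fin d → ℝ) {a b : ℕ} (h : b < a) :
    s.storeVec a w b = s.real b :=
  dif_neg (by omega)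

theorem storeVec_add (s : State d) (a : ℕ) (w : Fin d → ℝ) (j : Fin d) :
    s.storeVec a w (a + j) = w j := by
  simp [State.storeVec]

theorem interactionProg_runs (s : State d) (hε : 0 < ε) (hN : IsLoopBound n k d d₀ γ N)
    (hd₀ : 1 ≤ d₀) (hd : d₀ ≤ d) (hr : r < k) (hv : v < 2 ^ (2 * halfCoins n k d d₀ γ))
    (hanswers : s.answers = answersTo ε d₀ f (stewardQuery n k d d₀ γ v) r)
    (hqueried : s.queried = false) (h : StewardMemory n k d d₀ ε γ v r s.nat s.real) :
    Runs k f N interactionProg (fun s' =>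
      s'.answers = answersTo ε d₀ f (stewardQuery n k d d₀ γ v) (r + 1) ∧ s'.queried = false ∧
        StewardMemory n k d d₀ ε γ v (r + 1) s'.nat s'.real) s := by
  have hlength : s.answers.length < k := by rwa [hanswers, length_answersTo]
  have dim_le := hN.dim_le
  refine Runs.bindNat_seq (pointProg_runs s h hN (hd₀.trans hd) hv) ?_
  rintro g ⟨hpoint, hg⟩
  refine Runs.seq (Runs.query (by omega) hlength hqueried ?_)
  simp only [val_const, hpoint]
  set w := f s.answers (stewardQuery n k d d₀ γ v r) with hw
  set ρ := State.storeVec { s with nat := g } value w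
  replace hg : StewardMemory n k d d₀ ε γ v r g ρ :=
    hg.of_agree (fun _ _ => rfl) fun a ha _ => storeVec_of_lt _ _ ha
  have hinput : RoundingInput ε d₀ w g ρ :=
    { hg with value_eq := storeVec_add { s with nat := g } value w }
  refine Runs.bindMem_seq (roundProg_runs { s with queried := true } hε hinput hd₀ (by omega)
    (by omega)) ?_
  rintro g' ρ' ⟨hrounded, hρ', hg'⟩
  replace hg : StewardMemory n k d d₀ ε γ v r g' ρ' := hg.of_agree (by grind) (by grind)
  refine Runs.seq (Runs.answer (by omega) hlength rfl (Runs.setN ⟨?_, rfl, ?_⟩))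
  · have readVec_eq : State.readVec { s with nat := g', real := ρ', queried := true }
        (value + d) = roundVec ε d₀ w := funext hrounded
    simp only [val_add, val_mem, val_const, hg.dim_eq]
    rw [answersTo_succ, ← hanswers, ← hw, ← readVec_eq]
  · simp only [val_add, val_mem, val_const, hg.roundIndex_eq]
    exact hg.next_round

theorem stewardProg_runs (hε : 0 < ε) (hγ : 0 < γ) (hN : IsLoopBound n k d d₀ γ N) (hk : 1 ≤ k)
    (hd₀ : 1 ≤ d₀) (hd : d₀ ≤ d) (z : Bits (2 * halfCoins n k d d₀ γ)) :
    Runs k f N stewardProg (fun s => s.answers = answersTo ε d₀ f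
      (stewardQuery n k d d₀ γ (coinNumber (List.ofFn z) 0)) k)
      (State.init d [n, k, d, d₀] [ε, δ, γ] z) := by
  set v := coinNumber (List.ofFn z) 0
  have hv : v < 2 ^ (2 * halfCoins n k d d₀ γ) := coinNumber_ofFn_lt z
  refine Runs.ite (fun _ => Runs.seq ((initProg_runs (ε := ε) hγ hN hd₀ hd z).mono ?_))
    fun hzero => absurd hk hzero
  rintro s ⟨hanswers, hqueried, hmem⟩
  refine Runs.loop (fun r s => s.answers = answersTo ε d₀ f (stewardQuery n k d d₀ γ v) r ∧
    s.queried = false ∧ StewardMemory n k d d₀ ε γ v r s.nat s.real) k hN.rounds_le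
    ⟨hanswers, hqueried, hmem⟩ ?_ ?_
  · rintro r hr s ⟨hanswers, hqueried, hmem⟩
    exact ⟨by grind [StewardMemory],
      interactionProg_runs s hε hN hd₀ hd hr hv hanswers hqueried hmem⟩
  · rintro s ⟨hanswers, -, hmem⟩
    exact ⟨by grind [StewardMemory], hanswers⟩

end Steward

theorem Exec.deterministic {n d k : ℕ} {f : List (Fin d → ℝ) → Bits n → Fin d → ℝ} {p : Prog}
    {s s' s'' : State d} {t t' : ℕ} (h : Exec k f p s t s') (h' : Exec k f p s t' s'') :
    s' = s'' := by
  induction h generalizing t' s'' <;> cases h' <;> grind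

/-! ### The number of random bits and the running time -/

theorem logInv_nonneg (x : ℝ) : 0 ≤ logInv x := le_max_left _ _

theorem logInvCeil_le (γ : ℝ) : (logInvCeil γ : ℝ) ≤ logInv γ + 1 :=
  calc (logInvCeil γ : ℝ) ≤ ⌈logInv γ⌉₊ := by
        exact_mod_cast Nat.ceil_le_ceil (le_max_right 0 (Real.logb 2 (1 / γ)))
    _ ≤ logInv γ + 1 := (Nat.ceil_lt_add_one (logInv_nonneg γ)).le

theorem clog_two_le_logb {m : ℕ} (hm : 1 ≤ m) : (Nat.clog 2 m : ℝ) ≤ 2 * Real.logb 2 m := by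
  rcases hm.eq_or_lt with rfl | hm
  · simp
  have logb_ge : 1 ≤ Real.logb 2 m := by
    rw [Real.le_logb_iff_rpow_le one_lt_two (by positivity), Real.rpow_one]
    exact_mod_cast hm
  have ceil_lt := Nat.ceil_lt_add_one (zero_le_one.trans logb_ge)
  have clog_eq := Real.natCeil_logb_natCast 2 m
  rw [Nat.cast_ofNat] at clog_eq
  rw [clog_eq] at ceil_lt
  linarith

theorem two_pow_clog_le {m : ℕ} (hm : 1 ≤ m) : 2 ^ Nat.clog 2 m ≤ 2 * m := by
  rcases hm.eq_or_lt with rfl | hm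
  · simp
  calc 2 ^ Nat.clog 2 m = 2 * 2 ^ (Nat.clog 2 m).pred := by
        rw [← pow_succ', ← Nat.succ_eq_add_one,
          Nat.succ_pred_eq_of_pos (Nat.clog_pos one_lt_two hm)]
    _ ≤ 2 * m := Nat.mul_le_mul_left 2 (Nat.pow_pred_clog_lt_self one_lt_two hm).le

theorem sq_le_two_mul_two_pow (l : ℕ) : l ^ 2 ≤ 2 * 2 ^ l := by
  rcases Nat.lt_or_ge l 3 with hl | hl
  · interval_cases l <;> norm_num
  induction l, hl using Nat.le_induction with
  | base => norm_num
  | succ l hl ih => rw [pow_succ 2 l]; nlinarith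

theorem sq_clog_two_le {m : ℕ} (hm : 1 ≤ m) : Nat.clog 2 m ^ 2 ≤ 4 * m := by
  linarith [sq_le_two_mul_two_pow (Nat.clog 2 m), two_pow_clog_le hm]

theorem halfLength_le (D e h₀ l : ℕ) : halfLength D e h₀ l ≤ h₀ + 12 * (D * 2 ^ l + e * l) := by
  have closed_form : halfLength D e h₀ l + 12 * D = h₀ + 12 * (D * 2 ^ l + e * l) := by
    induction l with
    | zero => simp [halfLength]
    | succ l ih => rw [halfLength, pow_succ]; linarith
  omega

section Bounds

variable {n k d d₀ : ℕ}

theorem pow_ceilDiv_le_two_pow_shiftBits (d d₀ : ℕ) :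
    (d₀ + 1) ^ (d ⌈/⌉ d₀) ≤ 2 ^ shiftBits d d₀ := by
  rw [shiftBits, mul_comm, pow_mul]
  exact Nat.pow_le_pow_left (Nat.le_pow_clog one_lt_two _) _

theorem two_pow_mul_errorExponent_le (k : ℕ) {γ : ℝ} (hγ : 0 < γ) :
    (2 : ℝ) ^ Nat.clog 2 k * (1 / 2) ^ errorExponent k γ ≤ γ := by
  have hlog : 1 ≤ γ * 2 ^ logInvCeil γ :=
    not_lt.mp ((lt_logInvCeil_iff hγ).not.mp (lt_irrefl _))
  calc (2 : ℝ) ^ Nat.clog 2 k * (1 / 2) ^ errorExponent k γ = 1 / 2 ^ logInvCeil γ := by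
        rw [errorExponent, pow_add, one_div_pow, one_div_pow]
        field_simp
    _ ≤ γ := (div_le_iff₀ (by positivity)).mpr hlog

theorem shiftBits_le (hd₀ : 1 ≤ d₀) (hd : d₀ ≤ d) :
    (shiftBits d d₀ : ℝ) ≤ 4 * (d * Real.logb 2 (d₀ + 1) / d₀) := by
  have blocks_le : ((d ⌈/⌉ d₀ : ℕ) : ℝ) ≤ 2 * (d / d₀) := by
    have : d ⌈/⌉ d₀ * d₀ ≤ 2 * d := (Nat.div_mul_le_self _ _).trans (by omega)
    rw [← mul_div_assoc, le_div_iff₀ (by exact_mod_cast hd₀)]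
    exact_mod_cast this
  have clog_le := clog_two_le_logb (Nat.le_add_left 1 d₀)
  push_cast at clog_le
  calc (shiftBits d d₀ : ℝ) ≤ 2 * (d / d₀) * (2 * Real.logb 2 (d₀ + 1)) := by
        rw [shiftBits, Nat.cast_mul]
        gcongr
    _ = 4 * (d * Real.logb 2 (d₀ + 1) / d₀) := by ring

theorem shiftBits_mul_two_pow_le (hk : 1 ≤ k) (hd₀ : 1 ≤ d₀) (hd : d₀ ≤ d) :
    (shiftBits d d₀ * 2 ^ Nat.clog 2 k : ℝ) ≤ 8 * (k * d * Real.logb 2 (d₀ + 1) / d₀) := by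
  have shift_le := shiftBits_le hd₀ hd
  have pow_le : (2 ^ Nat.clog 2 k : ℝ) ≤ 2 * k := by exact_mod_cast two_pow_clog_le hk
  calc (shiftBits d d₀ * 2 ^ Nat.clog 2 k : ℝ)
      ≤ 4 * (d * Real.logb 2 (d₀ + 1) / d₀) * (2 * k) :=
        mul_le_mul shift_le pow_le (by positivity) ((Nat.cast_nonneg _).trans shift_le)
    _ = 8 * (k * d * Real.logb 2 (d₀ + 1) / d₀) := by ring

theorem errorExponent_mul_clog_le (γ : ℝ) (hk : 1 ≤ k) :
    (errorExponent k γ * Nat.clog 2 k : ℝ) ≤ 8 * k + 2 * (Real.logb 2 k * logInv γ) := by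
  have sq_le : (Nat.clog 2 k : ℝ) ^ 2 ≤ 4 * k := by exact_mod_cast sq_clog_two_le hk
  have clog_le : (Nat.clog 2 k : ℝ) ≤ k := by exact_mod_cast clog_two_le_self k
  calc (errorExponent k γ * Nat.clog 2 k : ℝ)
      = (Nat.clog 2 k : ℝ) ^ 2 + Nat.clog 2 k * logInvCeil γ := by
        rw [errorExponent, Nat.cast_add]; ring
    _ ≤ (Nat.clog 2 k : ℝ) ^ 2 + Nat.clog 2 k * (logInv γ + 1) := by
        gcongr
        exact logInvCeil_le γ
    _ ≤ 8 * k + Nat.clog 2 k * logInv γ := by linarith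
    _ ≤ 8 * k + 2 * Real.logb 2 k * logInv γ := by
        gcongr
        · exact logInv_nonneg γ
        · exact clog_two_le_logb hk
    _ = 8 * k + 2 * (Real.logb 2 k * logInv γ) := by ring

theorem le_mul_logb_div (hd₀ : 1 ≤ d₀) (hd : d₀ ≤ d) :
    (k : ℝ) ≤ k * d * Real.logb 2 (d₀ + 1) / d₀ := by
  have hd₀' : (1 : ℝ) ≤ d₀ := by exact_mod_cast hd₀
  have logb_ge : 1 ≤ Real.logb 2 (d₀ + 1) := by
    rw [Real.le_logb_iff_rpow_le one_lt_two (by positivity), Real.rpow_one]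
    linarith
  rw [le_div_iff₀ (by positivity)]
  calc (k * d₀ : ℝ) ≤ k * d * 1 := by rw [mul_one]; gcongr
    _ ≤ k * d * Real.logb 2 (d₀ + 1) := by gcongr

theorem two_mul_halfCoins_le (n k d d₀ : ℕ) (γ : ℝ) : 2 * halfCoins n k d d₀ γ ≤
    n + 1 + 24 * (shiftBits d d₀ * 2 ^ Nat.clog 2 k + errorExponent k γ * Nat.clog 2 k) := by
  have := halfLength_le (shiftBits d d₀) (errorExponent k γ) ((n + 1) / 2) (Nat.clog 2 k)
  rw [halfCoins]
  omega

theorem two_mul_halfCoins_le_of_le (n : ℕ) (γ : ℝ) (hk : 1 ≤ k) (hd₀ : 1 ≤ d₀) (hd : d₀ ≤ d)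
    {C : ℝ} (hC : 385 ≤ C) : ((2 * halfCoins n k d d₀ γ : ℕ) : ℝ) ≤
      n + C * (k * d * Real.logb 2 (d₀ + 1) / d₀ + Real.logb 2 k * logInv γ) := by
  have coins_le : ((2 * halfCoins n k d d₀ γ : ℕ) : ℝ) ≤ n + 1 +
      24 * (shiftBits d d₀ * 2 ^ Nat.clog 2 k + errorExponent k γ * Nat.clog 2 k) := by
    exact_mod_cast two_mul_halfCoins_le n k d d₀ γ
  have shift_le := shiftBits_mul_two_pow_le hk hd₀ hd
  have error_le := errorExponent_mul_clog_le γ hk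
  have rounds_le := le_mul_logb_div (k := k) hd₀ hd
  have hk' : (1 : ℝ) ≤ k := by exact_mod_cast hk
  have log_nonneg : 0 ≤ Real.logb 2 k * logInv γ :=
    mul_nonneg (Real.logb_nonneg one_lt_two hk') (logInv_nonneg γ)
  set A := k * d * Real.logb 2 (d₀ + 1) / d₀
  set B := Real.logb 2 k * logInv γ
  calc ((2 * halfCoins n k d d₀ γ : ℕ) : ℝ) ≤ n + 385 * (A + B) := by linarith
    _ ≤ n + C * (A + B) := by
        gcongr
        linarith

/-- A bound for the numbers of passes through the loops of the steward that is polynomial in the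
input. -/
def sizeBound (n k d : ℕ) (γ : ℝ) : ℕ := 100 * (n + k + d + logInvCeil γ + 1) ^ 3

theorem le_sizeBound {a : ℕ} {γ : ℝ} (h : a ≤ 100 * (n + k + d + logInvCeil γ + 1)) :
    a ≤ sizeBound n k d γ :=
  h.trans (Nat.mul_le_mul_left _ (Nat.le_self_pow three_ne_zero _))

theorem two_mul_halfCoins_le_sizeBound (n : ℕ) (γ : ℝ) (hk : 1 ≤ k) (hd₀ : 1 ≤ d₀)
    (hd : d₀ ≤ d) : 2 * halfCoins n k d d₀ γ ≤ sizeBound n k d γ := by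
  have coins_le := two_mul_halfCoins_le n k d d₀ γ
  have level_le := clog_two_le_self k
  rw [sizeBound]
  set M := n + k + d + logInvCeil γ + 1
  have shift_le : shiftBits d d₀ * 2 ^ Nat.clog 2 k ≤ M * M * (2 * M) :=
    Nat.mul_le_mul (Nat.mul_le_mul ((ceilDiv_le_self hd₀).trans (by omega))
      ((clog_two_le_self _).trans (by omega))) ((two_pow_clog_le hk).trans (by omega))
  have error_le : errorExponent k γ * Nat.clog 2 k ≤ M * M :=
    Nat.mul_le_mul (by rw [errorExponent]; omega) (by omega)
  have one_le : 1 ≤ M := by omega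
  calc 2 * halfCoins n k d d₀ γ ≤ M + 24 * (M * M * (2 * M) + M * M) := by omega
    _ = 48 * M ^ 3 + 24 * M ^ 2 + M := by ring
    _ ≤ 48 * M ^ 3 + 24 * M ^ 3 + M ^ 3 := by
        gcongr
        · norm_num
        · exact Nat.le_self_pow three_ne_zero M
    _ ≤ 100 * M ^ 3 := by omega

theorem isLoopBound_sizeBound (n : ℕ) (γ : ℝ) (hk : 1 ≤ k) (hd₀ : 1 ≤ d₀) (hd : d₀ ≤ d) :
    IsLoopBound n k d d₀ γ (sizeBound n k d γ) where
  dim_le := le_sizeBound (by omega)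
  rounds_le := le_sizeBound (by omega)
  logInvCeil_le := le_sizeBound (by omega)
  coins_le := two_mul_halfCoins_le_sizeBound n γ hk hd₀ hd

theorem sizeBound_add_three_pow_le (n k d : ℕ) (ε γ : ℝ) (q : ℕ) :
    ((sizeBound n k d γ + 3 : ℕ) : ℝ) ^ q ≤
      803 ^ q * (n + k + d + logInv ε + logInv γ + 1) ^ (3 * q) := by
  have log_le := logInvCeil_le γ
  have logγ_nonneg := logInv_nonneg γ
  have logε_nonneg := logInv_nonneg ε
  set X : ℝ := n + k + d + logInv ε + logInv γ + 1
  have : (0 : ℝ) ≤ n + k + d := by positivity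
  have one_le : 1 ≤ X ^ 3 := one_le_pow₀ (by linarith)
  rw [pow_mul, ← mul_pow]
  gcongr
  calc ((sizeBound n k d γ + 3 : ℕ) : ℝ) = 100 * (n + k + d + logInvCeil γ + 1) ^ 3 + 3 := by
        rw [sizeBound]
        push_cast
        ring
    _ ≤ 100 * (2 * X) ^ 3 + 3 := by
        gcongr
        linarith
    _ ≤ 803 * X ^ 3 := by linarith

end Bounds

/-! ### Success of the steward -/

theorem uniformProb_mono {α : Type} [Fintype α] {E F : Set α} (h : E ⊆ F) :
    uniformProb E ≤ uniformProb F := by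
  rw [uniformProb, uniformProb]
  gcongr
  exact Set.toFinite F

theorem lintegral_uniformProb_le {Ω : Type} [MeasurableSpace Ω] (P : Measure Ω)
    [IsProbabilityMeasure P] {α : Type} [Fintype α] (E : Ω → Set α) {p : ℝ}
    (h : ∀ ω, uniformProb (E ω) ≤ p) :
    ∫⁻ ω, ENNReal.ofReal (uniformProb (E ω)) ∂P ≤ ENNReal.ofReal p := by
  refine (lintegral_mono fun ω => ENNReal.ofReal_le_ofReal (h ω)).trans ?_
  rw [lintegral_const, measure_univ, mul_one]

section Success

variable {n k d d₀ : ℕ} {ε δ γ C : ℝ}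

theorem everBad_of_fails (hε : 0 < ε) (hd₀ : 1 ≤ d₀) {O : Owner n d ε δ} {x : ℕ → Bits n}
    {Y : Fin k → Fin d → ℝ} (hY : List.ofFn Y = answersTo ε d₀ O.func x k) (hC : 4 ≤ C)
    (h : Fails (C * (ε * d₀)) O Y) :
    EverBad (idealStep ε d₀ O) (BadQuery ε k O) k 0 [] x := by
  by_contra hgood
  obtain ⟨i, hi⟩ := h
  have answer_eq : Y i = roundVec ε d₀ (O.func (answersTo ε d₀ O.func x i) (x i)) := by
    rw [← getElem_answersTo (r := k) (by simp [length_answersTo]),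
      ← List.getElem_of_eq hY (by simp), List.getElem_ofFn]
  rw [hY, take_answersTo i.2.le, answer_eq] at hi
  refine hi.not_ge ((norm_roundVec_sub_le_of_not_everBad hε hd₀ hgood i.2).trans ?_)
  exact (cellWidth_le hε hd₀).trans (by gcongr)

theorem answers_eq_answersTo (hε : 0 < ε) (hγ : 0 < γ) (hk : 1 ≤ k) (hd₀ : 1 ≤ d₀) (hd : d₀ ≤ d)
    {O : Owner n d ε δ} {z : Bits (2 * halfCoins n k d d₀ γ)} {t : ℕ} {Y : Fin k → Fin d → ℝ}
    (h : Transcript stewardProg [n, k, d, d₀] [ε, δ, γ] O z t Y) :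
    List.ofFn Y = answersTo ε d₀ O.func
      (stewardQuery n k d d₀ γ (coinNumber (List.ofFn z) 0)) k := by
  obtain ⟨s, hs, hY⟩ := h
  obtain ⟨_, s', hs', -, hanswers⟩ :=
    stewardProg_runs hε hγ (isLoopBound_sizeBound n γ hk hd₀ hd) hk hd₀ hd z
  rw [← hY, hs.deterministic hs', hanswers]

theorem uniformProb_fails_le (hε : 0 < ε) (hγ : 0 < γ) (hk : 1 ≤ k) (hd₀ : 1 ≤ d₀) (hd : d₀ ≤ d)
    (hC : 4 ≤ C) (O : Owner n d ε δ) :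
    uniformProb {z : Bits (2 * halfCoins n k d d₀ γ) | ∃ (t : ℕ) (Y : Fin k → Fin d → ℝ),
      Transcript stewardProg [n, k, d, d₀] [ε, δ, γ] O z t Y ∧ Fails (C * (ε * d₀)) O Y} ≤
      k * δ + γ := by
  have level_le := Nat.le_pow_clog one_lt_two k
  refine (uniformProb_mono ?_).trans (uniformProb_coinNumber_le (card_everBad_idealStep_le hd₀
    (pow_ceilDiv_le_two_pow_shiftBits d d₀) level_le (show n ≤ 2 * ((n + 1) / 2) by omega)
    (two_pow_mul_errorExponent_le k hγ) O))
  rintro z ⟨t, Y, hY, hfails⟩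
  exact (everBad_of_fails hε hd₀ (answers_eq_answersTo hε hγ hk hd₀ hd hY) hC hfails).mono level_le

theorem stewardProg_isOneQuerySteward (hε : 0 < ε) (hγ : 0 < γ) (hk : 1 ≤ k) (hd₀ : 1 ≤ d₀)
    (hd : d₀ ≤ d) (hC : 4 ≤ C) {T : ℝ}
    (hT : ((sizeBound n k d γ + 3 : ℕ) : ℝ) ^ stewardProg.degree ≤ T) :
    IsOneQuerySteward stewardProg [n, k, d, d₀] [ε, δ, γ] n k d ε δ (C * (ε * d₀)) (k * δ + γ)
      (2 * halfCoins n k d d₀ γ) T where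
  halts O z := by
    obtain ⟨t, s, hs, ht, hanswers⟩ := stewardProg_runs (f := O.func) (δ := δ) hε hγ
      (isLoopBound_sizeBound n γ hk hd₀ hd) hk hd₀ hd z
    obtain ⟨Y, hY⟩ : ∃ Y : Fin k → Fin d → ℝ, s.answers = List.ofFn Y := by
      have length_eq : s.answers.length = k := by rw [hanswers, length_answersTo]
      subst length_eq
      exact ⟨s.answers.get, (List.ofFn_get _).symm⟩
    exact ⟨t, Y, ⟨s, hs, hY⟩, (by exact_mod_cast ht : (t : ℝ) ≤ _).trans hT⟩
  correct _ _ P _ O := lintegral_uniformProb_le P _ fun ω =>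
    uniformProb_fails_le hε hγ hk hd₀ hd hC (O ω)

theorem stewardProg_isOneQuerySteward_zero (hγ : 0 < γ) {ε' T : ℝ} (hT : 2 ≤ T) :
    IsOneQuerySteward stewardProg [n, 0, d, d₀] [ε, δ, γ] n 0 d ε δ ε' ((0 : ℕ) * δ + γ) 0 T where
  halts O z :=
    ⟨2, Fin.elim0, ⟨_, .iteFalse _ _ _ _ _ 1 (lt_irrefl 0) (.skip _), rfl⟩, by exact_mod_cast hT⟩
  correct _ _ P _ O := lintegral_uniformProb_le P _ fun ω => by
    refine (uniformProb_mono (F := ∅) ?_).trans ?_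
    · rintro z ⟨_, _, _, i, _⟩
      exact i.elim0
    · simp [uniformProb, hγ.le]

end Success

end RandomnessSteward

end

theorem mainTheorem8 :
    ∃ (S : RandomnessSteward.Prog) (C : ℝ) (c : ℕ),
      ∀ (n k d d₀ : ℕ) (ε δ γ : ℝ), 1 ≤ d₀ → d₀ ≤ d → 0 < ε → 0 < δ → 0 < γ →
        ∃ m : ℕ,
          (m : ℝ) ≤ n + C * (k * d * Real.logb 2 (d₀ + 1) / d₀ +
            Real.logb 2 k * RandomnessSteward.logInv γ) ∧
          RandomnessSteward.IsOneQuerySteward S [n, k, d, d₀] [ε, δ, γ] n k d ε δ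
            (C * (ε * d₀)) (k * δ + γ) m
            (C * (n + k + d + RandomnessSteward.logInv ε + RandomnessSteward.logInv γ + 1) ^ c) := by
  set q := RandomnessSteward.stewardProg.degree
  have constant_le : (803 : ℝ) ≤ 803 ^ q := le_self_pow₀ (by norm_num) (Nat.succ_ne_zero _)
  refine ⟨RandomnessSteward.stewardProg, 803 ^ q, 3 * q, fun n k d d₀ ε δ γ hd₀ hd hε _ hγ => ?_⟩
  have time_le := RandomnessSteward.sizeBound_add_three_pow_le n k d ε γ q
  rcases Nat.eq_zero_or_pos k with rfl | hk
  · have two_le : (2 : ℝ) ≤ ((RandomnessSteward.sizeBound n 0 d γ + 3 : ℕ) : ℝ) ^ q := by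
      exact_mod_cast (Nat.le_add_left 2 _).trans (Nat.le_self_pow (Nat.succ_ne_zero _) _)
    exact ⟨0, by simp,
      RandomnessSteward.stewardProg_isOneQuerySteward_zero hγ (two_le.trans time_le)⟩
  · exact ⟨_, RandomnessSteward.two_mul_halfCoins_le_of_le n γ hk hd₀ hd (by linarith),
      RandomnessSteward.stewardProg_isOneQuerySteward hε hγ hk hd₀ hd (by linarith) time_le⟩
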